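/- Let $p$ be a prime and let $F$ and $C$ be finite extensions of $\mathbb{Q}_p$. Let $\mathcal{O}$ be the ring of integers of $F$, $\varpi$ any uniformizer, $q$ the cardinality of the residue field, $\mathrm{val}$ the normalized valuation and $|x|_F=q^{-\mathrm{val}(x)}$. Let $G=\mathrm{GL}_3(F)$, $K=\mathrm{GL}_3(\mathcal{O})$, $B$ the upper triangular Borel subgroup, and $P=LN$ the standard block upper triangular parabolic subgroup of type $3=2+1$, with Levi subgroup $L=\mathrm{GL}_2(F)\times\mathrm{GL}_1(F)$ having center $Z_L$, and unipotent radical $N$; put $N_0=N\cap K$ and $Z_L^+=\{z\in Z_L: zN_0z^{-1}\subseteq N_0\}$. Let $\chi_1,\chi_2,\chi_3\colon F^\times\to C^\times$ be smooth (locally constant) characters, $\chi=\chi_1\otimes\chi_2\otimes\chi_3$ the corresponding character of the diagonal torus, inflated to $B$, and $\eta_i=\chi_i^{-1}\chi_{i+1}$ for $i=1,2$. Let $(\mathrm{Ind}_B^G\chi)^{\mathrm{sm}}$ be the space of locally constant $f\colon G\to C$ with $f(gb)=\chi(b)^{-1}f(g)$ for $g\in G$, $b\in B$, with $G$ acting by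 $(\gamma f)(g)=f(\gamma^{-1}g)$; define $(\mathrm{Ind}_{B\cap L}^L\chi)^{\mathrm{sm}}$ likewise. For $z\in Z_L^+$ and an $N_0$-invariant $f$ put $\tau_z f=[N_0:zN_0z^{-1}]^{-1}\sum_{n\in N_0/zN_0z^{-1}} nzf$. Let $V=((\mathrm{Ind}_B^G\chi)^{\mathrm{sm}})^{N_0,\,Z_L^+=\chi}$ be the space of $N_0$-invariant $f\in(\mathrm{Ind}_B^G\chi)^{\mathrm{sm}}$ with $\tau_zf=\chi(z)f$ for all $z\in Z_L^+$. Notation. For a smooth character $\eta$ of $F^\times$, $c(\eta)\ge 0$ is the smallest integer $c\ge 0$ such that $\eta$ is trivial on $(1+(\varpi^c))\cap\mathcal{O}^\times$. For a statement $S$, $\delta_S$ is $1$ if $S$ holds and $0$ otherwise; $\mathrm{val}(0)=\infty$. Integrals of locally constant $C$-valued functions are taken for the Haar measure on $F$ giving $\mathcal{O}$ volume $1$. Put $$\dot s_1=\begin{pmatrix}0&-1&0\\1&0&0\\0&0&1\end{pmatrix},\quad \dot s_2=\begin{pmatrix}1&0&0\\0&0&-1\\0&1&0\end{pmatrix},\quad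 \dot w_0=\dot s_1\dot s_2\dot s_1,\quad \ell(a)=\begin{pmatrix}1&0&0\\a&1&0\\0&0&1\end{pmatrix},\quad u(a)=\begin{pmatrix}1&a&0\\0&1&0\\0&0&1\end{pmatrix}.$$ Assume $\eta_2\ne|\cdot|_F^{-1}$ and $\eta_1\eta_2\ne|\cdot|_F^{-2}$. Then restriction of functions from $G$ to $L$ is a $C$-linear isomorphism $\theta\colon V\to(\mathrm{Ind}_{B\cap L}^L\chi)^{\mathrm{sm}}$. Moreover, every $f\in V$ satisfies the following formulas, which express its values at points of the cells $I\dot wB$ (up to left translation by $N_0$ and right translation by $B$; $I\subset K$ the subgroup of matrices that are upper triangular modulo $\varpi$) through $\theta(f)=f|_L$; all integrands (the factor $\eta_2(t)$ in front of a difference being taken to be $0$ at $t=0$) are locally constant. For all $a\in\mathcal{O}$ and $b,c\in(\varpi)$: $$f\begin{pmatrix}1&0&0\\a&1&0\\b&c&1\end{pmatrix}=\delta_{\mathrm{val}(b)\ge c(\eta_1\eta_2)}\int_{\mathcal{O}}\eta_2(1+ct)\,f(\ell(a+bt))\,dt,$$ $$f\left(\begin{pmatrix}1&a&0\\0&1&0\\c&b&1\end{pmatrix}\dot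 s_1\right)=\delta_{\mathrm{val}(b)\ge c(\eta_1\eta_2)}\int_{\mathcal{O}}\eta_2(1+ct)\,f(u(a+bt)\dot s_1)\,dt,$$ $$f\left(\begin{pmatrix}1&0&0\\a&1&0\\c&0&1\end{pmatrix}\dot s_2\right)=\delta_{\mathrm{val}(c)\ge c(\eta_1\eta_2)}\left\{\int_{\mathcal{O}}\eta_2(t)\,[f(\ell(a+ct))-f(\ell(a))]\,dt+\delta_{c(\eta_2)=0}\frac{q-1}{q-\eta_2(\varpi)}f(\ell(a))\right\},$$ $$f\left(\begin{pmatrix}1&a&0\\0&1&0\\0&c&1\end{pmatrix}\dot s_1\dot s_2\right)=\delta_{\mathrm{val}(c)\ge c(\eta_1\eta_2)}\left\{\int_{\mathcal{O}}\eta_2(t)\,[f(u(a-ct)\dot s_1)-f(u(a)\dot s_1)]\,dt+\delta_{c(\eta_2)=0}\frac{q-1}{q-\eta_2(\varpi)}f(u(a)\dot s_1)\right\},$$ $$f(\ell(a)\dot s_2\dot s_1)=\delta_{c(\eta_1\eta_2)=0}\frac{q(q-1)}{q^2-\eta_1\eta_2(\varpi)}\left\{\int_{\mathcal{O}}\eta_2(t)\,[f(\ell(a+t))-f(\ell(a))]\,dt+\delta_{c(\eta_2)=0}\frac{q-1}{q-\eta_2(\varpi)}f(\ell(a))+\int_{(\varpi)}\eta_2(1-at)\,f(u(t)\dot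 s_1)\,dt\right\},$$ $$f(u(a)\dot w_0)=\delta_{c(\eta_1\eta_2)=0}\frac{q(q-1)}{q^2-\eta_1\eta_2(\varpi)}\left\{\int_{\mathcal{O}}\eta_2(t)\,[f(u(a-t)\dot s_1)-f(u(a)\dot s_1)]\,dt+\delta_{c(\eta_2)=0}\frac{q-1}{q-\eta_2(\varpi)}f(u(a)\dot s_1)+\int_{(\varpi)}\eta_2(-1+at)\,f(\ell(t))\,dt\right\}.$$ -/

import Mathlib

open scoped NormedField

namespace GL3Ind

noncomputable section

/-! ### The local field -/

section Field

variable (F : Type*) [NontriviallyNormedField F] [IsUltrametricDist F]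

/-- The ring of integers of `F`, that is, the closed unit ball. -/
abbrev intRing : Subring F := Valued.integer F

/-- The maximal ideal `(ϖ)` of the ring of integers. -/
abbrev maxIdeal : Ideal (intRing F) := IsLocalRing.maximalIdeal (intRing F)

/-- The cardinality `q` of the residue field. -/
def resCard : ℕ := Nat.card (IsLocalRing.ResidueField (intRing F))

variable {F}

/-- The normalized valuation on `Fˣ`: the largest integer `n` with `x ∈ ϖ ^ n 𝒪`. -/
def valF (x : Fˣ) : ℤ :=
  sSup {n : ℤ | ∃ ϖ : intRing F, Irreducible ϖ ∧ ‖(x : F)‖ ≤ ‖(ϖ : F)‖ ^ n}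

variable {C : Type*} [Field C]

variable (C) in
/-- The normalized absolute value `|x|_F = q ^ (- valF x)`, with values in the coefficient field. -/
def absF (x : Fˣ) : C := (resCard F : C) ^ (-valF x)

/-- A character of `Fˣ` as a function on `F`, extended by zero. -/
def extZero (η : Fˣ →* Cˣ) (x : F) : C :=
  open Classical in if h : x = 0 then 0 else (η (Units.mk0 x h) : C)

/-- The conductor: the smallest `c ≥ 0` such that `η` is trivial on `(1 + (ϖ ^ c)) ∩ 𝒪ˣ`. -/
def charConductor (η : Fˣ →* Cˣ) : ℕ :=
  sInf {c : ℕ | ∀ u : (intRing F)ˣ, (u : intRing F) - 1 ∈ maxIdeal F ^ c →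
    η (Units.map (intRing F).subtype.toMonoidHom u) = 1}

/-- The symbol `δ_P`, equal to `1` if `P` holds and to `0` otherwise. -/
def delta (P : Prop) : C := open Classical in if P then 1 else 0

/-- `φ` is invariant under translation by `(ϖ ^ n)`. -/
def IsLevel (φ : intRing F → C) (n : ℕ) : Prop :=
  ∀ x y : intRing F, x - y ∈ maxIdeal F ^ n → φ x = φ y

/-- The integral `∫ φ(t) dt` over the ring of integers of a locally constant `C`-valued function,
for the Haar measure of total mass `1`: the average of `φ` over `𝒪 / (ϖ ^ n)`, for any `n` such
that `φ` is invariant under `(ϖ ^ n)`. It is `0` by convention if `φ` is not locally constant. -/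
def integralO (φ : intRing F → C) : C :=
  open Classical in
  if h : ∃ n, IsLevel φ n then
    (Nat.card (intRing F ⧸ maxIdeal F ^ Nat.find h) : C)⁻¹ *
      ∑ᶠ x : intRing F ⧸ maxIdeal F ^ Nat.find h, φ (Quotient.out x)
  else 0

/-- The restriction of `φ` to `(ϖ)`, extended by zero to the ring of integers. -/
def onMaxIdeal (φ : intRing F → C) (t : intRing F) : C :=
  open Classical in if t ∈ maxIdeal F then φ t else 0

end Field

/-! ### Subgroups of `GL₃(F)` -/

section Groups

variable (F : Type*) [Field F]

/-- The Borel subgroup of upper triangular matrices. -/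
def borelGL : Subgroup (GL (Fin 3) F) where
  carrier := {g | ∀ i j, j < i → g i j = 0}
  one_mem' := fun i j h => by simp [h.ne']
  mul_mem' := by
    intro a b ha hb
    exact Matrix.BlockTriangular.mul (b := id) (M := a.1) (N := b.1)
      (fun i j h => ha i j h) (fun i j h => hb i j h)
  inv_mem' := by
    intro a ha
    have h := Matrix.blockTriangular_inv_of_blockTriangular (b := id) (M := a.1)
      (fun i j h => ha i j h)
    intro i j hij
    have := h hij
    rwa [← Matrix.coe_units_inv] at this

/-- The Levi subgroup `L = GL₂(F) × GL₁(F)` of block diagonal matrices. -/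
def levi : Subgroup (GL (Fin 3) F) where
  carrier := {g | g 0 2 = 0 ∧ g 1 2 = 0 ∧ g 2 0 = 0 ∧ g 2 1 = 0}
  one_mem' := by simp
  mul_mem' := by
    rintro a b ⟨h1, h2, h3, h4⟩ ⟨k1, k2, k3, k4⟩
    simp [Matrix.mul_apply, Fin.sum_univ_three, *]
  inv_mem' := by
    rintro a ⟨h1, h2, h3, h4⟩
    change (a⁻¹).1 0 2 = 0 ∧ (a⁻¹).1 1 2 = 0 ∧ (a⁻¹).1 2 0 = 0 ∧ (a⁻¹).1 2 1 = 0
    rw [Matrix.coe_units_inv, Matrix.inv_def]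
    simp [Matrix.adjugate_fin_three, *]

/-- The unipotent radical `N` of the standard parabolic subgroup with Levi subgroup
`GL₂(F) × GL₁(F)`: only the entries `(1,3)` and `(2,3)` may differ from those of the identity. -/
def unip : Subgroup (GL (Fin 3) F) where
  carrier := {g | ∀ i j, j ≠ 2 ∨ i = 2 → g i j = (1 : Matrix (Fin 3) (Fin 3) F) i j}
  one_mem' := by simp
  mul_mem' := by
    intro a b ha hb i j hij
    have ha' : ∀ i j, j ≠ 2 ∨ i = 2 → a.1 i j = (1 : Matrix (Fin 3) (Fin 3) F) i j := ha
    have hb' : ∀ i j, j ≠ 2 ∨ i = 2 → b.1 i j = (1 : Matrix (Fin 3) (Fin 3) F) i j := hb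
    change (a.1 * b.1) i j = _
    rw [Matrix.mul_apply, Fin.sum_univ_three]
    fin_cases i <;> fin_cases j <;> simp_all
  inv_mem' := by
    intro a ha i j hij
    have ha' : ∀ i j, j ≠ 2 ∨ i = 2 → a.1 i j = (1 : Matrix (Fin 3) (Fin 3) F) i j := ha
    have hd : a.1.det = 1 := by
      rw [Matrix.det_fin_three]
      simp [ha']
    change (a⁻¹).1 i j = _
    rw [Matrix.coe_units_inv, Matrix.inv_def, hd]
    fin_cases i <;> fin_cases j <;> simp_all [Matrix.adjugate_fin_three]

/-- The center `Z_L` of the Levi subgroup, as a subgroup of `GL₃(F)`. -/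
def leviCenter : Subgroup (GL (Fin 3) F) :=
  (Subgroup.center (levi F)).map (levi F).subtype

end Groups

section LocalGroups

variable (F : Type*) [NontriviallyNormedField F] [IsUltrametricDist F]

/-- The maximal compact subgroup `K = GL₃(𝒪)`. -/
def maxCompact : Subgroup (GL (Fin 3) F) :=
  (Matrix.GeneralLinearGroup.map (n := Fin 3) (intRing F).subtype).range

/-- The compact open subgroup `N₀ = N ∩ K` of `N`. -/
def unip₀ : Subgroup (GL (Fin 3) F) := unip F ⊓ maxCompact F

end LocalGroups

/-! ### Induced representations and the Hecke action -/

section Hecke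

variable {G : Type*} [Group G] (C : Type*) [Field C]

/-- The conjugate `g N₀ g⁻¹`. -/
def conjSubgroup (g : G) (N₀ : Subgroup G) : Subgroup G := N₀.map (MulAut.conj g).toMonoidHom

/-- The Hecke operator `τ_ℓ f = [N₀ : ℓ N₀ ℓ⁻¹]⁻¹ ∑ n ℓ f`, the sum being over
`n ∈ N₀ / ℓ N₀ ℓ⁻¹`, on functions on `G` on which `G` acts by `(γ f)(g) = f (γ⁻¹ g)`. It is
meant for `N₀`-invariant functions and for `ℓ` with `ℓ N₀ ℓ⁻¹ ≤ N₀`. -/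
def hecke (N₀ : Subgroup G) (ℓ : G) : (G → C) →ₗ[C] (G → C) where
  toFun f g := ((conjSubgroup ℓ N₀).relIndex N₀ : C)⁻¹ *
    ∑ᶠ n : N₀ ⧸ (conjSubgroup ℓ N₀).subgroupOf N₀, f (ℓ⁻¹ * ((Quotient.out n : N₀) : G)⁻¹ * g)
  map_add' f₁ f₂ := by
    funext g
    by_cases h : Finite (N₀ ⧸ (conjSubgroup ℓ N₀).subgroupOf N₀)
    · simp only [Pi.add_apply]
      rw [finsum_add_distrib (Set.toFinite _) (Set.toFinite _), mul_add]
    · have : (conjSubgroup ℓ N₀).relIndex N₀ = 0 := by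
        rw [not_finite_iff_infinite] at h
        exact Nat.card_eq_zero_of_infinite
      simp [this]
  map_smul' c f := by
    funext g
    by_cases h : Finite (N₀ ⧸ (conjSubgroup ℓ N₀).subgroupOf N₀)
    · simp only [Pi.smul_apply, smul_eq_mul, RingHom.id_apply]
      rw [← mul_finsum _]
      ring
    · have : (conjSubgroup ℓ N₀).relIndex N₀ = 0 := by
        rw [not_finite_iff_infinite] at h
        exact Nat.card_eq_zero_of_infinite
      simp [this]

end Hecke

section Ind

variable {F : Type*} [NontriviallyNormedField F] [IsUltrametricDist F] {C : Type*} [Field C]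

/-- The character `χ = χ₁ ⊗ χ₂ ⊗ χ₃` evaluated on the diagonal of a matrix; for matrices in the
Borel subgroup this is the inflation of the character `χ` of the diagonal torus. -/
def torusChar (χ : Fin 3 → Fˣ →* Cˣ) (g : GL (Fin 3) F) : C := ∏ i, extZero (χ i) (g i i)

/-- The smooth induction `(Ind_B^G χ)^sm`: locally constant functions `f` on `G = GL₃(F)` with
`f (g b) = χ(b)⁻¹ f(g)` for `b ∈ B`. -/
def smoothInd (χ : Fin 3 → Fˣ →* Cˣ) : Submodule C (GL (Fin 3) F → C) where
  carrier := {f | IsLocallyConstant f ∧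
    ∀ g, ∀ b ∈ borelGL F, f (g * b) = (torusChar χ b)⁻¹ * f g}
  zero_mem' := ⟨IsLocallyConstant.const 0, by simp⟩
  add_mem' h₁ h₂ := ⟨h₁.1.add h₂.1, fun g b hb => by
    simp [h₁.2 g b hb, h₂.2 g b hb, mul_add]⟩
  smul_mem' c f h := ⟨h.1.comp (c * ·), fun g b hb => by
    simp only [Pi.smul_apply, smul_eq_mul, h.2 g b hb]; ring⟩

/-- The smooth induction `(Ind_{B ∩ L}^L χ)^sm`. -/
def smoothIndLevi (χ : Fin 3 → Fˣ →* Cˣ) : Submodule C (levi F → C) where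
  carrier := {f | IsLocallyConstant f ∧
    ∀ g, ∀ b : levi F, (b : GL (Fin 3) F) ∈ borelGL F →
      f (g * b) = (torusChar χ (b : GL (Fin 3) F))⁻¹ * f g}
  zero_mem' := ⟨IsLocallyConstant.const 0, by simp⟩
  add_mem' h₁ h₂ := ⟨h₁.1.add h₂.1, fun g b hb => by
    simp [h₁.2 g b hb, h₂.2 g b hb, mul_add]⟩
  smul_mem' c f h := ⟨h.1.comp (c * ·), fun g b hb => by
    simp only [Pi.smul_apply, smul_eq_mul, h.2 g b hb]; ring⟩

/-- The space `((Ind_B^G χ)^sm)^{N₀, Z_L⁺ = χ}` with `N₀ = N ∩ K`: the `N₀`-invariant `f` in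
`(Ind_B^G χ)^sm` with `τ_z f = χ(z) f` for all `z ∈ Z_L` such that `z N₀ z⁻¹ ⊆ N₀`. -/
def eigenInd (χ : Fin 3 → Fˣ →* Cˣ) : Submodule C (GL (Fin 3) F → C) where
  carrier := {f | f ∈ smoothInd χ ∧
    (∀ n ∈ unip₀ F, ∀ g, f (n⁻¹ * g) = f g) ∧
    ∀ z ∈ leviCenter F, conjSubgroup z (unip₀ F) ≤ unip₀ F →
      hecke C (unip₀ F) z f = torusChar χ z • f}
  zero_mem' := ⟨zero_mem _, by simp, by simp⟩
  add_mem' h₁ h₂ := ⟨add_mem h₁.1 h₂.1,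
    fun n hn g => by simp only [Pi.add_apply, h₁.2.1 n hn g, h₂.2.1 n hn g],
    fun z hz hz' => by rw [map_add, h₁.2.2 z hz hz', h₂.2.2 z hz hz', smul_add]⟩
  smul_mem' c f h := ⟨Submodule.smul_mem _ c h.1,
    fun n hn g => by simp only [Pi.smul_apply, h.2.1 n hn g],
    fun z hz hz' => by rw [map_smul, h.2.2 z hz hz', smul_comm]⟩

/-- The map `θ` given by restriction of functions from `G` to `L`. -/
def theta (χ : Fin 3 → Fˣ →* Cˣ) : eigenInd χ →ₗ[C] smoothIndLevi χ where
  toFun f := ⟨fun ℓ => f.1 ℓ, f.2.1.1.comp_continuous continuous_subtype_val,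
    fun g b hb => f.2.1.2 g b hb⟩
  map_add' _ _ := rfl
  map_smul' _ _ := rfl

end Ind

/-! ### Explicit matrices -/

section Matrices

variable {F : Type*} [Field F]

/-- The matrix with rows `(1, 0, 0)`, `(a, 1, 0)`, `(b, c, 1)`. -/
def lowMat (a b c : F) : GL (Fin 3) F :=
  .mkOfDetNeZero !![1, 0, 0; a, 1, 0; b, c, 1] (by simp [Matrix.det_fin_three])

/-- The matrix with rows `(1, a, 0)`, `(0, 1, 0)`, `(c, b, 1)`. -/
def mixMat (a b c : F) : GL (Fin 3) F :=
  .mkOfDetNeZero !![1, a, 0; 0, 1, 0; c, b, 1] (by simp [Matrix.det_fin_three])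

variable (F)

/-- The representative of the first simple reflection. -/
def s₁ : GL (Fin 3) F :=
  .mkOfDetNeZero !![0, -1, 0; 1, 0, 0; 0, 0, 1] (by simp [Matrix.det_fin_three])

/-- The representative of the second simple reflection. -/
def s₂ : GL (Fin 3) F :=
  .mkOfDetNeZero !![1, 0, 0; 0, 0, -1; 0, 1, 0] (by simp [Matrix.det_fin_three])

/-- The representative of the longest element of the Weyl group. -/
def w₀ : GL (Fin 3) F := s₁ F * s₂ F * s₁ F

end Matrices

end

end GL3Ind

open GL3Ind

/-! Multiplying `f` by `χ₃(det g)` makes it invariant under the elements of `B` with diagonal `(1,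
1, *)`, so it becomes a function `h` of the first two columns of `g`: a function on `3 × 2`
matrices, zero in rank less than two, on which upper triangular `2 × 2` matrices act from the right
through `η₁η₂` and `η₂` (`toFlag`). Values on `L` become values at matrices with zero last row. For
`z = diag(a, a, b)` and `x = a / b`, the condition `τ_z f = χ(z) f` says that `h(M)` is the average
over `v, w ∈ 𝒪` of the values of `h` at the matrix obtained from `M` by subtracting `v` and `w`
times the last row from the first two rows and multiplying the last row by `x`
(`hecke_apply_eq_flagAvg`, `col_eigen`).

By compactness `h` is invariant under a congruence subgroup of some level `m`. For `x` divisible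
enough, the last row can therefore be cleared almost everywhere in the average, which leaves values
on `L`. When the first column is `(1, a, b)` with `b ∈ (ϖ)`, one of the two integrals separates as
`∫ η₁η₂(1 - vb) dv`, and this is the factor `δ` (`col_eq_delta_mul_integralO`,
`integralO_extZero_one_sub`). On the cell of `1` the other integral is the formula. On the cell of
`s₂` the last row is negligible only for `t` away from `0`; subtracting the integrand for `c = 0`
removes the neighbourhood of `0` (`col_sub_col`). The value `S` at `c = 0` vanishes if `η₂` is
ramified, and otherwise the equation for `x = ϖ` reads `S = q⁻¹ η₂(ϖ) S + (1 - q⁻¹) f(ℓ(a))`. On the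
cell of `s₂s₁` the value `R` vanishes if `η₁η₂` is ramified, and otherwise `R = q⁻² η₁η₂(ϖ) R + (1 -
q⁻¹)(A + J)`, with `A` and `J` already known from the smaller cells (`col_cell_three`). The two
excluded characters are exactly those for which these equations degenerate. The other three cells
follow by interchanging the first two rows, since `ṡ₁` normalizes `N₀` and commutes with `Z_L`.

Elimination with integral multipliers shows that the six cells exhaust the matrices of rank two
(`exists_basicCell`), so the formulas give injectivity of `θ` (`eq_zero_of_vanishesOnLevi`).
Surjectivity needs no check that the formulas define an eigenfunction. The functions of level `m`
form a finite-dimensional space, stable under the averaging operator `T` of `ϖ`. Moreover `T - 1`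
takes values in the subspace of functions vanishing on `L`, and it is injective there by the
uniqueness just proved, hence bijective there. Any extension of a given function on `L` can thus be
corrected to a fixed vector of `T` (`exists_fixed_of_sub_mem`, `exists_isFlagEigen`). -/

namespace GL3Ind

set_option linter.unusedSectionVars false

noncomputable section

/-! ### Integration over the ring of integers -/

section Integral

variable {F : Type*} [NontriviallyNormedField F] [IsUltrametricDist F]
variable {C : Type*} [Field C]

/-- `φ` is invariant under translation by some power of the maximal ideal. -/
def HasLevel (φ : intRing F → C) : Prop := ∃ n, IsLevel φ n

theorem IsLevel.mono {φ : intRing F → C} {m n : ℕ} (h : IsLevel φ m) (hmn : m ≤ n) :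
    IsLevel φ n := fun x y hxy => h x y (Ideal.pow_le_pow_right hmn hxy)

theorem HasLevel.map₂ {φ ψ : intRing F → C} (op : C → C → C) (h : HasLevel φ) (h' : HasLevel ψ) :
    HasLevel fun t => op (φ t) (ψ t) := by
  obtain ⟨m, hm⟩ := h
  obtain ⟨n, hn⟩ := h'
  refine ⟨max m n, fun x y hxy => ?_⟩
  simp only [hm.mono (le_max_left m n) x y hxy, hn.mono (le_max_right m n) x y hxy]

theorem HasLevel.sub {φ ψ : intRing F → C} (h : HasLevel φ) (h' : HasLevel ψ) :
    HasLevel fun t => φ t - ψ t := h.map₂ (· - ·) h'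

theorem HasLevel.mul {φ ψ : intRing F → C} (h : HasLevel φ) (h' : HasLevel ψ) :
    HasLevel fun t => φ t * ψ t := h.map₂ (· * ·) h'

theorem hasLevel_const (c : C) : HasLevel fun _ : intRing F => c := ⟨0, fun _ _ _ => rfl⟩

theorem HasLevel.comp {φ : intRing F → C} (h : HasLevel φ) {e : intRing F → intRing F}
    (he : ∀ n x y, x - y ∈ maxIdeal F ^ n → e x - e y ∈ maxIdeal F ^ n) :
    HasLevel fun t => φ (e t) := by
  obtain ⟨n, hn⟩ := h
  exact ⟨n, fun x y hxy => hn _ _ (he n x y hxy)⟩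

variable [IsDiscreteValuationRing (intRing F)] [Finite (IsLocalRing.ResidueField (intRing F))]

instance finite_quotient_pow (n : ℕ) : Finite (intRing F ⧸ maxIdeal F ^ n) :=
  Valued.integer.finite_quotient_maximalIdeal_pow_of_finite_residueField ‹_› n

theorem out_sub_mem (I : Ideal (intRing F)) (x : intRing F) :
    Quotient.out (Ideal.Quotient.mk I x) - x ∈ I :=
  (Ideal.Quotient.mk_eq_mk_iff_sub_mem _ _).1 (Quotient.out_eq _)

theorem mk_out (I : Ideal (intRing F)) (x : intRing F ⧸ I) :
    Ideal.Quotient.mk I (Quotient.out x) = x := Quotient.out_eq x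

variable [CharZero C]

/-- The definition averages at the least level. A finer level gives the same average because the
fibres of the projection from `𝒪 / (ϖ ^ n)` to `𝒪 / (ϖ ^ k)` all have the same cardinality. -/
theorem integralO_eq {φ : intRing F → C} {n : ℕ} (h : IsLevel φ n) :
    integralO φ = (Nat.card (intRing F ⧸ maxIdeal F ^ n) : C)⁻¹ *
      ∑ᶠ x : intRing F ⧸ maxIdeal F ^ n, φ (Quotient.out x) := by
  classical
  have hex : ∃ n, IsLevel φ n := ⟨n, h⟩
  have hdef : integralO φ = (Nat.card (intRing F ⧸ maxIdeal F ^ Nat.find hex) : C)⁻¹ *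
      ∑ᶠ x : intRing F ⧸ maxIdeal F ^ Nat.find hex, φ (Quotient.out x) := by
    rw [integralO, dif_pos hex]
  rw [hdef]
  have hk : IsLevel φ (Nat.find hex) := Nat.find_spec hex
  have hkn : Nat.find hex ≤ n := Nat.find_min' hex h
  generalize Nat.find hex = k at hk hkn
  have := Fintype.ofFinite (intRing F ⧸ maxIdeal F ^ k)
  have := Fintype.ofFinite (intRing F ⧸ maxIdeal F ^ n)
  rw [finsum_eq_sum_of_fintype, finsum_eq_sum_of_fintype]
  have hle : maxIdeal F ^ n ≤ maxIdeal F ^ k := Ideal.pow_le_pow_right hkn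
  set π : intRing F ⧸ maxIdeal F ^ n →+* intRing F ⧸ maxIdeal F ^ k := Ideal.Quotient.factor hle
  have hπ : Function.Surjective π := Ideal.Quotient.factor_surjective hle
  have h1 : ∀ x : intRing F ⧸ maxIdeal F ^ n,
      φ (Quotient.out x) = φ (Quotient.out (π x)) := by
    intro x
    obtain ⟨x, rfl⟩ := Ideal.Quotient.mk_surjective x
    rw [h _ _ (out_sub_mem _ x)]
    exact (hk _ _ (out_sub_mem _ x)).symm
  set c := (Finset.univ.filter fun x => π x = 0).card with hc
  have hfib : ∀ y, (Finset.univ.filter fun x => π x = y).card = c := fun y =>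
    AddMonoidHom.card_fiber_eq_of_mem_range π.toAddMonoidHom (hπ y) (hπ 0)
  have h2 : ∑ x : intRing F ⧸ maxIdeal F ^ n, φ (Quotient.out x) = c * ∑ y : intRing F ⧸ maxIdeal F ^ k,
      φ (Quotient.out y) := by
    rw [Finset.sum_congr rfl fun x _ => h1 x, ← Finset.sum_fiberwise Finset.univ π, Finset.mul_sum]
    refine Finset.sum_congr rfl fun y _ => ?_
    rw [Finset.sum_congr rfl (g := fun _ => φ (Quotient.out y)) fun x hx => by
      rw [(Finset.mem_filter.1 hx).2], Finset.sum_const, hfib, nsmul_eq_mul]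
  have h3 : Nat.card (intRing F ⧸ maxIdeal F ^ n) = c * Nat.card (intRing F ⧸ maxIdeal F ^ k) := by
    rw [Nat.card_eq_fintype_card, Nat.card_eq_fintype_card, ← Finset.card_univ,
      Finset.card_eq_sum_card_fiberwise (f := π) (t := Finset.univ) (by simp),
      Finset.sum_congr rfl fun y _ => hfib y, Finset.sum_const, Finset.card_univ, smul_eq_mul,
      mul_comm]
  have hc0 : (c : C) ≠ 0 := by
    intro h0
    rw [Nat.cast_eq_zero.1 h0, zero_mul] at h3
    exact Nat.card_pos.ne' h3
  rw [h2, h3, Nat.cast_mul, mul_inv]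
  field_simp

theorem integralO_eq_sum {φ : intRing F → C} {n : ℕ} (h : IsLevel φ n)
    [Fintype (intRing F ⧸ maxIdeal F ^ n)] :
    integralO φ = (Nat.card (intRing F ⧸ maxIdeal F ^ n) : C)⁻¹ *
      ∑ x : intRing F ⧸ maxIdeal F ^ n, φ (Quotient.out x) := by
  rw [integralO_eq h, finsum_eq_sum_of_fintype]

theorem card_quotient_ne_zero (n : ℕ) : (Nat.card (intRing F ⧸ maxIdeal F ^ n) : C) ≠ 0 :=
  Nat.cast_ne_zero.2 Nat.card_pos.ne'

theorem integralO_const (c : C) : integralO (fun _ : intRing F => c) = c := by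
  have := Fintype.ofFinite (intRing F ⧸ maxIdeal F ^ 0)
  rw [integralO_eq_sum (n := 0) (fun _ _ _ => rfl), Finset.sum_const, Finset.card_univ,
    nsmul_eq_mul, ← Nat.card_eq_fintype_card, inv_mul_cancel_left₀ (card_quotient_ne_zero 0)]

theorem integralO_add {φ ψ : intRing F → C} (h : HasLevel φ) (h' : HasLevel ψ) :
    integralO (fun t => φ t + ψ t) = integralO φ + integralO ψ := by
  obtain ⟨m, hm⟩ := h
  obtain ⟨n, hn⟩ := h'
  replace hm := hm.mono (le_max_left m n)
  replace hn := hn.mono (le_max_right m n)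
  have := Fintype.ofFinite (intRing F ⧸ maxIdeal F ^ max m n)
  rw [integralO_eq_sum hm, integralO_eq_sum hn, integralO_eq_sum (n := max m n)
    (fun x y hxy => by simp only [hm x y hxy, hn x y hxy]), Finset.sum_add_distrib, mul_add]

theorem integralO_const_mul (c : C) {φ : intRing F → C} (h : HasLevel φ) :
    integralO (fun t => c * φ t) = c * integralO φ := by
  obtain ⟨n, hn⟩ := h
  have := Fintype.ofFinite (intRing F ⧸ maxIdeal F ^ n)
  rw [integralO_eq_sum hn, integralO_eq_sum (n := n)
    (fun x y hxy => by simp only [hn x y hxy]), ← Finset.mul_sum]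
  ring

theorem integralO_mul_const (c : C) {φ : intRing F → C} (h : HasLevel φ) :
    integralO (fun t => φ t * c) = integralO φ * c := by
  simp_rw [mul_comm _ c]
  exact integralO_const_mul c h

theorem integralO_sub {φ ψ : intRing F → C} (h : HasLevel φ) (h' : HasLevel ψ) :
    integralO (fun t => φ t - ψ t) = integralO φ - integralO ψ := by
  have := integralO_add h ((hasLevel_const (-1 : C)).mul h')
  rw [integralO_const_mul _ h'] at this
  simpa [sub_eq_add_neg] using this

/-- By `he` and `he'` the map `e` respects and reflects congruences, so it induces an injection of
the finite ring `𝒪 / (ϖ ^ n)` into itself, which permutes the terms of the sum. -/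
theorem integralO_comp {φ : intRing F → C} (h : HasLevel φ) {e : intRing F → intRing F}
    (he : ∀ n x y, x - y ∈ maxIdeal F ^ n → e x - e y ∈ maxIdeal F ^ n)
    (he' : ∀ n x y, e x - e y ∈ maxIdeal F ^ n → x - y ∈ maxIdeal F ^ n) :
    integralO (fun t => φ (e t)) = integralO φ := by
  obtain ⟨n, hn⟩ := h
  rw [integralO_eq hn, integralO_eq (n := n) (fun x y hxy => hn _ _ (he n x y hxy))]
  congr 1
  refine finsum_eq_of_bijective
    (fun x => Ideal.Quotient.mk (maxIdeal F ^ n) (e (Quotient.out x))) ?_ ?_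
  · rw [← Finite.injective_iff_bijective]
    intro x y hxy
    rw [Ideal.Quotient.mk_eq_mk_iff_sub_mem] at hxy
    rw [← mk_out _ x, ← mk_out _ y, Ideal.Quotient.mk_eq_mk_iff_sub_mem]
    exact he' n _ _ hxy
  · intro x
    exact (hn _ _ (out_sub_mem _ _)).symm

theorem integralO_affine {φ : intRing F → C} (h : HasLevel φ) (u : (intRing F)ˣ) (s : intRing F) :
    integralO (fun t => φ ((u : intRing F) * t + s)) = integralO φ := by
  refine integralO_comp h (e := fun t => (u : intRing F) * t + s) ?_ ?_
  · intro n x y hxy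
    have := Ideal.mul_mem_left _ (u : intRing F) hxy
    convert this using 1
    ring
  · intro n x y hxy
    have := Ideal.mul_mem_left _ ((u⁻¹ : (intRing F)ˣ) : intRing F) hxy
    convert this using 1
    simp only [add_sub_add_right_eq_sub, mul_sub, Units.inv_mul_cancel_left]

theorem integralO_add_right {φ : intRing F → C} (h : HasLevel φ) (s : intRing F) :
    integralO (fun t => φ (t + s)) = integralO φ := by
  simpa using integralO_affine h 1 s

theorem integralO_unit_mul {φ : intRing F → C} (h : HasLevel φ) (u : (intRing F)ˣ) :
    integralO (fun t => φ ((u : intRing F) * t)) = integralO φ := by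
  simpa using integralO_affine h u 0

/-- Joint local constancy of a function of two variables. -/
def HasLevel₂ (φ : intRing F → intRing F → C) : Prop :=
  ∃ n, (∀ x, IsLevel (φ x) n) ∧ ∀ y, IsLevel (fun x => φ x y) n

theorem HasLevel₂.left {φ : intRing F → intRing F → C} (h : HasLevel₂ φ) (x) :
    HasLevel (φ x) := let ⟨n, hn⟩ := h; ⟨n, hn.1 x⟩

theorem HasLevel₂.right {φ : intRing F → intRing F → C} (h : HasLevel₂ φ) (y) :
    HasLevel (fun x => φ x y) := let ⟨n, hn⟩ := h; ⟨n, hn.2 y⟩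

theorem HasLevel₂.integral {φ : intRing F → intRing F → C} (h : HasLevel₂ φ) :
    HasLevel (fun x => integralO (φ x)) := by
  obtain ⟨n, hn⟩ := h
  refine ⟨n, fun x y hxy => ?_⟩
  have : φ x = φ y := funext fun z => hn.2 z x y hxy
  simp only [this]

theorem HasLevel₂.map₂ {φ ψ : intRing F → intRing F → C} (op : C → C → C) (h : HasLevel₂ φ)
    (h' : HasLevel₂ ψ) : HasLevel₂ fun x y => op (φ x y) (ψ x y) := by
  obtain ⟨m, hm⟩ := h
  obtain ⟨n, hn⟩ := h'
  refine ⟨max m n, fun a x y hxy => ?_, fun a x y hxy => ?_⟩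
  · simp only [(hm.1 a).mono (le_max_left m n) x y hxy, (hn.1 a).mono (le_max_right m n) x y hxy]
  · have h1 := (hm.2 a).mono (le_max_left m n) x y hxy
    have h2 := (hn.2 a).mono (le_max_right m n) x y hxy
    simp only at h1 h2 ⊢
    rw [h1, h2]

theorem integralO_swap {φ : intRing F → intRing F → C} (h : HasLevel₂ φ) :
    integralO (fun x => integralO fun y => φ x y) =
      integralO (fun y => integralO fun x => φ x y) := by
  obtain ⟨n, hn⟩ := h
  have := Fintype.ofFinite (intRing F ⧸ maxIdeal F ^ n)
  rw [integralO_eq_sum (φ := fun x => integralO fun y => φ x y) (n := n),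
    integralO_eq_sum (φ := fun y => integralO fun x => φ x y) (n := n)]
  · simp_rw [integralO_eq_sum (hn.1 _), integralO_eq_sum (hn.2 _), ← Finset.mul_sum]
    rw [Finset.sum_comm]
  · intro x y hxy
    have : (fun z => φ z x) = fun z => φ z y := funext fun z => hn.1 z x y hxy
    simp only [this]
  · intro x y hxy
    have : φ x = φ y := funext fun z => hn.2 z x y hxy
    simp only [this]

theorem mem_maxIdeal_iff_of_sub_mem {x y : intRing F} (h : x - y ∈ maxIdeal F) :
    x ∈ maxIdeal F ↔ y ∈ maxIdeal F :=
  ⟨fun hx => by simpa using sub_mem hx h, fun hy => by simpa using add_mem h hy⟩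

theorem isLevel_onMaxIdeal_const (c : C) : IsLevel (onMaxIdeal fun _ : intRing F => c) 1 := by
  intro x y hxy
  rw [pow_one] at hxy
  have := mem_maxIdeal_iff_of_sub_mem hxy
  unfold onMaxIdeal
  by_cases hy : y ∈ maxIdeal F
  · rw [if_pos hy, if_pos (this.2 hy)]
  · rw [if_neg hy, if_neg (mt this.1 hy)]

theorem HasLevel.onMaxIdeal {φ : intRing F → C} (h : HasLevel φ) : HasLevel (onMaxIdeal φ) := by
  have := HasLevel.mul ⟨1, isLevel_onMaxIdeal_const (1 : C)⟩ h
  convert this using 2 with t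
  simp only [GL3Ind.onMaxIdeal]
  split_ifs <;> simp

theorem resCard_ne_zero : (resCard F : C) ≠ 0 := Nat.cast_ne_zero.2 Nat.card_pos.ne'

/-- Only the zero class of `𝒪 / (ϖ)` contributes. -/
theorem integralO_onMaxIdeal_one : integralO (onMaxIdeal fun _ : intRing F => (1 : C)) =
    (resCard F : C)⁻¹ := by
  have := Fintype.ofFinite (intRing F ⧸ maxIdeal F ^ 1)
  rw [integralO_eq_sum (isLevel_onMaxIdeal_const 1), Finset.sum_eq_single 0]
  · have h1 : Nat.card (intRing F ⧸ maxIdeal F ^ 1) = resCard F := by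
      rw [pow_one]; rfl
    have h0 : Quotient.out (0 : intRing F ⧸ maxIdeal F ^ 1) ∈ maxIdeal F := by
      have := out_sub_mem (maxIdeal F ^ 1) 0
      rw [sub_zero] at this
      exact (pow_one (maxIdeal F)).le this
    rw [h1]
    unfold onMaxIdeal
    rw [if_pos h0, mul_one]
  · intro x _ hx
    rw [onMaxIdeal, if_neg]
    intro h
    apply hx
    rw [← mk_out _ x, Ideal.Quotient.eq_zero_iff_mem]
    exact (pow_one (maxIdeal F)).ge h
  · simp

end Integral

/-! ### The field and its characters -/

section LocalField

/-- A finite extension of `ℚ_p` is a proper metric space, so its unit ball is compact. Compactness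
and nontriviality of the valuation give a discrete valuation ring, and the residue field is the
quotient of a compact group by an open subgroup. -/
theorem discreteValuationRing_and_finite_of_finiteDimensional {p : ℕ} [Fact p.Prime]
    (F : Type*) [NontriviallyNormedField F] [IsUltrametricDist F]
    [NormedAlgebra ℚ_[p] F] [FiniteDimensional ℚ_[p] F] :
    CompactSpace (intRing F) ∧ IsDiscreteValuationRing (intRing F) ∧
      Finite (IsLocalRing.ResidueField (intRing F)) := by
  have : ProperSpace F := FiniteDimensional.proper ℚ_[p] F
  have hc : CompactSpace (intRing F) := by
    refine isCompact_iff_compactSpace (s := ((intRing F : Subring F) : Set F)).1 ?_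
    convert isCompact_closedBall (0 : F) 1 using 1
    ext x
    simp [Valued.integer.mem_iff]
  have hn : (Valued.v : Valuation F NNReal).IsNontrivial := by
    rw [Valuation.isNontrivial_iff_exists_lt_one]
    obtain ⟨x, hx, hx'⟩ := NormedField.exists_norm_lt_one F
    exact ⟨x, norm_pos_iff.1 hx, hx'⟩
  have hd : IsDiscreteValuationRing (intRing F) :=
    Valued.integer.isDiscreteValuationRing_of_compactSpace
  refine ⟨hc, hd, ?_⟩
  obtain ⟨ϖ, hϖ⟩ := IsDiscreteValuationRing.exists_irreducible (intRing F)
  have hopen : IsOpen ((maxIdeal F : Ideal (intRing F)) : Set (intRing F)) := by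
    rw [Irreducible.maximalIdeal_eq_closedBall hϖ]
    exact IsUltrametricDist.isOpen_closedBall _ (norm_pos_iff.2 hϖ.ne_zero).ne'
  exact AddSubgroup.quotient_finite_of_isOpen (maxIdeal F).toAddSubgroup hopen

variable {F : Type*} [NontriviallyNormedField F] [IsUltrametricDist F]

theorem isUnit_of_notMem {x : intRing F} (h : x ∉ maxIdeal F) : IsUnit x := by
  simpa using h

theorem isUnit_one_add {x : intRing F} (h : x ∈ maxIdeal F) : IsUnit (1 + x) := by
  apply isUnit_of_notMem
  intro h'
  have : (1 : intRing F) ∈ maxIdeal F := by simpa using sub_mem h' h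
  simp at this

theorem isUnit_one_sub {x : intRing F} (h : x ∈ maxIdeal F) : IsUnit (1 - x) := by
  simpa [sub_eq_add_neg] using isUnit_one_add (neg_mem h)

theorem isUnit_of_sub_one_mem {x : intRing F} (h : x - 1 ∈ maxIdeal F) : IsUnit x := by
  simpa using isUnit_one_add h

theorem coe_unit_ne_zero (u : (intRing F)ˣ) : ((u : intRing F) : F) ≠ 0 := by
  simp

theorem coe_inv_unit (u : (intRing F)ˣ) :
    (((u⁻¹ : (intRing F)ˣ) : intRing F) : F) = ((u : intRing F) : F)⁻¹ := by
  apply eq_inv_of_mul_eq_one_left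
  rw [← Subring.coe_mul, Units.inv_mul, Subring.coe_one]

theorem exists_coe_div {x y : F} (h : ‖x‖ ≤ ‖y‖) : ∃ z : intRing F, (z : F) = x / y := by
  refine ⟨⟨x / y, Valued.integer.mem_iff.2 ?_⟩, rfl⟩
  rw [norm_div]
  exact div_le_one_of_le₀ h (norm_nonneg _)

theorem exists_coe_div_mem {x y : F} (h : ‖x‖ < ‖y‖) :
    ∃ z ∈ maxIdeal F, (z : F) = x / y := by
  obtain ⟨z, hz⟩ := exists_coe_div h.le
  refine ⟨z, ?_, hz⟩
  rw [IsLocalRing.mem_maximalIdeal, mem_nonunits_iff, Valued.integer.isUnit_iff_norm_eq_one]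
  apply ne_of_lt
  change ‖(z : F)‖ < 1
  rw [hz, norm_div]
  exact (div_lt_one ((norm_nonneg x).trans_lt h)).2 h

variable [IsDiscreteValuationRing (intRing F)]

theorem mem_pow_iff_dvd {ϖ : intRing F} (hϖ : Irreducible ϖ) {n : ℕ} {x : intRing F} :
    x ∈ maxIdeal F ^ n ↔ ϖ ^ n ∣ x := by
  rw [maxIdeal, hϖ.maximalIdeal_eq, Ideal.span_singleton_pow, Ideal.mem_span_singleton]

theorem mem_maxIdeal_iff_dvd {ϖ : intRing F} (hϖ : Irreducible ϖ) {x : intRing F} :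
    x ∈ maxIdeal F ↔ ϖ ∣ x := by
  simpa using mem_pow_iff_dvd hϖ (n := 1) (x := x)

theorem mem_pow_iff_norm {ϖ : intRing F} (hϖ : Irreducible ϖ) {n : ℕ} {x : intRing F} :
    x ∈ maxIdeal F ^ n ↔ ‖(x : F)‖ ≤ ‖(ϖ : F)‖ ^ n := by
  have := Irreducible.maximalIdeal_pow_eq_closedBall_pow hϖ n
  have h2 := Set.ext_iff.1 this x
  rw [mem_closedBall_zero_iff] at h2
  exact h2

theorem norm_uniformizer_pos {ϖ : intRing F} (hϖ : Irreducible ϖ) : 0 < ‖(ϖ : F)‖ :=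
  Valued.integer.norm_irreducible_pos hϖ

theorem norm_uniformizer_lt_one {ϖ : intRing F} (hϖ : Irreducible ϖ) : ‖(ϖ : F)‖ < 1 :=
  Valued.integer.norm_irreducible_lt_one hϖ

theorem uniformizer_mem {ϖ : intRing F} (hϖ : Irreducible ϖ) : ϖ ∈ maxIdeal F :=
  (mem_maxIdeal_iff_dvd hϖ).2 dvd_rfl

/-- Every nonzero ideal `x𝒪` contains a power of the maximal ideal. -/
theorem exists_pow_le_span {x : intRing F} (hx : x ≠ 0) :
    ∃ n, ∀ y ∈ maxIdeal F ^ n, ∃ z, y = x * z := by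
  obtain ⟨ϖ, hϖ⟩ := IsDiscreteValuationRing.exists_irreducible (intRing F)
  obtain ⟨n, u, rfl⟩ := IsDiscreteValuationRing.eq_unit_mul_pow_irreducible hx hϖ
  refine ⟨n, fun y hy => ?_⟩
  obtain ⟨z, rfl⟩ := (mem_pow_iff_dvd hϖ).1 hy
  refine ⟨(u⁻¹ : (intRing F)ˣ) * z, ?_⟩
  rw [mul_mul_mul_comm, Units.mul_inv, one_mul]

variable {C : Type*} [Field C]

/-- The inclusion of the units of the ring of integers. -/
def unitCoe : (intRing F)ˣ →* Fˣ := Units.map (intRing F).subtype.toMonoidHom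

@[simp] theorem coe_unitCoe (u : (intRing F)ˣ) : (unitCoe u : F) = ((u : intRing F) : F) := rfl

/-- A character that is trivial on a subgroup `1 + (ϖ ^ n)`. -/
def IsSmoothChar (η : Fˣ →* Cˣ) : Prop :=
  ∃ n, ∀ u : (intRing F)ˣ, (u : intRing F) - 1 ∈ maxIdeal F ^ n → η (unitCoe u) = 1

theorem extZero_of_ne {η : Fˣ →* Cˣ} {x : F} (h : x ≠ 0) :
    extZero η x = (η (Units.mk0 x h) : C) := dif_neg h

@[simp] theorem extZero_zero (η : Fˣ →* Cˣ) : extZero η (0 : F) = (0 : C) := dif_pos rfl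

@[simp] theorem extZero_coe (η : Fˣ →* Cˣ) (x : Fˣ) : extZero η (x : F) = (η x : C) := by
  rw [extZero_of_ne x.ne_zero, Units.mk0_val]

@[simp] theorem extZero_one (η : Fˣ →* Cˣ) : extZero η (1 : F) = (1 : C) := by
  simpa using extZero_coe η 1

theorem extZero_ne_zero (η : Fˣ →* Cˣ) {x : F} (h : x ≠ 0) : extZero η x ≠ 0 := by
  rw [extZero_of_ne h]; exact Units.ne_zero _

theorem extZero_mul (η : Fˣ →* Cˣ) (x y : F) : extZero η (x * y) = extZero η x * extZero η y := by
  by_cases hx : x = 0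
  · simp [hx]
  by_cases hy : y = 0
  · simp [hy]
  rw [extZero_of_ne hx, extZero_of_ne hy, extZero_of_ne (mul_ne_zero hx hy), ← Units.val_mul,
    ← map_mul, Units.mk0_mul]

theorem extZero_inv (η : Fˣ →* Cˣ) (x : F) : extZero η x⁻¹ = (extZero η x)⁻¹ := by
  by_cases hx : x = 0
  · simp [hx]
  apply eq_inv_of_mul_eq_one_left
  rw [← extZero_mul, inv_mul_cancel₀ hx, extZero_one]

theorem extZero_mul_apply (η θ : Fˣ →* Cˣ) (x : F) :
    extZero (η * θ) x = extZero η x * extZero θ x := by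
  by_cases hx : x = 0
  · simp [hx]
  simp [extZero_of_ne hx]

theorem extZero_inv_apply (η : Fˣ →* Cˣ) (x : F) : extZero η⁻¹ x = (extZero η x)⁻¹ := by
  by_cases hx : x = 0
  · simp [hx]
  simp [extZero_of_ne hx]

theorem extZero_unit (η : Fˣ →* Cˣ) (u : (intRing F)ˣ) :
    extZero η ((u : intRing F) : F) = (η (unitCoe u) : C) := extZero_coe η (unitCoe u)

theorem IsSmoothChar.mul {η θ : Fˣ →* Cˣ} (h : IsSmoothChar η) (h' : IsSmoothChar θ) :
    IsSmoothChar (η * θ) := by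
  obtain ⟨m, hm⟩ := h
  obtain ⟨n, hn⟩ := h'
  refine ⟨max m n, fun u hu => ?_⟩
  rw [MonoidHom.mul_apply, hm u (Ideal.pow_le_pow_right (le_max_left m n) hu),
    hn u (Ideal.pow_le_pow_right (le_max_right m n) hu), one_mul]

theorem IsSmoothChar.inv {η : Fˣ →* Cˣ} (h : IsSmoothChar η) : IsSmoothChar η⁻¹ := by
  obtain ⟨m, hm⟩ := h
  exact ⟨m, fun u hu => by rw [MonoidHom.inv_apply, hm u hu, inv_one]⟩

theorem tendsto_norm_pow_uniformizer {ϖ : intRing F} (hϖ : Irreducible ϖ) :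
    Filter.Tendsto (fun n : ℕ => ‖(ϖ : F)‖ ^ n) Filter.atTop (nhds 0) :=
  tendsto_pow_atTop_nhds_zero_of_lt_one (norm_nonneg _) (norm_uniformizer_lt_one hϖ)

theorem tendsto_one_of_sub_mem_pow {x : ℕ → intRing F} {y : F}
    (h : ∀ n, ∃ z ∈ maxIdeal F ^ n, (z : F) = x n - y) :
    Filter.Tendsto (fun n => (x n : F)) Filter.atTop (nhds y) := by
  obtain ⟨ϖ, hϖ⟩ := IsDiscreteValuationRing.exists_irreducible (intRing F)
  rw [tendsto_iff_norm_sub_tendsto_zero]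
  refine squeeze_zero (fun _ => norm_nonneg _) (fun n => ?_) (tendsto_norm_pow_uniformizer hϖ)
  obtain ⟨z, hz, hzx⟩ := h n
  rw [← hzx]
  exact (mem_pow_iff_norm hϖ).1 hz

theorem isSmoothChar_of_isLocallyConstant {η : Fˣ →* Cˣ} (h : IsLocallyConstant η) :
    IsSmoothChar η := by
  by_contra hcon
  simp only [IsSmoothChar, not_exists, not_forall] at hcon
  choose u hu hu1 using hcon
  have ht : Filter.Tendsto (fun n => unitCoe (u n)) Filter.atTop (nhds (1 : Fˣ)) := by
    -- In a topological field convergence of units can be tested in `F`, without looking at the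
    -- inverses.
    rw [Units.isEmbedding_val₀.tendsto_nhds_iff]
    refine tendsto_one_of_sub_mem_pow (x := fun n => (u n : intRing F)) fun n => ⟨_, hu n, ?_⟩
    simp
  have ho : IsOpen {x | η x = η 1} := h.isOpen_fiber (η 1)
  obtain ⟨n, hn⟩ := (ht.eventually (ho.mem_nhds rfl)).exists
  exact hu1 n (by simpa using hn)

/-- Smoothness makes the set defining the conductor nonempty, so its infimum belongs to it. -/
theorem IsSmoothChar.eq_one {η : Fˣ →* Cˣ} (h : IsSmoothChar η) {u : (intRing F)ˣ}
    (hu : (u : intRing F) - 1 ∈ maxIdeal F ^ charConductor η) : η (unitCoe u) = 1 :=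
  Nat.sInf_mem (s := {c : ℕ | ∀ u : (intRing F)ˣ, (u : intRing F) - 1 ∈ maxIdeal F ^ c →
    η (Units.map (intRing F).subtype.toMonoidHom u) = 1}) h u hu

theorem exists_ne_one_of_lt_charConductor {η : Fˣ →* Cˣ} {n : ℕ} (h : n < charConductor η) :
    ∃ u : (intRing F)ˣ, (u : intRing F) - 1 ∈ maxIdeal F ^ n ∧ η (unitCoe u) ≠ 1 := by
  have := Nat.notMem_of_lt_sInf h
  rw [Set.mem_ofPred_eq] at this
  push Not at this
  exact this

theorem extZero_unit_eq_one {η : Fˣ →* Cˣ} (h : IsSmoothChar η) (h0 : charConductor η = 0)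
    {x : intRing F} (hx : IsUnit x) : extZero η (x : F) = (1 : C) := by
  obtain ⟨u, rfl⟩ := hx
  rw [extZero_unit, h.eq_one (by simp [h0]), Units.val_one]

theorem extZero_eq_one {η : Fˣ →* Cˣ} (h : IsSmoothChar η) {x : intRing F} (hx : IsUnit x)
    (hx1 : x - 1 ∈ maxIdeal F ^ charConductor η) : extZero η (x : F) = (1 : C) := by
  obtain ⟨u, rfl⟩ := hx
  rw [extZero_unit, h.eq_one hx1, Units.val_one]

theorem IsSmoothChar.hasLevel {η : Fˣ →* Cˣ} (h : IsSmoothChar η) {e : intRing F → intRing F}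
    (he : ∀ n x y, x - y ∈ maxIdeal F ^ n → e x - e y ∈ maxIdeal F ^ n)
    (hu : ∀ t, IsUnit (e t)) : HasLevel fun t => extZero η (e t : F) := by
  refine ⟨charConductor η, fun x y hxy => ?_⟩
  obtain ⟨u, hu'⟩ := hu x
  obtain ⟨v, hv⟩ := hu y
  have h1 := Ideal.mul_mem_left _ ((v⁻¹ : (intRing F)ˣ) : intRing F) (he _ x y hxy)
  have h2 := h.eq_one (u := v⁻¹ * u) (by
    convert h1 using 1
    rw [← hu', ← hv, mul_sub, Units.inv_mul, Units.val_mul])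
  rw [map_mul, map_mul, map_inv, map_inv, inv_mul_eq_one] at h2
  simp only [← hu', ← hv, extZero_unit, h2]

/-- Source of the symbols `δ` with a valuation condition. If `b` is in the conductor, the integrand
is `1`; otherwise a change of variables multiplies the integral by some `η(u) ≠ 1`. -/
theorem integralO_extZero_one_sub [CharZero C] [Finite (IsLocalRing.ResidueField (intRing F))]
    {η : Fˣ →* Cˣ} (h : IsSmoothChar η) {b : intRing F} (hb : b ∈ maxIdeal F) :
    integralO (fun v : intRing F => extZero η (1 - v * b : F)) =
      delta (C := C) (b ∈ maxIdeal F ^ charConductor η) := by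
  have hunit : ∀ t : intRing F, IsUnit (1 - t * b) := fun t =>
    isUnit_one_sub (Ideal.mul_mem_left _ t hb)
  have hlev : HasLevel fun v : intRing F => extZero η (1 - v * b : F) := by
    have := h.hasLevel (e := fun v => 1 - v * b) (fun n x y hxy => by
      have := Ideal.mul_mem_left _ (-b) hxy
      convert this using 1
      ring) hunit
    simpa using this
  by_cases hbc : b ∈ maxIdeal F ^ charConductor η
  · have : (fun v : intRing F => extZero η (1 - v * b : F)) = fun _ => (1 : C) := by
      funext v
      have := extZero_eq_one h (hunit v) (by
        rw [sub_sub_cancel_left]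
        exact neg_mem (Ideal.mul_mem_left _ v hbc))
      simpa using this
    rw [this, integralO_const, delta, if_pos hbc]
  · rw [delta, if_neg hbc]
    obtain ⟨ϖ, hϖ⟩ := IsDiscreteValuationRing.exists_irreducible (intRing F)
    have hb0 : b ≠ 0 := by rintro rfl; exact hbc (zero_mem _)
    obtain ⟨n, w, rfl⟩ := IsDiscreteValuationRing.eq_unit_mul_pow_irreducible hb0 hϖ
    have hn : n < charConductor η := by
      by_contra hle
      exact hbc (Ideal.mul_mem_left _ _
        ((mem_pow_iff_dvd hϖ).2 (pow_dvd_pow _ (not_lt.1 hle))))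
    obtain ⟨u, hu, hu1⟩ := exists_ne_one_of_lt_charConductor hn
    obtain ⟨s, hs⟩ := (mem_pow_iff_dvd hϖ).1 hu
    -- With `b = w ϖ ^ n` and `u = 1 + ϖ ^ n s`, replacing `v` by `u v - w⁻¹ s` turns `1 - v b` into
    -- `u (1 - v b)`.
    have hinv := integralO_affine hlev u (-((w⁻¹ : (intRing F)ˣ) * s))
    have hpt : ∀ t : intRing F, extZero η (1 - ((u * t + -((w⁻¹ : (intRing F)ˣ) * s) : intRing F) : F)
        * (w * ϖ ^ n : intRing F)) = extZero η ((u : intRing F) : F) *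
          extZero η (1 - t * (w * ϖ ^ n : intRing F) : F) := by
      intro t
      rw [← extZero_mul]
      congr 1
      have : (1 - (u * t + -((w⁻¹ : (intRing F)ˣ) * s)) * (w * ϖ ^ n) : intRing F) =
          u * (1 - t * (w * ϖ ^ n)) := by
        have h1 : (u : intRing F) = 1 + ϖ ^ n * s := by rw [← hs]; ring
        have h2 : (w⁻¹ : (intRing F)ˣ) * s * (w * ϖ ^ n) = (u : intRing F) - 1 := by
          rw [mul_mul_mul_comm, Units.inv_mul, one_mul, hs, mul_comm]
        linear_combination h2
      exact_mod_cast congrArg (Subtype.val) this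
    rw [funext hpt, integralO_const_mul _ hlev] at hinv
    by_contra hne
    apply hu1
    have := mul_eq_right₀ hne |>.1 hinv
    rw [extZero_unit] at this
    exact Units.val_eq_one.1 this

/-- All uniformizers are associated and so have the same norm; the set in the supremum is therefore
the interval of integers at most `n`. -/
theorem valF_eq {ϖ : intRing F} (hϖ : Irreducible ϖ) (x : Fˣ) {u : (intRing F)ˣ} {n : ℤ}
    (h : (x : F) = ((u : intRing F) : F) * (ϖ : F) ^ n) : valF x = n := by
  have hs : {k : ℤ | ∃ ϖ : intRing F, Irreducible ϖ ∧ ‖(x : F)‖ ≤ ‖(ϖ : F)‖ ^ k} = Set.Iic n := by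
    ext k
    have hx : ‖(x : F)‖ = ‖(ϖ : F)‖ ^ n := by
      rw [h, norm_mul, Valued.integer.norm_coe_unit, one_mul, norm_zpow]
    simp only [Set.mem_ofPred_eq, Set.mem_Iic]
    constructor
    · rintro ⟨ϖ', hϖ', hk⟩
      have : ‖(ϖ' : F)‖ = ‖(ϖ : F)‖ := by
        obtain ⟨v, hv⟩ := IsDiscreteValuationRing.associated_of_irreducible (intRing F) hϖ hϖ'
        rw [← hv, Subring.coe_mul, norm_mul, Valued.integer.norm_coe_unit, mul_one]
      rw [this, hx, zpow_le_zpow_iff_right_of_lt_one₀ (norm_uniformizer_pos hϖ)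
        (norm_uniformizer_lt_one hϖ)] at hk
      exact hk
    · intro hk
      refine ⟨ϖ, hϖ, ?_⟩
      rwa [hx, zpow_le_zpow_iff_right_of_lt_one₀ (norm_uniformizer_pos hϖ)
        (norm_uniformizer_lt_one hϖ)]
  rw [valF, hs, csSup_Iic]

theorem exists_eq_unit_mul_zpow {ϖ : intRing F} (hϖ : Irreducible ϖ) {x : F} (hx : x ≠ 0) :
    ∃ (u : (intRing F)ˣ) (n : ℤ), x = ((u : intRing F) : F) * (ϖ : F) ^ n := by
  have hϖ0 : (ϖ : F) ≠ 0 := norm_pos_iff.1 (norm_uniformizer_pos hϖ)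
  have key : ∀ y : F, y ≠ 0 → ‖y‖ ≤ 1 →
      ∃ (u : (intRing F)ˣ) (n : ℤ), y = ((u : intRing F) : F) * (ϖ : F) ^ n := by
    intro y hy hy1
    obtain ⟨n, u, hu⟩ := IsDiscreteValuationRing.eq_unit_mul_pow_irreducible
      (x := (⟨y, Valued.integer.mem_iff.2 hy1⟩ : intRing F)) (by simpa [Subtype.ext_iff] using hy) hϖ
    refine ⟨u, n, ?_⟩
    have := congrArg Subtype.val hu
    simpa using this
  rcases le_total ‖x‖ 1 with h1 | h1
  · exact key x hx h1
  · obtain ⟨u, n, hu⟩ := key x⁻¹ (inv_ne_zero hx) (by rw [norm_inv]; exact inv_le_one_of_one_le₀ h1)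
    refine ⟨u⁻¹, -n, ?_⟩
    rw [coe_inv_unit, zpow_neg, ← mul_inv, ← hu, inv_inv]

/-- An unramified character is determined by its value at a uniformizer. -/
theorem coe_char_eq_absF {ϖ : intRing F} (hϖ : Irreducible ϖ) {η : Fˣ →* Cˣ}
    (hη : IsSmoothChar η) (h0 : charConductor η = 0) {k : ℕ}
    (h : extZero η (ϖ : F) = (resCard F : C) ^ k) :
    (fun x : Fˣ => (η x : C)) = fun x => (absF C x ^ k)⁻¹ := by
  funext x
  have hϖ0 : (ϖ : F) ≠ 0 := norm_pos_iff.1 (norm_uniformizer_pos hϖ)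
  obtain ⟨u, n, hu⟩ := exists_eq_unit_mul_zpow hϖ x.ne_zero
  have hx : x = unitCoe u * Units.mk0 (ϖ : F) hϖ0 ^ n := by
    apply Units.ext
    simpa using hu
  rw [absF, valF_eq hϖ x hu]
  conv_lhs => rw [hx]
  rw [map_mul, hη.eq_one (by simp [h0]), one_mul, map_zpow, Units.val_zpow_eq_zpow_val,
    ← extZero_of_ne hϖ0, h, zpow_neg, inv_pow, inv_inv, ← zpow_natCast, ← zpow_natCast,
    ← zpow_mul, ← zpow_mul, mul_comm]

end LocalField

/-! ### Functions on `3 × 2` matrices -/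

section FlagFunctions

open Matrix

variable {F : Type*} [NontriviallyNormedField F] [IsUltrametricDist F]
variable {C : Type*} [Field C]

/-- The diagonal matrix with entries `1, 1, x`. -/
def contr (x : F) : Matrix (Fin 3) (Fin 3) F := !![1, 0, 0; 0, 1, 0; 0, 0, x]

/-- The unipotent matrix with entries `v, w` in the last column. -/
def unipMat (v w : F) : Matrix (Fin 3) (Fin 3) F := !![1, 0, v; 0, 1, w; 0, 0, 1]

variable (F) in
/-- Integral matrices that are congruent modulo `(ϖ ^ m)` to the identity except for the first
two entries of the last column. -/
def parahoric (m : ℕ) : Set (Matrix (Fin 3) (Fin 3) (intRing F)) :=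
  {k | ∀ i j, j ≠ 2 ∨ i = 2 → k i j - (1 : Matrix (Fin 3) (Fin 3) (intRing F)) i j ∈ maxIdeal F ^ m}

/-- The functions on `3 × 2` matrices that correspond to `N₀`-invariant functions in the induced
representation, of level `m`, on which the units in `Z_L` act by the character. -/
def flagSpace (η₁₂ η₂ : Fˣ →* Cˣ) (m : ℕ) : Submodule C (Matrix (Fin 3) (Fin 2) F → C) where
  carrier := {h |
    (∀ M, ∀ c : Fin 2 → F, c ≠ 0 → M *ᵥ c = 0 → h M = 0) ∧
    (∀ M, ∀ a b d : F, a ≠ 0 → d ≠ 0 →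
      h (M * !![a, b; 0, d]) = extZero η₁₂ a * extZero η₂ d * h M) ∧
    (∀ k ∈ parahoric F m, ∀ M, h (k.map (intRing F).subtype * M) = h M) ∧
    ∀ u : (intRing F)ˣ, ∀ M, h (contr ((u : intRing F) : F) * M) = h M}
  zero_mem' := by simp
  add_mem' := by
    rintro h h' ⟨a1, a2, a3, a4⟩ ⟨b1, b2, b3, b4⟩
    refine ⟨fun M c hc hM => ?_, fun M a b d ha hd => ?_, fun k hk M => ?_, fun u M => ?_⟩
    · simp [a1 M c hc hM, b1 M c hc hM]
    · simp only [Pi.add_apply, a2 M a b d ha hd, b2 M a b d ha hd]; ring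
    · simp only [Pi.add_apply, a3 k hk, b3 k hk]
    · simp only [Pi.add_apply, a4, b4]
  smul_mem' := by
    rintro c h ⟨a1, a2, a3, a4⟩
    refine ⟨fun M c hc hM => ?_, fun M a b d ha hd => ?_, fun k hk M => ?_, fun u M => ?_⟩
    · simp [a1 M c hc hM]
    · simp only [Pi.smul_apply, smul_eq_mul, a2 M a b d ha hd]; ring
    · simp only [Pi.smul_apply, a3 k hk]
    · simp only [Pi.smul_apply, a4]

/-- The averaging operator corresponding to the Hecke operator of `diag(x, x, 1)`. -/
def flagAvg (x : F) (h : Matrix (Fin 3) (Fin 2) F → C) (M : Matrix (Fin 3) (Fin 2) F) : C :=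
  integralO fun v : intRing F => integralO fun w : intRing F =>
    h (contr x * unipMat (-(v : F)) (-(w : F)) * M)

/-- Eigenfunctions of all averaging operators. -/
def IsFlagEigen (h : Matrix (Fin 3) (Fin 2) F → C) : Prop :=
  ∀ x : intRing F, x ≠ 0 → ∀ M, flagAvg (x : F) h M = h M

/-- Invariance under the integral points of the unipotent radical. -/
def IsUnipInv (h : Matrix (Fin 3) (Fin 2) F → C) : Prop :=
  ∀ (v w : intRing F) M, h (unipMat (v : F) (w : F) * M) = h M

/-- The value at the matrix with given columns. -/
def col (h : Matrix (Fin 3) (Fin 2) F → C) (x₁ x₂ x₃ y₁ y₂ y₃ : F) : C :=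
  h !![x₁, y₁; x₂, y₂; x₃, y₃]

theorem col_congr {h : Matrix (Fin 3) (Fin 2) F → C} {x₁ x₂ x₃ y₁ y₂ y₃ x₁' x₂' x₃' y₁' y₂' y₃' : F}
    (h1 : x₁ = x₁') (h2 : x₂ = x₂') (h3 : x₃ = x₃') (h4 : y₁ = y₁') (h5 : y₂ = y₂')
    (h6 : y₃ = y₃') : col h x₁ x₂ x₃ y₁ y₂ y₃ = col h x₁' x₂' x₃' y₁' y₂' y₃' := by
  subst h1 h2 h3 h4 h5 h6; rfl

theorem unipMat_mul (v w v' w' : F) :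
    unipMat v w * unipMat v' w' = unipMat (v + v') (w + w') := by
  ext i j
  fin_cases i <;> fin_cases j <;> simp [unipMat, Matrix.mul_apply, Fin.sum_univ_three, add_comm]

theorem contr_mul (x y : F) : contr x * contr y = contr (x * y) := by
  ext i j
  fin_cases i <;> fin_cases j <;> simp [contr, Matrix.mul_apply, Fin.sum_univ_three]

theorem contr_one : contr (1 : F) = 1 := by
  ext i j
  fin_cases i <;> fin_cases j <;> simp [contr]

theorem unipMat_zero : unipMat (0 : F) 0 = 1 := by
  ext i j
  fin_cases i <;> fin_cases j <;> simp [unipMat]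

theorem unipMat_mul_contr (x v w : F) :
    unipMat v w * contr x = contr x * unipMat (x * v) (x * w) := by
  ext i j
  fin_cases i <;> fin_cases j <;>
    simp [unipMat, contr, Matrix.mul_apply, Fin.sum_univ_three, mul_comm]

variable {η₁₂ η₂ : Fˣ →* Cˣ} {m : ℕ} {h : Matrix (Fin 3) (Fin 2) F → C}

/-- The parahoric condition leaves the first two entries of the last column free, so it contains the
integral unipotent matrices for every `m`. -/
theorem isUnipInv_of_mem (hh : h ∈ flagSpace η₁₂ η₂ m) : IsUnipInv h := by
  intro v w M
  rw [← hh.2.2.1 (!![1, 0, v; 0, 1, w; 0, 0, 1] : Matrix (Fin 3) (Fin 3) (intRing F)) ?_ M]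
  · congr 2
    ext i j
    fin_cases i <;> fin_cases j <;> simp [unipMat]
  · intro i j hij
    fin_cases i <;> fin_cases j <;> simp_all

/-- Translating `(v, w)` by `x (a, b)` amounts to multiplication from the left by an integral
unipotent matrix. For `N₀`-invariant `h` the integrand of `flagAvg` thus depends only on `v, w`
modulo `x`. -/
theorem unipMat_neg_add (x v w a b : F) : contr x * unipMat (-(v + x * a)) (-(w + x * b)) =
    unipMat (-a) (-b) * (contr x * unipMat (-v) (-w)) := by
  rw [← mul_assoc, unipMat_mul_contr, mul_assoc, unipMat_mul]
  congr 2 <;> ring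

/-! ### Composition of the averaging operators. -/

section Avg

variable [IsDiscreteValuationRing (intRing F)]

theorem IsUnipInv.hasLevel₂ (hh : IsUnipInv h) {x : intRing F} (hx : x ≠ 0)
    (M : Matrix (Fin 3) (Fin 2) F) :
    HasLevel₂ fun v w : intRing F => h (contr (x : F) * unipMat (-(v : F)) (-(w : F)) * M) := by
  obtain ⟨n, hn⟩ := exists_pow_le_span hx
  refine ⟨n, fun v w w' hw => ?_, fun w v v' hv => ?_⟩
  · obtain ⟨z, hz⟩ := hn _ hw
    have h1 : (w : F) = w' + x * z := by
      rw [← Subring.coe_mul, ← hz]; simp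
    have := unipMat_neg_add (x : F) (v : F) w' 0 z
    rw [mul_zero, add_zero] at this
    have h2 := hh 0 (-z) (contr (x : F) * unipMat (-(v : F)) (-(w' : F)) * M)
    simp only [h1, this]
    rw [← h2]
    simp [Matrix.mul_assoc]
  · obtain ⟨z, hz⟩ := hn _ hv
    have h1 : (v : F) = v' + x * z := by
      rw [← Subring.coe_mul, ← hz]; simp
    have := unipMat_neg_add (x : F) (v' : F) w z 0
    rw [mul_zero, add_zero] at this
    have h2 := hh (-z) 0 (contr (x : F) * unipMat (-(v' : F)) (-(w : F)) * M)
    simp only [h1, this]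
    rw [← h2]
    simp [Matrix.mul_assoc]

variable [Finite (IsLocalRing.ResidueField (intRing F))] [CharZero C]

theorem integralO_translate₂ {φ : intRing F → intRing F → C} (hφ : HasLevel₂ φ)
    (a b : intRing F) :
    (integralO fun v => integralO fun w => φ (v + a) (w + b)) =
      integralO fun v => integralO fun w => φ v w := by
  simp_rw [integralO_add_right (hφ.left _)]
  exact integralO_add_right hφ.integral a

theorem flagAvg_unit (hh : h ∈ flagSpace η₁₂ η₂ m) (u : (intRing F)ˣ) :
    flagAvg ((u : intRing F) : F) h = h := by
  funext M
  simp only [GL3Ind.flagAvg, Matrix.mul_assoc, hh.2.2.2]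
  have := isUnipInv_of_mem hh
  have h1 : ∀ v w : intRing F, h (unipMat (-(v : F)) (-(w : F)) * M) = h M := fun v w => by
    simpa using this (-v) (-w) M
  simp [h1, integralO_const]

/-- Moving `unipMat` past `contr y` merges the two unipotent factors into one with parameters `v + y
v'`, `w + y w'`; the variables `v', w'` then disappear by translation invariance. -/
theorem flagAvg_mul (hh : IsUnipInv h) {x y : intRing F} (hx : x ≠ 0) (hy : y ≠ 0) :
    flagAvg (y : F) (flagAvg (x : F) h) = flagAvg ((x * y : intRing F) : F) h := by
  funext M
  simp only [GL3Ind.flagAvg]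
  have hl := hh.hasLevel₂ (mul_ne_zero hx hy) M
  have hpt : ∀ v w v' w' : intRing F, h (contr (x : F) * unipMat (-(v' : F)) (-(w' : F)) *
      (contr (y : F) * unipMat (-(v : F)) (-(w : F)) * M)) =
      h (contr ((x * y : intRing F) : F) * unipMat (-((v + y * v' : intRing F) : F))
        (-((w + y * w' : intRing F) : F)) * M) := by
    intro v w v' w'
    congr 1
    rw [← Matrix.mul_assoc, ← Matrix.mul_assoc, Matrix.mul_assoc (contr _) (unipMat _ _) (contr _),
      unipMat_mul_contr, ← Matrix.mul_assoc, contr_mul, Matrix.mul_assoc (contr _) (unipMat _ _),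
      unipMat_mul]
    push_cast
    congr 3 <;> ring
  simp only [hpt]
  have hmul : ∀ (s : intRing F) (n : ℕ) (a b : intRing F), a - b ∈ maxIdeal F ^ n →
      (s + y * a) - (s + y * b) ∈ maxIdeal F ^ n := fun s n a b hab => by
    have := Ideal.mul_mem_left _ y hab
    convert this using 1; ring
  have hmul' : ∀ (s : intRing F) (n : ℕ) (a b : intRing F), a - b ∈ maxIdeal F ^ n →
      (a + s) - (b + s) ∈ maxIdeal F ^ n := fun s n a b hab => by simpa using hab
  obtain ⟨n, hn1, hn2⟩ := hl
  -- The order of integration is changed so that `v` and `w` are integrated for fixed `v'` and `w'`.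
  have key : ∀ ψ : intRing F → intRing F → C, HasLevel₂ ψ →
      (integralO fun v => integralO fun w => integralO fun v' => integralO fun w' =>
        ψ (v + y * v') (w + y * w')) = integralO fun v => integralO fun w => ψ v w := by
    rintro ψ ⟨n, h1, h2⟩
    have hψ : HasLevel₂ ψ := ⟨n, h1, h2⟩
    have f2 : ∀ a b : intRing F, a - b ∈ maxIdeal F ^ n → ψ a = ψ b := fun a b hab =>
      funext fun z => h2 z _ _ hab
    have e2 : ∀ v : intRing F, (integralO fun w => integralO fun v' => integralO fun w' =>
        ψ (v + y * v') (w + y * w')) = integralO fun v' => integralO fun w => ψ (v + y * v') w := by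
      intro v
      rw [integralO_swap]
      · congr 1
        funext v'
        rw [integralO_swap]
        · have : ∀ w' : intRing F, (integralO fun w => ψ (v + y * v') (w + y * w')) =
            integralO fun w => ψ (v + y * v') w := fun w' => integralO_add_right (hψ.left _) _
          simp only [this, integralO_const]
        · exact ⟨n, fun a s t hst => h1 _ _ _ (hmul _ _ _ _ hst),
            fun a s t hst => h1 _ _ _ (hmul' _ _ _ _ hst)⟩
      · refine ⟨n, fun a s t hst => ?_, fun a s t hst => ?_⟩
        · simp only [f2 _ _ (hmul v n s t hst)]
        · have : (fun w' => ψ (v + y * a) (s + y * w')) = fun w' => ψ (v + y * a) (t + y * w') :=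
            funext fun w' => h1 _ _ _ (hmul' _ _ _ _ hst)
          simp only [this]
    simp only [e2]
    rw [integralO_swap]
    · have : ∀ v' : intRing F, (integralO fun v => integralO fun w => ψ (v + y * v') w) =
          integralO fun v => integralO fun w => ψ v w := fun v' =>
        integralO_add_right hψ.integral _
      simp only [this, integralO_const]
    · refine ⟨n, fun a s t hst => ?_, fun a s t hst => ?_⟩
      · simp only [f2 _ _ (hmul a n s t hst)]
      · simp only [f2 _ _ (hmul' (y * a) n s t hst)]
  exact key (fun v w => h (contr ((x * y : intRing F) : F) * unipMat (-(v : F)) (-(w : F)) * M)) ⟨n, hn1, hn2⟩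

/-- Multiplicativity of the operators reduces all `x` to `ϖ`, units acting trivially. -/
theorem isFlagEigen_of_uniformizer (hh : h ∈ flagSpace η₁₂ η₂ m) {ϖ : intRing F}
    (hϖ : Irreducible ϖ) (he : flagAvg (ϖ : F) h = h) : IsFlagEigen h := by
  have hpow : ∀ n : ℕ, flagAvg ((ϖ ^ n : intRing F) : F) h = h := by
    intro n
    induction n with
    | zero => simpa using flagAvg_unit hh 1
    | succ n ih =>
      rw [pow_succ', ← flagAvg_mul (isUnipInv_of_mem hh) hϖ.ne_zero (pow_ne_zero n hϖ.ne_zero), he,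
        ih]
  intro x hx M
  obtain ⟨n, u, rfl⟩ := IsDiscreteValuationRing.eq_unit_mul_pow_irreducible hx hϖ
  rw [← flagAvg_mul (isUnipInv_of_mem hh) u.ne_zero (pow_ne_zero n hϖ.ne_zero), flagAvg_unit hh,
    hpow]

end Avg

end FlagFunctions

/-! ### The values of an eigenfunction on the cells -/

section Formulas

open Matrix

variable {F : Type*} [NontriviallyNormedField F] [IsUltrametricDist F]
variable {C : Type*} [Field C]
variable [IsDiscreteValuationRing (intRing F)]
variable {η₁₂ η₂ : Fˣ →* Cˣ} {m : ℕ} {h : Matrix (Fin 3) (Fin 2) F → C}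

/-- The computations on the cells use only a few moves, recorded here and in the next lemmas: column
operations coming from `B`, and row operations coming from `N₀`, from the units in `Z_L` and from
the congruence subgroup of level `m`. -/
theorem col_smul₁ (hh : h ∈ flagSpace η₁₂ η₂ m) {b : F} (hb : b ≠ 0) (x₁ x₂ x₃ y₁ y₂ y₃ : F) :
    col h (b * x₁) (b * x₂) (b * x₃) y₁ y₂ y₃ = extZero η₁₂ b * col h x₁ x₂ x₃ y₁ y₂ y₃ := by
  have := hh.2.1 !![x₁, y₁; x₂, y₂; x₃, y₃] b 0 1 hb one_ne_zero
  rw [extZero_one, mul_one] at this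
  rw [col, col, ← this]
  congr 1
  ext i j
  fin_cases i <;> fin_cases j <;> simp [mul_comm]

theorem col_smul₂ (hh : h ∈ flagSpace η₁₂ η₂ m) {b : F} (hb : b ≠ 0) (x₁ x₂ x₃ y₁ y₂ y₃ : F) :
    col h x₁ x₂ x₃ (b * y₁) (b * y₂) (b * y₃) = extZero η₂ b * col h x₁ x₂ x₃ y₁ y₂ y₃ := by
  have := hh.2.1 !![x₁, y₁; x₂, y₂; x₃, y₃] 1 0 b one_ne_zero hb
  rw [extZero_one, one_mul] at this
  rw [col, col, ← this]
  congr 1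
  ext i j
  fin_cases i <;> fin_cases j <;> simp [mul_comm]

theorem col_add₂ (hh : h ∈ flagSpace η₁₂ η₂ m) (b x₁ x₂ x₃ y₁ y₂ y₃ : F) :
    col h x₁ x₂ x₃ (y₁ + b * x₁) (y₂ + b * x₂) (y₃ + b * x₃) = col h x₁ x₂ x₃ y₁ y₂ y₃ := by
  have := hh.2.1 !![x₁, y₁; x₂, y₂; x₃, y₃] 1 b 1 one_ne_zero one_ne_zero
  rw [extZero_one, one_mul, extZero_one, one_mul] at this
  rw [col, col, ← this]
  congr 1
  ext i j
  fin_cases i <;> fin_cases j <;> simp [mul_comm, add_comm]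

theorem col_unip (hh : h ∈ flagSpace η₁₂ η₂ m) (v w : intRing F) (x₁ x₂ x₃ y₁ y₂ y₃ : F) :
    col h (x₁ + v * x₃) (x₂ + w * x₃) x₃ (y₁ + v * y₃) (y₂ + w * y₃) y₃ =
      col h x₁ x₂ x₃ y₁ y₂ y₃ := by
  refine .trans ?_ (isUnipInv_of_mem hh v w _)
  rw [col]
  congr 1
  ext i j
  fin_cases i <;> fin_cases j <;> simp [unipMat]

theorem col_unit (hh : h ∈ flagSpace η₁₂ η₂ m) (u : (intRing F)ˣ) (x₁ x₂ x₃ y₁ y₂ y₃ : F) :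
    col h x₁ x₂ ((u : intRing F) * x₃) y₁ y₂ ((u : intRing F) * y₃) =
      col h x₁ x₂ x₃ y₁ y₂ y₃ := by
  refine .trans ?_ (hh.2.2.2 u _)
  rw [col]
  congr 1
  ext i j
  fin_cases i <;> fin_cases j <;> simp [contr]

theorem col_lower (hh : h ∈ flagSpace η₁₂ η₂ m) {α β γ : intRing F} (hα : α ∈ maxIdeal F ^ m)
    (hβ : β ∈ maxIdeal F ^ m) (hγ : γ ∈ maxIdeal F ^ m) (x₁ x₂ x₃ y₁ y₂ y₃ : F) :
    col h x₁ (x₂ + α * x₁) (x₃ + β * x₁ + γ * x₂) y₁ (y₂ + α * y₁) (y₃ + β * y₁ + γ * y₂) =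
      col h x₁ x₂ x₃ y₁ y₂ y₃ := by
  refine .trans ?_
    (hh.2.2.1 (!![1, 0, 0; α, 1, 0; β, γ, 1] : Matrix (Fin 3) (Fin 3) (intRing F)) ?_ _)
  · rw [col]
    congr 1
    ext i j
    fin_cases i <;> fin_cases j <;> simp [Matrix.mul_apply, Fin.sum_univ_three] <;> ring
  · intro i j hij
    fin_cases i <;> fin_cases j <;> simp_all

theorem col_eigen (he : IsFlagEigen h) {x : intRing F} (hx : x ≠ 0) (x₁ x₂ x₃ y₁ y₂ y₃ : F) :
    col h x₁ x₂ x₃ y₁ y₂ y₃ = integralO fun v : intRing F => integralO fun w : intRing F =>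
      col h (x₁ - v * x₃) (x₂ - w * x₃) (x * x₃) (y₁ - v * y₃) (y₂ - w * y₃) (x * y₃) := by
  rw [col, ← he x hx, flagAvg]
  congr! 5 with v w
  rw [col]
  congr 1
  ext i j
  fin_cases i <;> fin_cases j <;>
    simp [contr, unipMat, Matrix.mul_apply, Fin.sum_univ_three] <;> ring

/-! #### Interchanging the first two rows -/

/-- The function obtained by interchanging the first two rows. -/
def swapRow (h : Matrix (Fin 3) (Fin 2) F → C) (M : Matrix (Fin 3) (Fin 2) F) : C :=
  h ((!![0, 1, 0; 1, 0, 0; 0, 0, 1] : Matrix (Fin 3) (Fin 3) F) * M)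

theorem col_swapRow (x₁ x₂ x₃ y₁ y₂ y₃ : F) :
    col (swapRow h) x₁ x₂ x₃ y₁ y₂ y₃ = col h x₂ x₁ x₃ y₂ y₁ y₃ := by
  rw [col, col, swapRow]
  congr 1
  ext i j
  fin_cases i <;> fin_cases j <;> simp [Matrix.mul_apply, Fin.sum_univ_three]

theorem swapRow_mem (hh : h ∈ flagSpace η₁₂ η₂ m) : swapRow h ∈ flagSpace η₁₂ η₂ m := by
  refine ⟨fun M c hc hM => ?_, fun M a b d ha hd => ?_, fun k hk M => ?_, fun u M => ?_⟩
  · exact hh.1 _ c hc (by rw [← Matrix.mulVec_mulVec, hM, Matrix.mulVec_zero])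
  · rw [swapRow, ← Matrix.mul_assoc, hh.2.1 _ _ _ _ ha hd]
    rfl
  -- The conjugate of `k` by the row interchange, which is again in the parahoric set.
  · refine .trans ?_ (hh.2.2.1 (!![k 1 1, k 1 0, k 1 2; k 0 1, k 0 0, k 0 2;
      k 2 1, k 2 0, k 2 2] : Matrix (Fin 3) (Fin 3) (intRing F)) ?_ _)
    · rw [swapRow]
      congr 1
      ext i j
      fin_cases i <;> fin_cases j <;>
        simp [Matrix.vecMul, dotProduct, Matrix.mul_apply, Fin.sum_univ_three] <;> ring
    · intro i j hij
      have h00 := hk 0 0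
      have h01 := hk 0 1
      have h10 := hk 1 0
      have h11 := hk 1 1
      have h20 := hk 2 0
      have h21 := hk 2 1
      have h22 := hk 2 2
      fin_cases i <;> fin_cases j <;> simp_all
  · refine .trans ?_ (hh.2.2.2 u _)
    rw [swapRow]
    congr 1
    ext i j
    fin_cases i <;> fin_cases j <;>
      simp [contr, Matrix.vecMul, dotProduct, Matrix.mul_apply, Fin.sum_univ_three]

variable [Finite (IsLocalRing.ResidueField (intRing F))] [CharZero C]

/-- Interchanging the rows interchanges the integration variables `v` and `w`. -/
theorem swapRow_eigen (hh : h ∈ flagSpace η₁₂ η₂ m) (he : IsFlagEigen h) :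
    IsFlagEigen (swapRow h) := by
  intro x hx M
  rw [swapRow, ← he x hx]
  refine .trans ?_ (integralO_swap ((isUnipInv_of_mem hh).hasLevel₂ hx _)).symm
  refine congrArg _ (funext fun v => congrArg _ (funext fun w => congrArg h ?_))
  ext i j
  fin_cases i <;> fin_cases j <;>
    simp [contr, unipMat, Matrix.vecMul, dotProduct, Matrix.mul_apply, Fin.sum_univ_three]

/-! #### The formulas -/

/-- Absorbs the inner average that appears when the eigenvector equation is applied under an
integral. -/
theorem integralO_shift {φ : intRing F → C} (hφ : HasLevel φ) (c : intRing F) :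
    (integralO fun s => integralO fun t => φ (s + c * t)) = integralO φ := by
  obtain ⟨n, hn⟩ := hφ
  rw [integralO_swap]
  · have : ∀ t : intRing F, (integralO fun s => φ (s + c * t)) = integralO φ := fun t =>
      integralO_add_right ⟨n, hn⟩ _
    simp only [this, integralO_const]
  · refine ⟨n, fun s x y hxy => hn _ _ ?_, fun t x y hxy => hn _ _ ?_⟩
    · have := Ideal.mul_mem_left _ c hxy
      convert this using 1
      ring
    · simpa using hxy

/-- The last row is `x` times the coefficients of `t` in the second row, so changing `t` by a
multiple of `x` is a row operation from `N₀`. -/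
theorem hasLevel_col (hh : h ∈ flagSpace η₁₂ η₂ m) (x₁ a b d e : F) {x : intRing F} (hx : x ≠ 0) :
    HasLevel fun t : intRing F => col h x₁ (a + b * t) (x * b) 0 (d + e * t) (x * e) := by
  obtain ⟨n, hn⟩ := exists_pow_le_span hx
  refine ⟨n, fun t t' ht => ?_⟩
  obtain ⟨z, hz⟩ := hn _ ht
  have h1 : (t : F) = t' + x * z := by
    rw [← Subring.coe_mul, ← hz]; simp
  simp only
  refine .trans ?_ (col_unip hh 0 z x₁ (a + b * t') _ _ _ _)
  apply col_congr <;> first | rfl | (rw [h1]; ring) | simp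

/-- One integration in the eigenvector equation can be carried out on the cell of `1`. -/
theorem col_eq_delta_mul_integralO (hη : IsSmoothChar η₁₂) (hh : h ∈ flagSpace η₁₂ η₂ m)
    (he : IsFlagEigen h) (a d e : intRing F) {b x : intRing F} (hb : b ∈ maxIdeal F) (hx : x ≠ 0) :
    col h 1 a b 0 d e = delta (b ∈ maxIdeal F ^ charConductor η₁₂) *
      integralO fun t : intRing F => col h 1 (a + b * t) (x * b) 0 (d + e * t) (x * e) := by
  set Φ := fun t : intRing F => col h 1 (a + b * t) (x * b) 0 (d + e * t) (x * e) with hΦ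
  have hlev : HasLevel Φ := hasLevel_col hh 1 a b d e hx
  rw [col_eigen he hx]
  have key : ∀ v : intRing F, (integralO fun w : intRing F =>
      col h (1 - v * b) (a - w * b) (x * b) (0 - v * e) (d - w * e) (x * e)) =
      extZero η₁₂ (1 - v * b : F) * integralO Φ := by
    intro v
    obtain ⟨u, hu⟩ := isUnit_one_sub (Ideal.mul_mem_left _ v hb)
    have huF : ((u : intRing F) : F) = 1 - v * b := by rw [hu]; simp
    have hu0 := coe_unit_ne_zero u
    -- Dividing the first column by `u = 1 - v b` turns its second entry into `(a - w b) / u = a + b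
    -- t` with `t = (a v - w) / u`; this is the change of variables. The unit `u` in the last row is
    -- removed by `col_unit`.
    rw [← integralO_affine hlev (-u⁻¹) ((u⁻¹ : (intRing F)ˣ) * (a * v)),
      ← integralO_const_mul _ (hlev.comp fun n s t hst => by
        have := Ideal.mul_mem_left _ ((-u⁻¹ : (intRing F)ˣ) : intRing F) hst
        convert this using 1
        ring)]
    congr 1
    funext w
    set t : intRing F := ((-u⁻¹ : (intRing F)ˣ) : intRing F) * w +
      (u⁻¹ : (intRing F)ˣ) * (a * v) with ht
    set i : F := ((u : intRing F) : F)⁻¹ with hi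
    have hui : ((u : intRing F) : F) * i = 1 := mul_inv_cancel₀ hu0
    have htF : (t : F) = (a * v - w) * i := by
      rw [ht]; push_cast; rw [coe_inv_unit]; ring
    have e1 : Φ t = col h 1 (a + b * t) (i * (x * b)) 0 (d + e * t) (i * (x * e)) := by
      rw [hΦ, ← col_unit hh u]
      apply col_congr <;> first | rfl | (rw [← mul_assoc, hui, one_mul])
    rw [e1, ← huF, ← col_smul₁ hh hu0]
    -- This multiple of the first column produces the entry `-v e` at the top of the second.
    refine .trans ?_ (col_add₂ hh (-(v * e * i)) _ _ _ _ _ _)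
    have hv : (v : F) * b = 1 - (u : intRing F) := by rw [huF]; ring
    apply col_congr
    · rw [mul_one, huF]
    · rw [htF]
      linear_combination (-a * 1) * hv + (-b * (a * v - w)) * hui
    · linear_combination (-(x * b : F)) * hui
    · linear_combination (v * e : F) * hui
    · rw [htF]
      linear_combination (v * e * a - e * (a * v - w) + v * e * b * (a * v - w) * i : F) * hui +
        (e * (a * v - w) * i : F) * hv
    · linear_combination (-(x * e) + v * e * i * x * b: F) * hui + (x * e * i : F) * hv
  simp only [key]
  rw [integralO_mul_const, integralO_extZero_one_sub hη hb]
  have := hη.hasLevel (e := fun v => 1 - v * b) (fun n x y hxy => by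
    have := Ideal.mul_mem_left _ (-b) hxy
    convert this using 1
    ring) fun t => isUnit_one_sub (Ideal.mul_mem_left _ t hb)
  simpa using this

/-- The last row is `x - a γ` times the first row plus `γ` times the second, and both coefficients
are small enough for the level. -/
theorem col_third (hh : h ∈ flagSpace η₁₂ η₂ m) (a : intRing F) {x γ : intRing F} (d : F)
    (hx : x ∈ maxIdeal F ^ m) (hγ : γ ∈ maxIdeal F ^ m) :
    col h 1 a x 0 d (γ * d) = col h 1 a 0 0 d 0 := by
  rw [← col_lower hh (zero_mem _) (sub_mem hx (Ideal.mul_mem_left _ a hγ)) hγ 1 a 0 0 d 0]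
  apply col_congr <;> simp
  ring

theorem exists_mem_pow_ne_zero (n : ℕ) : ∃ x : intRing F, x ≠ 0 ∧ x ∈ maxIdeal F ^ n := by
  obtain ⟨ϖ, hϖ⟩ := IsDiscreteValuationRing.exists_irreducible (intRing F)
  exact ⟨ϖ ^ n, pow_ne_zero n hϖ.ne_zero, Ideal.pow_mem_pow (uniformizer_mem hϖ) n⟩

/-- The formula on the cell of `1`. -/
theorem col_cell_one (hη : IsSmoothChar η₁₂) (hh : h ∈ flagSpace η₁₂ η₂ m)
    (he : IsFlagEigen h) (a : intRing F) {b c : intRing F} (hb : b ∈ maxIdeal F)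
    (hc : c ∈ maxIdeal F) :
    col h 1 a b 0 1 c = delta (b ∈ maxIdeal F ^ charConductor η₁₂) *
      integralO fun t : intRing F => extZero η₂ (1 + c * t : F) * col h 1 (a + b * t) 0 0 1 0 := by
  -- For `x` in `(ϖ ^ m)` the last row `(x b, x c)` can be cleared by `col_third`; what remains of
  -- the second column is the unit `1 + c t` times `(0, 1, 0)`.
  obtain ⟨x, hx0, hx⟩ := exists_mem_pow_ne_zero (F := F) m
  have := col_eq_delta_mul_integralO hη hh he a 1 c hb hx0
  rw [Subring.coe_one] at this
  rw [this]
  congr 2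
  funext t
  obtain ⟨u, hu⟩ := isUnit_one_add (Ideal.mul_mem_right t _ hc)
  have huF : ((u : intRing F) : F) = 1 + c * t := by rw [hu]; simp
  have hu0 := coe_unit_ne_zero u
  rw [← huF, ← col_smul₂ hh hu0]
  have h1 := col_third hh (a + b * t) ((u : intRing F) : F)
    (Ideal.mul_mem_right b _ hx) (Ideal.mul_mem_right (c * (u⁻¹ : (intRing F)ˣ)) _ hx)
  push_cast at h1
  rw [coe_inv_unit] at h1
  rw [mul_zero, mul_one, ← h1]
  apply col_congr <;> first | rfl | field_simp

/-- If `t ∈ (ϖ ^ m)`, then `c t` and `y c` are small and both differences vanish. Otherwise `y / t ∈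
(ϖ ^ m)`, because `y ∈ (ϖ ^ (2m))`, so the last row can be cleared in both terms, and the entry `t`
comes out as `η₂(t)`. Without the subtraction nothing could be said near `t = 0`. -/
theorem col_sub_col (hh : h ∈ flagSpace η₁₂ η₂ m) (a c : intRing F) {y : intRing F}
    (hy : y ∈ maxIdeal F ^ (m + m)) (t : intRing F) :
    col h 1 (a + c * t) (y * c) 0 t y - col h 1 a 0 0 t y =
      extZero η₂ (t : F) * (col h 1 (a + c * t) 0 0 1 0 - col h 1 a 0 0 1 0) := by
  have hym : y ∈ maxIdeal F ^ m := Ideal.pow_le_pow_right (Nat.le_add_left m m) hy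
  by_cases ht : t ∈ maxIdeal F ^ m
  · have h1 := col_lower hh (Ideal.mul_mem_left _ c ht) (Ideal.mul_mem_right c _ hym)
      (zero_mem _) 1 a 0 0 t y
    have h2 := col_lower hh (Ideal.mul_mem_left _ c ht) (zero_mem _) (zero_mem _) 1 a 0 0 1 0
    simp only [Subring.coe_mul, Subring.coe_zero, mul_one, zero_mul, mul_zero, add_zero,
      zero_add] at h1 h2
    rw [h1, h2]
    ring
  · obtain ⟨ϖ, hϖ⟩ := IsDiscreteValuationRing.exists_irreducible (intRing F)
    have ht0 : t ≠ 0 := by rintro rfl; exact ht (zero_mem _)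
    obtain ⟨k, u, rfl⟩ := IsDiscreteValuationRing.eq_unit_mul_pow_irreducible ht0 hϖ
    obtain ⟨z, rfl⟩ := (mem_pow_iff_dvd hϖ).1 hy
    have hk : k ≤ m := by
      by_contra hk
      exact ht (Ideal.mul_mem_left _ _ ((mem_pow_iff_dvd hϖ).2 (pow_dvd_pow _ (not_le.1 hk).le)))
    obtain ⟨l, rfl⟩ := Nat.exists_eq_add_of_le hk
    -- This element is `y / t`.
    have hγ : ϖ ^ (k + l) * (ϖ ^ l * (z * (u⁻¹ : (intRing F)ˣ))) ∈ maxIdeal F ^ (k + l) :=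
      Ideal.mul_mem_right _ _ ((mem_pow_iff_dvd hϖ).2 dvd_rfl)
    have hyγ : ϖ ^ (k + l + (k + l)) * z =
        ϖ ^ (k + l) * (ϖ ^ l * (z * (u⁻¹ : (intRing F)ˣ))) * (u * ϖ ^ k) := by
      have : (u⁻¹ : (intRing F)ˣ) * (u : intRing F) = 1 := Units.inv_mul u
      linear_combination (-(ϖ ^ (k + l + (k + l)) * z)) * this
    have htF : ((u * ϖ ^ k : intRing F) : F) ≠ 0 := fun h0 => ht0 (Subtype.ext h0)
    generalize ϖ ^ (k + l) * (ϖ ^ l * (z * (u⁻¹ : (intRing F)ˣ))) = γ at hyγ hγ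
    generalize ϖ ^ (k + l + (k + l)) * z = y at *
    generalize (u * ϖ ^ k : intRing F) = t at *
    have h1 := col_third hh (a + c * t) (t : F) (Ideal.mul_mem_right c _ hym) hγ
    have h2 := col_third hh a (t : F) (zero_mem _) hγ
    have h3 := col_smul₂ hh htF 1 (a + c * t) 0 0 1 0
    have h4 := col_smul₂ hh htF 1 a 0 0 1 0
    rw [← Subring.coe_mul, ← hyγ] at h1 h2
    simp only [mul_one, mul_zero] at h3 h4
    push_cast at h1 h2
    rw [h1, h2, h3, h4, mul_sub]

/-- The factor `η₂(t)` alone need not be locally constant at `0`; by `col_sub_col` the product is a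
difference of two functions that are. -/
theorem hasLevel_extZero_mul_sub (hh : h ∈ flagSpace η₁₂ η₂ m) (a c : intRing F) :
    HasLevel fun t : intRing F =>
      extZero η₂ (t : F) * (col h 1 (a + c * t) 0 0 1 0 - col h 1 a 0 0 1 0) := by
  obtain ⟨y, hy0, hy⟩ := exists_mem_pow_ne_zero (F := F) (m + m)
  simp only [← col_sub_col hh a c hy]
  have h1 := hasLevel_col hh 1 a c 0 1 hy0
  have h2 := hasLevel_col hh 1 a 0 0 1 hy0
  simp only [zero_add, one_mul, mul_one, zero_mul, mul_zero, add_zero] at h1 h2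
  exact h1.sub h2

/-- The function subtracted in `col_sub_col` integrates, by the eigenvector equation with `b = 0`,
to the value at `ℓ(a) s₂`. -/
theorem integralO_col (hη : IsSmoothChar η₁₂) (hh : h ∈ flagSpace η₁₂ η₂ m)
    (he : IsFlagEigen h) (a c : intRing F) {y : intRing F} (hy0 : y ≠ 0)
    (hy : y ∈ maxIdeal F ^ (m + m)) :
    (integralO fun t : intRing F => col h 1 (a + c * t) (y * c) 0 t y) =
      (integralO fun t : intRing F =>
        extZero η₂ (t : F) * (col h 1 (a + c * t) 0 0 1 0 - col h 1 a 0 0 1 0)) +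
      col h 1 a 0 0 0 1 := by
  have h1 := hasLevel_col hh 1 a c 0 1 hy0
  have h2 := hasLevel_col hh 1 a 0 0 1 hy0
  have h3 := col_eq_delta_mul_integralO hη hh he a 0 1 (zero_mem (maxIdeal F)) hy0
  rw [delta, if_pos (zero_mem _)] at h3
  simp only [zero_add, one_mul, mul_one, zero_mul, mul_zero, add_zero, Subring.coe_zero,
    Subring.coe_one] at h1 h2 h3
  simp only [← col_sub_col hh a c hy]
  rw [h3, integralO_sub h1 h2, sub_add_cancel]

/-- For unramified `η₂` the eigenvector equation for `ϖ` averages over `t` the values with second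
column `(0, t, ϖ)`: these are `η₂(ϖ) S` for `t ∈ (ϖ)` and `φ` for units `t`. Hence `S = q⁻¹ η₂(ϖ) S
+ (1 - q⁻¹) φ`. -/
theorem col_cell_two_zero (hη : IsSmoothChar η₁₂) (hη₂ : IsSmoothChar η₂)
    (hh : h ∈ flagSpace η₁₂ η₂ m) (he : IsFlagEigen h) {ϖ : intRing F} (hϖ : Irreducible ϖ)
    (hne : charConductor η₂ = 0 → (resCard F : C) - extZero η₂ (ϖ : F) ≠ 0) (a : intRing F) :
    col h 1 a 0 0 0 1 = delta (charConductor η₂ = 0) *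
      (((resCard F : C) - 1) / ((resCard F : C) - extZero η₂ (ϖ : F))) * col h 1 a 0 0 1 0 := by
  by_cases h0 : charConductor η₂ = 0
  · rw [delta, if_pos h0, one_mul]
    have hϖ0 : (ϖ : F) ≠ 0 := norm_pos_iff.1 (norm_uniformizer_pos hϖ)
    set S := col h 1 a 0 0 0 1 with hS
    set φ := col h 1 a 0 0 1 0 with hφ
    have h3 := col_eq_delta_mul_integralO hη hh he a 0 1 (zero_mem (maxIdeal F)) hϖ.ne_zero
    rw [delta, if_pos (zero_mem _)] at h3
    simp only [zero_add, one_mul, mul_one, zero_mul, mul_zero, add_zero, Subring.coe_zero,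
      Subring.coe_one] at h3
    have hpt : (fun t : intRing F => col h 1 a 0 0 t ϖ) = fun t =>
        onMaxIdeal (fun _ => (1 : C)) t * (extZero η₂ (ϖ : F) * S - φ) + φ := by
      funext t
      unfold onMaxIdeal
      split_ifs with ht
      · obtain ⟨s, rfl⟩ := (mem_maxIdeal_iff_dvd hϖ).1 ht
        have h1 := col_smul₂ hh hϖ0 1 a 0 0 s 1
        have h2 := col_unip hh 0 s 1 a 0 0 0 1
        simp only [mul_zero, mul_one, add_zero, zero_add, Subring.coe_zero] at h1 h2
        rw [Subring.coe_mul, h1, h2]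
        ring
      · obtain ⟨u, rfl⟩ := isUnit_of_notMem ht
        have hu0 := coe_unit_ne_zero u
        have h1 := col_smul₂ hh hu0 1 a 0 0 1 (((u : intRing F) : F)⁻¹ * ϖ)
        have h2 := col_unit hh u 1 a 0 0 1 (((u : intRing F) : F)⁻¹ * ϖ)
        simp only [mul_zero, mul_one, mul_inv_cancel_left₀ hu0] at h1 h2
        -- After the second column and the last row are rescaled by the unit `t`, the point lies in
        -- the cell of `1` with `b = 0`, `c = ϖ`, where every `η₂(1 + ϖ t)` is `1`.
        have h4 := col_cell_one hη hh he a (zero_mem (maxIdeal F)) (uniformizer_mem hϖ)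
        rw [delta, if_pos (zero_mem _), one_mul] at h4
        have h5 : ∀ t : intRing F, extZero η₂ (1 + ϖ * t : F) = (1 : C) := fun t => by
          have := extZero_unit_eq_one hη₂ h0
            (isUnit_one_add (Ideal.mul_mem_right t _ (uniformizer_mem hϖ)))
          simpa using this
        simp only [h5, one_mul, Subring.coe_zero, zero_mul, add_zero, integralO_const] at h4
        rw [h1, ← h2, h4, extZero_unit_eq_one hη₂ h0 u.isUnit]
        ring
    have hl : HasLevel (onMaxIdeal fun _ : intRing F => (1 : C)) := ⟨1, isLevel_onMaxIdeal_const 1⟩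
    rw [hpt, integralO_add (hl.mul (hasLevel_const _)) (hasLevel_const _), integralO_const,
      integralO_mul_const _ hl, integralO_onMaxIdeal_one] at h3
    have hq : (resCard F : C) ≠ 0 := resCard_ne_zero
    have := hne h0
    field_simp at h3 ⊢
    linear_combination h3
  · rw [delta, if_neg h0, zero_mul, zero_mul]
    -- On this matrix, multiplying the second column by `u` is the same as multiplying the last row
    -- by `u`, which has no effect; so the value equals `η₂(u)` times itself.
    obtain ⟨u, -, hu⟩ := exists_ne_one_of_lt_charConductor (Nat.pos_of_ne_zero h0)
    have h1 := col_smul₂ hh (coe_unit_ne_zero u) 1 a 0 0 0 1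
    have h2 := col_unit hh u 1 a 0 0 0 1
    simp only [mul_zero, mul_one] at h1 h2
    rw [h1] at h2
    by_contra hne
    apply hu
    have := (mul_eq_right₀ hne).1 h2
    rw [extZero_unit] at this
    exact Units.val_eq_one.1 this

/-- The formula on the cell of `s₂`. -/
theorem col_cell_two (hη : IsSmoothChar η₁₂) (hη₂ : IsSmoothChar η₂)
    (hh : h ∈ flagSpace η₁₂ η₂ m) (he : IsFlagEigen h) {ϖ : intRing F} (hϖ : Irreducible ϖ)
    (hne : charConductor η₂ = 0 → (resCard F : C) - extZero η₂ (ϖ : F) ≠ 0) (a : intRing F)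
    {c : intRing F} (hc : c ∈ maxIdeal F) :
    col h 1 a c 0 0 1 = delta (c ∈ maxIdeal F ^ charConductor η₁₂) *
      ((integralO fun t : intRing F =>
        extZero η₂ (t : F) * (col h 1 (a + c * t) 0 0 1 0 - col h 1 a 0 0 1 0)) +
      delta (charConductor η₂ = 0) *
      (((resCard F : C) - 1) / ((resCard F : C) - extZero η₂ (ϖ : F))) * col h 1 a 0 0 1 0) := by
  obtain ⟨y, hy0, hy⟩ := exists_mem_pow_ne_zero (F := F) (m + m)
  have := col_eq_delta_mul_integralO hη hh he a 0 1 hc hy0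
  simp only [zero_add, one_mul, mul_one, Subring.coe_zero, Subring.coe_one] at this
  rw [this, integralO_col hη hh he a c hy0 hy, col_cell_two_zero hη hη₂ hh he hϖ hne]

end Formulas

/-! ### The value on the cell of `s₂s₁`. -/

section LastCell

open Matrix

variable {F : Type*} [NontriviallyNormedField F] [IsUltrametricDist F]
variable {C : Type*} [Field C]
variable [IsDiscreteValuationRing (intRing F)]
variable {η₁₂ η₂ : Fˣ →* Cˣ} {m : ℕ} {h : Matrix (Fin 3) (Fin 2) F → C}
variable [Finite (IsLocalRing.ResidueField (intRing F))] [CharZero C]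

theorem onMaxIdeal_of_mem {φ : intRing F → C} {t : intRing F} (ht : t ∈ maxIdeal F) :
    onMaxIdeal φ t = φ t := if_pos ht

theorem onMaxIdeal_of_notMem {φ : intRing F → C} {t : intRing F} (ht : t ∉ maxIdeal F) :
    onMaxIdeal φ t = 0 := if_neg ht

theorem onMaxIdeal_eq_mul (φ : intRing F → C) (t : intRing F) :
    onMaxIdeal φ t = onMaxIdeal (fun _ => 1) t * φ t := by
  by_cases ht : t ∈ maxIdeal F
  · simp [onMaxIdeal_of_mem ht]
  · simp [onMaxIdeal_of_notMem ht]

theorem hasLevel_one_onMaxIdeal : HasLevel (onMaxIdeal fun _ : intRing F => (1 : C)) :=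
  ⟨1, isLevel_onMaxIdeal_const 1⟩

theorem integralO_one_sub_onMaxIdeal_mul (c : C) :
    integralO (fun t : intRing F => (1 - onMaxIdeal (fun _ => (1 : C)) t) * c) =
      (1 - (resCard F : C)⁻¹) * c := by
  rw [integralO_mul_const _ ((hasLevel_const 1).sub hasLevel_one_onMaxIdeal),
    integralO_sub (hasLevel_const 1) hasLevel_one_onMaxIdeal, integralO_const,
    integralO_onMaxIdeal_one]

/-- Splitting a double integral according to which variables are units. -/
theorem integralO_split {Γ : intRing F → intRing F → C} (hΓ : HasLevel₂ Γ) {A J S : C}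
    (h1 : ∀ v, v ∉ maxIdeal F → integralO (Γ v) = A)
    (h2 : ∀ v ∈ maxIdeal F, ∀ w ∈ maxIdeal F, Γ v w = S)
    (h3 : ∀ w, w ∉ maxIdeal F → integralO (onMaxIdeal fun v => Γ v w) = J) :
    (integralO fun v => integralO fun w => Γ v w) =
      (1 - (resCard F : C)⁻¹) * A + ((resCard F : C)⁻¹ * ((resCard F : C)⁻¹ * S) +
        (1 - (resCard F : C)⁻¹) * J) := by
  set δ : intRing F → C := onMaxIdeal fun _ => 1 with hδ
  have hδl : HasLevel δ := hasLevel_one_onMaxIdeal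
  have hδ₂ : HasLevel₂ fun v _ : intRing F => δ v :=
    ⟨1, fun _ _ _ _ => rfl, fun _ => isLevel_onMaxIdeal_const 1⟩
  have hδΓ : HasLevel₂ fun v w => δ v * Γ v w := hδ₂.map₂ (· * ·) hΓ
  have e1 : ∀ v, (integralO fun w => Γ v w) =
      (1 - δ v) * A + integralO fun w => δ v * Γ v w := by
    intro v
    rw [integralO_const_mul _ (hΓ.left v)]
    by_cases hv : v ∈ maxIdeal F
    · rw [hδ, onMaxIdeal_of_mem hv]; ring
    · rw [hδ, onMaxIdeal_of_notMem hv, ← h1 v hv]; ring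
  have e2 : ∀ w, (integralO fun v => δ v * Γ v w) =
      δ w * ((resCard F : C)⁻¹ * S) + (1 - δ w) * J := by
    intro w
    by_cases hw : w ∈ maxIdeal F
    · have : (fun v => δ v * Γ v w) = fun v => δ v * S := by
        funext v
        by_cases hv : v ∈ maxIdeal F
        · rw [h2 v hv w hw]
        · rw [hδ, onMaxIdeal_of_notMem hv, zero_mul, zero_mul]
      rw [this, integralO_mul_const _ hδl, integralO_onMaxIdeal_one, hδ, onMaxIdeal_of_mem hw]
      ring
    · have : (fun v => δ v * Γ v w) = onMaxIdeal fun v => Γ v w :=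
        funext fun v => (onMaxIdeal_eq_mul (fun v => Γ v w) v).symm
      rw [this, h3 w hw, hδ, onMaxIdeal_of_notMem hw]
      ring
  simp only [e1]
  rw [integralO_add (((hasLevel_const 1).sub hδl).mul (hasLevel_const A)) hδΓ.integral,
    integralO_one_sub_onMaxIdeal_mul, integralO_swap hδΓ]
  simp only [e2]
  rw [integralO_add (hδl.mul (hasLevel_const _))
    (((hasLevel_const 1).sub hδl).mul (hasLevel_const J)), integralO_one_sub_onMaxIdeal_mul,
    integralO_mul_const _ hδl, integralO_onMaxIdeal_one]

theorem isLevel_col_one (hh : h ∈ flagSpace η₁₂ η₂ m) (a c : intRing F) :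
    IsLevel (fun t : intRing F => col h 1 (a + c * t) 0 0 1 0) m := by
  intro s t hst
  have := col_lower hh (Ideal.mul_mem_left _ c hst) (zero_mem _) (zero_mem _) 1 (a + c * t) 0 0 1 0
  simp only [mul_one, mul_zero, add_zero, Subring.coe_zero, zero_mul] at this
  simp only
  rw [← this]
  apply col_congr <;> simp
  ring

theorem hasLevel_extZero_one_add (hη₂ : IsSmoothChar η₂) {c : intRing F} (d : intRing F)
    (hc : ∀ t, IsUnit (d + c * t)) : HasLevel fun t : intRing F => extZero η₂ (d + c * t : F) := by
  have := hη₂.hasLevel (e := fun t => d + c * t) (fun n x y hxy => by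
    have := Ideal.mul_mem_left _ c hxy
    convert this using 1
    ring) hc
  simpa using this

/-- The value on the big cell expressed through the values on the cells of `1` and of `s₂`. -/
theorem integralO_col_of_unit (hη : IsSmoothChar η₁₂) (hη0 : charConductor η₁₂ = 0)
    (hh : h ∈ flagSpace η₁₂ η₂ m) (he : IsFlagEigen h) {ϖ : intRing F} (hϖ : Irreducible ϖ)
    (a : intRing F) {v : intRing F} (hv : v ∉ maxIdeal F) :
    (integralO fun w : intRing F => col h v w ϖ (-1) (-a) 0) =
      (integralO fun t : intRing F =>
        extZero η₂ (t : F) * (col h 1 (a + t) 0 0 1 0 - col h 1 a 0 0 1 0)) +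
      col h 1 a 0 0 0 1 := by
  obtain ⟨u, rfl⟩ := isUnit_of_notMem hv
  have hu0 := coe_unit_ne_zero u
  obtain ⟨x, hx0, hx⟩ := exists_mem_pow_ne_zero (F := F) (m + m)
  have hy0 : x * ϖ ≠ 0 := mul_ne_zero hx0 hϖ.ne_zero
  have hy : x * ϖ ∈ maxIdeal F ^ (m + m) := Ideal.mul_mem_right _ _ hx
  set Λ := fun t : intRing F => col h 1 (a + t) ϖ 0 t ϖ with hΛ
  set Λy := fun t : intRing F => col h 1 (a + t) (x * ϖ : intRing F) 0 t (x * ϖ : intRing F)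
    with hΛy
  have hΛyl : HasLevel Λy := by
    have := hasLevel_col hh 1 a 1 0 1 hy0
    simpa [hΛy] using this
  have hΛl : HasLevel Λ := by
    have := hasLevel_col hh 1 a 1 0 1 hϖ.ne_zero
    simpa using this
  -- Adding `u⁻¹` times the first column to the second clears the `-1`. Dividing the first column
  -- and rescaling the last row by units then gives columns `(1, a + t, ϖ)` and `(0, t, ϖ)` with `t
  -- = u⁻¹ w - a`.
  have e1 : ∀ w : intRing F, col h (u : intRing F) w ϖ (-1) (-a) 0 =
      Λ ((u⁻¹ : (intRing F)ˣ) * w + -a) := by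
    intro w
    have f1 := col_add₂ hh ((u : intRing F) : F)⁻¹ (u : intRing F) w ϖ (-1) (-a) 0
    have f2 := col_smul₁ hh hu0 1 (((u : intRing F) : F)⁻¹ * w) (((u : intRing F) : F)⁻¹ * ϖ) 0
      (((u : intRing F) : F)⁻¹ * w - a) (((u : intRing F) : F)⁻¹ * ϖ)
    have f3 := col_unit hh u⁻¹ 1 (((u : intRing F) : F)⁻¹ * w) ϖ 0
      (((u : intRing F) : F)⁻¹ * w - a) ϖ
    rw [coe_inv_unit] at f3
    rw [f3, extZero_unit_eq_one hη hη0 u.isUnit, one_mul] at f2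
    rw [← f1, hΛ]
    simp only
    push_cast
    rw [coe_inv_unit]
    refine .trans ?_ (f2.trans ?_)
    · apply col_congr
      · rw [mul_one]
      · rw [mul_inv_cancel_left₀ hu0]
      · rw [mul_inv_cancel_left₀ hu0]
      · rw [inv_mul_cancel₀ hu0]; ring
      · ring
      · ring
    · apply col_congr <;> ring
  -- One more use of the eigenvector equation replaces `ϖ` by the smaller `x ϖ` in the last row, at
  -- the cost of an average over `t + ϖ s` that is harmless under the integral over `t`.
  have e2 : ∀ t : intRing F, Λ t = integralO fun s => Λy (t + ϖ * s) := by
    intro t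
    have := col_eq_delta_mul_integralO hη hh he (a + t) t ϖ (uniformizer_mem hϖ) hx0
    rw [hη0, pow_zero, delta, if_pos (by simp), one_mul] at this
    rw [hΛ, hΛy]
    simp only
    push_cast at this ⊢
    rw [this]
    simp only [add_assoc]
  have e3 := integralO_col hη hh he a 1 hy0 hy
  simp only [Subring.coe_one, one_mul, mul_one] at e3
  rw [funext e1, ← e3, integralO_affine hΛl]
  rw [funext e2]
  exact integralO_shift hΛyl ϖ

theorem hasLevel_onMaxIdeal_col (hη₂ : IsSmoothChar η₂) (hh : h ∈ flagSpace η₁₂ η₂ m)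
    (a : intRing F) : HasLevel (onMaxIdeal fun s : intRing F =>
      extZero η₂ (1 - a * s : F) * col h s 1 0 (-1) 0 0) := by
  have h1 : HasLevel fun t : intRing F => col h t 1 0 (-1) 0 0 := by
    refine ⟨m, fun s t hst => ?_⟩
    have f := fun t : intRing F => col_smul₂ hh (neg_ne_zero.2 (one_ne_zero (α := F)))
      t 1 0 1 0 0
    have := isLevel_col_one (swapRow_mem hh) 0 1 s t hst
    simp only [col_swapRow, Subring.coe_zero, Subring.coe_one, zero_add, one_mul] at this
    simp only [mul_one, mul_zero] at f
    simp only [f, this]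
  obtain ⟨n, hn⟩ := h1
  refine ⟨max (max n 1) (charConductor η₂), fun s t hst => ?_⟩
  have hst1 : s - t ∈ maxIdeal F := by
    have := Ideal.pow_le_pow_right ((le_max_right n 1).trans (le_max_left _ _)) hst
    rwa [pow_one] at this
  have hst2 := hn s t (Ideal.pow_le_pow_right ((le_max_left n 1).trans (le_max_left _ _)) hst)
  have hst3 := Ideal.pow_le_pow_right (le_max_right (max n 1) (charConductor η₂)) hst
  by_cases ht : t ∈ maxIdeal F
  · have hs := (mem_maxIdeal_iff_of_sub_mem hst1).2 ht
    rw [onMaxIdeal_of_mem hs, onMaxIdeal_of_mem ht]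
    simp only at hst2
    rw [hst2]
    congr 1
    obtain ⟨u, hu⟩ := isUnit_one_sub (Ideal.mul_mem_left _ a ht)
    have huF : ((u : intRing F) : F) = 1 - a * t := by rw [hu]; simp
    -- The quotient of `1 - a s` by `1 - a t` is congruent to `1` modulo the conductor.
    have hw : (1 - a * s : intRing F) = u * (1 - (u⁻¹ : (intRing F)ˣ) * (a * (s - t))) := by
      rw [mul_sub, mul_one, Units.mul_inv_cancel_left, hu]; ring
    have hwF : (1 - a * s : F) =
        (u : intRing F) * ((1 - (u⁻¹ : (intRing F)ˣ) * (a * (s - t)) : intRing F) : F) :=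
      (by simp : (1 - a * s : F) = ((1 - a * s : intRing F) : F)).trans (congrArg Subtype.val hw)
    rw [hwF, extZero_mul, ← huF,
      extZero_eq_one hη₂ (x := 1 - (u⁻¹ : (intRing F)ˣ) * (a * (s - t))), mul_one]
    · exact isUnit_one_sub (Ideal.mul_mem_left _ _ (Ideal.mul_mem_left _ _ hst1))
    · rw [sub_sub_cancel_left]
      exact neg_mem (Ideal.mul_mem_left _ _ (Ideal.mul_mem_left _ _ hst3))
  · rw [onMaxIdeal_of_notMem ht,
      onMaxIdeal_of_notMem (mt (mem_maxIdeal_iff_of_sub_mem hst1).1 ht)]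

/-- For `s ∈ (ϖ)`, adding `a` times the first column makes the second column `-u (1, 0, c)` with `u
= 1 - a s` a unit and `c = -u⁻¹ a ϖ`. With rows interchanged this is the cell of `1`, whose formula
averages over `s + ϖ t`; the outer integral over `s` absorbs this average. -/
theorem integralO_onMaxIdeal_col (hη : IsSmoothChar η₁₂) (hη0 : charConductor η₁₂ = 0)
    (hη₂ : IsSmoothChar η₂) (hh : h ∈ flagSpace η₁₂ η₂ m) (he : IsFlagEigen h) {ϖ : intRing F}
    (hϖ : Irreducible ϖ) (a : intRing F) :
    integralO (onMaxIdeal fun s : intRing F => col h s 1 ϖ (-1) (-a) 0) =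
      integralO (onMaxIdeal fun s : intRing F =>
        extZero η₂ (1 - a * s : F) * col h s 1 0 (-1) 0 0) := by
  set Jf := fun s : intRing F => extZero η₂ (1 - a * s : F) * col h s 1 0 (-1) 0 0 with hJf
  have hJl : HasLevel (onMaxIdeal Jf) := hasLevel_onMaxIdeal_col hη₂ hh a
  rw [← integralO_shift hJl ϖ]
  congr 1
  funext s
  have hmem : ∀ t, (s + ϖ * t ∈ maxIdeal F ↔ s ∈ maxIdeal F) := fun t =>
    mem_maxIdeal_iff_of_sub_mem (by
      rw [add_sub_cancel_left]; exact Ideal.mul_mem_right _ _ (uniformizer_mem hϖ))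
  by_cases hs : s ∈ maxIdeal F
  · have e1 : (fun t => onMaxIdeal Jf (s + ϖ * t)) = fun t => Jf (s + ϖ * t) :=
      funext fun t => onMaxIdeal_of_mem ((hmem t).2 hs)
    rw [onMaxIdeal_of_mem hs, e1]
    obtain ⟨u, hu⟩ := isUnit_one_sub (Ideal.mul_mem_left _ a hs)
    have huF : ((u : intRing F) : F) = 1 - a * s := by rw [hu]; simp
    have hu0 := coe_unit_ne_zero u
    set c : intRing F := -((u⁻¹ : (intRing F)ˣ) * a * ϖ) with hc
    have hcm : c ∈ maxIdeal F := neg_mem (Ideal.mul_mem_left _ _ (uniformizer_mem hϖ))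
    have hcF : ((u : intRing F) : F) * c = -(a * ϖ) := by
      rw [hc]; push_cast; rw [coe_inv_unit]; field_simp
    have f1 := col_cell_one hη (swapRow_mem hh) (swapRow_eigen hh he) s (uniformizer_mem hϖ) hcm
    rw [hη0, pow_zero, delta, if_pos (by simp), one_mul] at f1
    simp only [col_swapRow] at f1
    have f2 := col_add₂ hh (a : F) s 1 ϖ (-1) (-a) 0
    have f3 := col_smul₂ hh (neg_ne_zero.2 hu0) s 1 ϖ 1 0 c
    have f4 := fun t : F => col_smul₂ hh (neg_ne_zero.2 (one_ne_zero (α := F))) t 1 0 1 0 0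
    simp only [mul_one, mul_zero] at f4
    have hl : HasLevel fun t : intRing F => extZero η₂ (1 + c * t : F) *
        col h (s + ϖ * t) 1 0 1 0 0 := by
      refine (hasLevel_extZero_one_add hη₂ 1 fun t => isUnit_one_add
        (Ideal.mul_mem_right t _ hcm)).mul ?_ |> fun H => by simpa using H
      have := isLevel_col_one (swapRow_mem hh) s ϖ
      simp only [col_swapRow] at this
      exact ⟨m, this⟩
    rw [← f2]
    have f5 : col h s 1 ϖ (-1 + a * s) (-a + a * 1) (0 + a * ϖ) =
        col h s 1 ϖ (-((u : intRing F) : F) * 1) (-((u : intRing F) : F) * 0)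
          (-((u : intRing F) : F) * c) := by
      apply col_congr <;> first | rfl | ring1 | (rw [neg_mul, hcF]; ring1) | (rw [huF]; ring1)
    rw [f5, f3, f1, ← integralO_const_mul _ hl]
    congr 1
    funext t
    rw [hJf]
    simp only
    push_cast
    rw [f4, ← mul_assoc, ← mul_assoc, ← extZero_mul, ← extZero_mul]
    congr 2
    linear_combination (-t : F) * hcF - huF
  · have e1 : (fun t => onMaxIdeal Jf (s + ϖ * t)) = fun _ => 0 :=
      funext fun t => onMaxIdeal_of_notMem (mt (hmem t).1 hs)
    rw [onMaxIdeal_of_notMem hs, e1, integralO_const]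

/-- The formula on the cell of `s₂s₁`. -/
theorem col_cell_three (hη : IsSmoothChar η₁₂) (hη₂ : IsSmoothChar η₂)
    (hh : h ∈ flagSpace η₁₂ η₂ m) (he : IsFlagEigen h) {ϖ : intRing F} (hϖ : Irreducible ϖ)
    (hne : charConductor η₂ = 0 → (resCard F : C) - extZero η₂ (ϖ : F) ≠ 0)
    (hne' : charConductor η₁₂ = 0 → (resCard F : C) ^ 2 - extZero η₁₂ (ϖ : F) ≠ 0)
    (a : intRing F) :
    col h 0 0 1 (-1) (-a) 0 = delta (charConductor η₁₂ = 0) *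
      ((resCard F : C) * ((resCard F : C) - 1) / ((resCard F : C) ^ 2 - extZero η₁₂ (ϖ : F))) *
      ((integralO fun t : intRing F =>
        extZero η₂ (t : F) * (col h 1 (a + t) 0 0 1 0 - col h 1 a 0 0 1 0)) +
      delta (charConductor η₂ = 0) *
      (((resCard F : C) - 1) / ((resCard F : C) - extZero η₂ (ϖ : F))) * col h 1 a 0 0 1 0 +
      integralO (onMaxIdeal fun s : intRing F =>
        extZero η₂ (1 - a * s : F) * col h s 1 0 (-1) 0 0)) := by
  by_cases h0 : charConductor η₁₂ = 0
  · rw [delta, if_pos h0, one_mul, ← col_cell_two_zero hη hη₂ hh he hϖ hne,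
      ← integralO_onMaxIdeal_col hη h0 hη₂ hh he hϖ]
    set R := col h 0 0 1 (-1) (-a) 0 with hR
    have hϖ0 : (ϖ : F) ≠ 0 := norm_pos_iff.1 (norm_uniformizer_pos hϖ)
    set Γ := fun v w : intRing F => col h v w ϖ (-1) (-a) 0 with hΓ
    have hΓl : HasLevel₂ Γ := by
      obtain ⟨n, hn⟩ := exists_pow_le_span hϖ.ne_zero
      refine ⟨n, fun v w w' hw => ?_, fun w v v' hv => ?_⟩
      · obtain ⟨z, hz⟩ := hn _ hw
        have h1 : (w : F) = w' + ϖ * z := by rw [← Subring.coe_mul, ← hz]; simp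
        have := col_unip hh 0 z v w' ϖ (-1) (-a) 0
        simp only [Subring.coe_zero, zero_mul, mul_zero, add_zero] at this
        rw [hΓ]
        simp only
        rw [h1, ← this, mul_comm]
      · obtain ⟨z, hz⟩ := hn _ hv
        have h1 : (v : F) = v' + ϖ * z := by rw [← Subring.coe_mul, ← hz]; simp
        have := col_unip hh z 0 v' w ϖ (-1) (-a) 0
        simp only [Subring.coe_zero, zero_mul, mul_zero, add_zero] at this
        rw [hΓ]
        simp only
        rw [h1, ← this, mul_comm]
    have key : R = integralO fun v => integralO fun w => Γ v w := by
      -- The signs of `v` and `w` in the eigenvector equation are removed by multiplying both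
      -- variables by `-1`.
      rw [hR, col_eigen he hϖ.ne_zero, ← integralO_unit_mul hΓl.integral (-1)]
      congr 1
      funext v
      rw [← integralO_unit_mul (hΓl.left _) (-1)]
      congr 1
      funext w
      rw [hΓ]
      apply col_congr <;> simp
    -- If `v` is a unit, the integral over `w` is given by `integralO_col_of_unit`. If `v, w ∈ (ϖ)`,
    -- the factor `ϖ` leaves the first column, and `N₀` leads back to `R`. If only `w` is a unit, it
    -- can be normalized to `1`. The result is a linear equation for `R` with coefficient `1 - q⁻²
    -- η₁₂(ϖ)`.
    rw [integralO_split hΓl (S := extZero η₁₂ (ϖ : F) * R)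
      (fun v hv => integralO_col_of_unit hη h0 hh he hϖ a hv) ?_
      (J := integralO (onMaxIdeal fun s : intRing F => col h s 1 ϖ (-1) (-a) 0)) ?_] at key
    · have hq : (resCard F : C) ≠ 0 := resCard_ne_zero
      have := hne' h0
      field_simp
      field_simp at key
      linear_combination key
    · intro v hv w hw
      obtain ⟨v, rfl⟩ := (mem_maxIdeal_iff_dvd hϖ).1 hv
      obtain ⟨w, rfl⟩ := (mem_maxIdeal_iff_dvd hϖ).1 hw
      have h1 := col_smul₁ hh hϖ0 v w 1 (-1) (-a) 0
      have h2 := col_unip hh v w 0 0 1 (-1) (-a) 0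
      simp only [mul_one, mul_zero, zero_add, add_zero] at h1 h2
      rw [hΓ]
      simp only
      push_cast
      rw [h1, h2]
    · intro w hw
      obtain ⟨u, rfl⟩ := isUnit_of_notMem hw
      have hu0 := coe_unit_ne_zero u
      have hl : HasLevel (onMaxIdeal fun s : intRing F => col h s 1 ϖ (-1) (-a) 0) := by
        have := (hΓl.right 1).onMaxIdeal
        simpa [hΓ] using this
      rw [← integralO_unit_mul hl u⁻¹]
      congr 1
      funext v
      have hiff : (u⁻¹ : (intRing F)ˣ) * v ∈ maxIdeal F ↔ v ∈ maxIdeal F :=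
        Ideal.unit_mul_mem_iff_mem _ (Units.isUnit _)
      by_cases hv : v ∈ maxIdeal F
      · rw [onMaxIdeal_of_mem hv, onMaxIdeal_of_mem (hiff.2 hv), hΓ]
        simp only
        push_cast
        rw [coe_inv_unit]
        have h1 := col_smul₁ hh hu0 (((u : intRing F) : F)⁻¹ * v) 1
          (((u : intRing F) : F)⁻¹ * ϖ) (-1) (-a) 0
        have h2 := col_unit hh u⁻¹ (((u : intRing F) : F)⁻¹ * v) 1 ϖ (-1) (-a) 0
        rw [coe_inv_unit, mul_zero] at h2
        rw [h2, extZero_unit_eq_one hη h0 u.isUnit, mul_inv_cancel_left₀ hu0,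
          mul_inv_cancel_left₀ hu0, mul_one, one_mul] at h1
        exact h1
      · rw [onMaxIdeal_of_notMem hv, onMaxIdeal_of_notMem (mt hiff.1 hv)]
  · rw [delta, if_neg h0, zero_mul, zero_mul]
    -- Here scaling the first column and scaling the last row by `u` agree, so the value is
    -- multiplied by some `η₁₂(u) ≠ 1`.
    obtain ⟨u, -, hu⟩ := exists_ne_one_of_lt_charConductor (Nat.pos_of_ne_zero h0)
    have h1 := col_smul₁ hh (coe_unit_ne_zero u) 0 0 1 (-1) (-a) 0
    have h2 := col_unit hh u 0 0 1 (-1) (-a) 0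
    simp only [mul_zero, mul_one] at h1 h2
    rw [h1] at h2
    by_contra hne
    apply hu
    have := (mul_eq_right₀ hne).1 h2
    rw [extZero_unit] at this
    exact Units.val_eq_one.1 this

end LastCell

/-! ### The cell decomposition -/

section Cells

open Matrix

variable {F : Type*} [NontriviallyNormedField F] [IsUltrametricDist F]

variable (F) in
/-- The permutation matrix interchanging the first two rows. -/
def rowSwap : Matrix (Fin 3) (Fin 3) F := !![0, 1, 0; 1, 0, 0; 0, 0, 1]

theorem rowSwap_mul_self : rowSwap F * rowSwap F = 1 := by
  ext i j
  fin_cases i <;> fin_cases j <;> simp [rowSwap, Matrix.mul_apply, Fin.sum_univ_three]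

theorem rowSwap_mul_unipMat (v w : F) : rowSwap F * unipMat v w = unipMat w v * rowSwap F := by
  ext i j
  fin_cases i <;> fin_cases j <;> simp [rowSwap, unipMat, Matrix.mul_apply, Fin.sum_univ_three]

/-- Representatives of the cells of `1`, `s₂` and `s₂s₁`. -/
def IsBasicCell (N : Matrix (Fin 3) (Fin 2) F) : Prop :=
  (∃ a b c : intRing F, b ∈ maxIdeal F ∧ c ∈ maxIdeal F ∧
    N = !![1, 0; (a : F), 1; (b : F), (c : F)]) ∨
  (∃ a c : intRing F, c ∈ maxIdeal F ∧ N = !![1, 0; (a : F), 0; (c : F), 1]) ∨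
  ∃ a : intRing F, N = !![0, 1; 0, (a : F); 1, 0]

/-- `M` can be brought to `N` by the groups `N₀` and `B`. -/
def CellRel (M N : Matrix (Fin 3) (Fin 2) F) : Prop :=
  ∃ (v w : intRing F) (a b d : F), a ≠ 0 ∧ d ≠ 0 ∧
    unipMat (v : F) (w : F) * M * !![a, b; 0, d] = N

theorem CellRel.trans {M N P : Matrix (Fin 3) (Fin 2) F} (h : CellRel M N) (h' : CellRel N P) :
    CellRel M P := by
  obtain ⟨v, w, a, b, d, ha, hd, rfl⟩ := h
  obtain ⟨v', w', a', b', d', ha', hd', rfl⟩ := h'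
  refine ⟨v' + v, w' + w, a * a', a * b' + b * d', d * d', mul_ne_zero ha ha',
    mul_ne_zero hd hd', ?_⟩
  have h1 : !![a * a', a * b' + b * d'; 0, d * d'] = !![a, b; 0, d] * !![a', b'; 0, d'] := by
    ext i j
    fin_cases i <;> fin_cases j <;> simp
  rw [h1, Subring.coe_add, Subring.coe_add, ← unipMat_mul]
  simp only [Matrix.mul_assoc]

theorem CellRel.swap {M N : Matrix (Fin 3) (Fin 2) F} (h : CellRel M N) :
    CellRel (rowSwap F * M) (rowSwap F * N) := by
  obtain ⟨v, w, a, b, d, ha, hd, rfl⟩ := h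
  refine ⟨w, v, a, b, d, ha, hd, ?_⟩
  rw [← Matrix.mul_assoc, ← rowSwap_mul_unipMat]
  simp only [Matrix.mul_assoc]

theorem cellRel_cols {a b d : F} (ha : a ≠ 0) (hd : d ≠ 0) (x₁ x₂ x₃ y₁ y₂ y₃ : F) :
    CellRel !![x₁, y₁; x₂, y₂; x₃, y₃] !![a * x₁, d * y₁ + b * x₁; a * x₂, d * y₂ + b * x₂;
      a * x₃, d * y₃ + b * x₃] := by
  refine ⟨0, 0, a, b, d, ha, hd, ?_⟩
  rw [Subring.coe_zero, unipMat_zero, Matrix.one_mul]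
  ext i j
  fin_cases i <;> fin_cases j <;> simp [mul_comm, add_comm]

theorem cellRel_unip (v w : intRing F) (x₁ x₂ x₃ y₁ y₂ y₃ : F) :
    CellRel !![x₁, y₁; x₂, y₂; x₃, y₃]
      !![x₁ + v * x₃, y₁ + v * y₃; x₂ + w * x₃, y₂ + w * y₃; x₃, y₃] := by
  refine ⟨v, w, 1, 0, 1, one_ne_zero, one_ne_zero, ?_⟩
  ext i j
  fin_cases i <;> fin_cases j <;> simp [unipMat, Matrix.mul_apply]

theorem CellRel.congr {M N N' : Matrix (Fin 3) (Fin 2) F} (h : CellRel M N) (hN : N = N') :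
    CellRel M N' := hN ▸ h

/-- The cells met by matrices whose first column has its largest entry in the first row. -/
theorem exists_basicCell_of_first {x₁ x₂ x₃ y₁ y₂ y₃ : F} (h21 : ‖x₂‖ ≤ ‖x₁‖) (h31 : ‖x₃‖ < ‖x₁‖)
    (hM : ∀ c : Fin 2 → F, !![x₁, y₁; x₂, y₂; x₃, y₃] *ᵥ c = 0 → c = 0) :
    ∃ N, CellRel !![x₁, y₁; x₂, y₂; x₃, y₃] N ∧ IsBasicCell N := by
  have hx1 : x₁ ≠ 0 := norm_pos_iff.1 ((norm_nonneg _).trans_lt h31)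
  obtain ⟨a, ha⟩ := exists_coe_div h21
  obtain ⟨b, hb, hb'⟩ := exists_coe_div_mem h31
  have step1 := cellRel_cols (b := -(y₁ / x₁)) (inv_ne_zero hx1) one_ne_zero x₁ x₂ x₃ y₁ y₂ y₃
  set z₂ := y₂ - y₁ / x₁ * x₂ with hz₂
  set z₃ := y₃ - y₁ / x₁ * x₃ with hz₃
  replace step1 := step1.congr (N' := !![1, 0; (a : F), z₂; (b : F), z₃]) (by
    rw [ha, hb']
    ext i j
    fin_cases i <;> fin_cases j <;> simp [hx1, hz₂, hz₃] <;> field_simp <;> ring)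
  have hz : z₂ ≠ 0 ∨ z₃ ≠ 0 := by
    by_contra hcon
    push Not at hcon
    have := hM ![-(y₁ / x₁), 1] (by
      ext i
      fin_cases i
      · simp [hx1]
      · have := hcon.1
        simp only [hz₂] at this
        simp only [Fin.mk_one, cons_mulVec, cons_dotProduct, dotProduct_of_isEmpty]
        simp
        linear_combination this
      · have := hcon.2
        simp only [hz₃] at this
        simp
        linear_combination this)
    simpa using congrFun this 1
  rcases lt_or_ge ‖z₃‖ ‖z₂‖ with hlt | hge
  · have hz2 : z₂ ≠ 0 := norm_pos_iff.1 ((norm_nonneg _).trans_lt hlt)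
    obtain ⟨c, hc, hc'⟩ := exists_coe_div_mem hlt
    refine ⟨_, step1.trans ((cellRel_cols (b := 0) one_ne_zero (inv_ne_zero hz2) _ _ _ _ _ _).congr
      ?_), Or.inl ⟨a, b, c, hb, hc, rfl⟩⟩
    rw [hc']
    ext i j
    fin_cases i <;> fin_cases j <;> simp [hz2]; field_simp
  · have hz3 : z₃ ≠ 0 := by
      rintro h0
      rw [h0, norm_zero] at hge
      rcases hz with h | h
      · exact h (norm_le_zero_iff.1 hge)
      · exact h h0
    obtain ⟨t, ht⟩ := exists_coe_div hge
    -- The last row times `-t` clears `z₂`, and it changes `a` into `a - t b`.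
    refine ⟨_, (step1.trans ((cellRel_cols (b := 0) one_ne_zero (inv_ne_zero hz3)
      _ _ _ _ _ _))).trans ((cellRel_unip 0 (-t) _ _ _ _ _ _).congr ?_),
      Or.inr (Or.inl ⟨a - t * b, b, hb, rfl⟩)⟩
    push_cast
    rw [ht]
    ext i j
    fin_cases i <;> fin_cases j <;> simp [hz3] <;> field_simp <;> ring

theorem rowSwap_mul_cols (x₁ x₂ x₃ y₁ y₂ y₃ : F) :
    rowSwap F * !![x₁, y₁; x₂, y₂; x₃, y₃] = !![x₂, y₂; x₁, y₁; x₃, y₃] := by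
  ext i j
  fin_cases i <;> fin_cases j <;> simp [rowSwap, Matrix.mul_apply, Fin.sum_univ_three]

/-- Elimination in which the pivot has the largest norm, so that all multipliers are integral. `N₀`
only allows adding the last row to the others, so ties in the first column are decided in favour of
the last row; the first two rows are ordered by the interchange. -/
theorem exists_basicCell (M : Matrix (Fin 3) (Fin 2) F)
    (hM : ∀ c : Fin 2 → F, M *ᵥ c = 0 → c = 0) :
    ∃ N, CellRel M N ∧ (IsBasicCell N ∨ IsBasicCell (rowSwap F * N)) := by
  obtain ⟨x₁, x₂, x₃, y₁, y₂, y₃, rfl⟩ : ∃ x₁ x₂ x₃ y₁ y₂ y₃, M = !![x₁, y₁; x₂, y₂; x₃, y₃] :=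
    ⟨M 0 0, M 1 0, M 2 0, M 0 1, M 1 1, M 2 1, by
      ext i j; fin_cases i <;> fin_cases j <;> rfl⟩
  have hM' : ∀ c : Fin 2 → F, !![x₂, y₂; x₁, y₁; x₃, y₃] *ᵥ c = 0 → c = 0 := by
    intro c hc
    refine hM c ?_
    rw [← rowSwap_mul_cols, ← mulVec_mulVec, hc, mulVec_zero]
  rcases lt_or_ge ‖x₃‖ (max ‖x₁‖ ‖x₂‖) with h3 | h3
  · rcases le_total ‖x₂‖ ‖x₁‖ with h21 | h12
    · rw [max_eq_left h21] at h3
      obtain ⟨N, hN, hN'⟩ := exists_basicCell_of_first h21 h3 hM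
      exact ⟨N, hN, Or.inl hN'⟩
    · rw [max_eq_right h12] at h3
      obtain ⟨N, hN, hN'⟩ := exists_basicCell_of_first h12 h3 hM'
      refine ⟨rowSwap F * N, ?_, Or.inr ?_⟩
      · rw [← rowSwap_mul_cols]
        exact hN.swap
      · rwa [← Matrix.mul_assoc, rowSwap_mul_self, Matrix.one_mul]
  · have hx3 : x₃ ≠ 0 := by
      rintro rfl
      rw [norm_zero] at h3
      have h1 : x₁ = 0 := norm_le_zero_iff.1 ((le_max_left _ _).trans h3)
      have h2 : x₂ = 0 := norm_le_zero_iff.1 ((le_max_right _ _).trans h3)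
      have := hM ![1, 0] (by
        ext i
        fin_cases i <;> simp [h1, h2])
      simpa using congrFun this 0
    obtain ⟨s, hs⟩ := exists_coe_div ((le_max_left _ _).trans h3)
    obtain ⟨t, ht⟩ := exists_coe_div ((le_max_right _ _).trans h3)
    set z₁ := y₁ - x₁ / x₃ * y₃ with hz₁
    set z₂ := y₂ - x₂ / x₃ * y₃ with hz₂
    have step : CellRel !![x₁, y₁; x₂, y₂; x₃, y₃] !![0, z₁; 0, z₂; 1, 0] := by
      refine ((cellRel_unip (-s) (-t) x₁ x₂ x₃ y₁ y₂ y₃).trans (cellRel_cols (b := -(y₃ / x₃))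
        (inv_ne_zero hx3) one_ne_zero _ _ _ _ _ _)).congr ?_
      push_cast
      rw [hs, ht]
      ext i j
      fin_cases i <;> fin_cases j <;> simp [hx3, hz₁, hz₂] <;> field_simp <;> ring
    have hz : z₁ ≠ 0 ∨ z₂ ≠ 0 := by
      by_contra hcon
      push Not at hcon
      have := hM ![-(y₃ / x₃), 1] (by
        ext i
        fin_cases i
        · have := hcon.1
          simp only [hz₁] at this
          simp
          linear_combination this
        · have := hcon.2
          simp only [hz₂] at this
          simp
          linear_combination this
        · simp [hx3])
      simpa using congrFun this 1
    rcases le_total ‖z₂‖ ‖z₁‖ with h21 | h12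
    · have hz1 : z₁ ≠ 0 := by
        intro h0
        rw [h0, norm_zero] at h21
        rcases hz with h | h
        · exact h h0
        · exact h (norm_le_zero_iff.1 h21)
      obtain ⟨a, ha⟩ := exists_coe_div h21
      refine ⟨_, step.trans ((cellRel_cols (b := 0) one_ne_zero (inv_ne_zero hz1)
        _ _ _ _ _ _).congr ?_), Or.inl (Or.inr (Or.inr ⟨a, rfl⟩))⟩
      rw [ha]
      ext i j
      fin_cases i <;> fin_cases j <;> simp [hz1]; field_simp
    · have hz2 : z₂ ≠ 0 := by
        intro h0
        rw [h0, norm_zero] at h12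
        rcases hz with h | h
        · exact h (norm_le_zero_iff.1 h12)
        · exact h h0
      obtain ⟨a, ha⟩ := exists_coe_div h12
      refine ⟨!![0, a; 0, 1; 1, 0], step.trans ((cellRel_cols (b := 0) one_ne_zero
        (inv_ne_zero hz2) _ _ _ _ _ _).congr ?_), Or.inr (Or.inr (Or.inr ⟨a, ?_⟩))⟩
      · rw [ha]
        ext i j
        fin_cases i <;> fin_cases j <;> simp [hz2]; field_simp
      · rw [rowSwap_mul_cols]

end Cells

/-! ### Existence of eigenfunctions -/

section Existence

open Matrix

variable {F : Type*} [NontriviallyNormedField F] [IsUltrametricDist F]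
variable {C : Type*} [Field C]
variable [IsDiscreteValuationRing (intRing F)]
variable {η₁₂ η₂ : Fˣ →* Cˣ} {m : ℕ} {h : Matrix (Fin 3) (Fin 2) F → C}

theorem eq_zero_of_cellRel (hh : h ∈ flagSpace η₁₂ η₂ m) {M N : Matrix (Fin 3) (Fin 2) F}
    (hMN : CellRel M N) (hN : h N = 0) : h M = 0 := by
  obtain ⟨v, w, a, b, d, ha, hd, rfl⟩ := hMN
  rw [hh.2.1 _ _ _ _ ha hd, isUnipInv_of_mem hh] at hN
  exact (mul_eq_zero.1 hN).resolve_left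
    (mul_ne_zero (extZero_ne_zero _ ha) (extZero_ne_zero _ hd))

/-- Matrices of rank two are covered by the cells, and in smaller rank `h` vanishes by definition of
`flagSpace`. -/
theorem eq_zero_of_basicCell (hh : h ∈ flagSpace η₁₂ η₂ m)
    (h1 : ∀ N, IsBasicCell N → h N = 0) (h2 : ∀ N, IsBasicCell N → swapRow h N = 0) : h = 0 := by
  funext M
  by_cases hM : ∀ c : Fin 2 → F, M *ᵥ c = 0 → c = 0
  · obtain ⟨N, hMN, hN⟩ := exists_basicCell M hM
    refine eq_zero_of_cellRel hh hMN ?_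
    rcases hN with hN | hN
    · exact h1 N hN
    · have := h2 _ hN
      change h (rowSwap F * (rowSwap F * N)) = 0 at this
      rwa [← Matrix.mul_assoc, rowSwap_mul_self, Matrix.one_mul] at this
  · push Not at hM
    obtain ⟨c, hc, hc0⟩ := hM
    exact hh.1 M c hc0 hc

/-- Vanishing on matrices with zero last row, that is, on the subgroup `P`. -/
def VanishesOnLevi (h : Matrix (Fin 3) (Fin 2) F → C) : Prop :=
  ∀ x₁ x₂ y₁ y₂ : F, col h x₁ x₂ 0 y₁ y₂ 0 = 0

section

variable [Finite (IsLocalRing.ResidueField (intRing F))] [CharZero C]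

theorem apply_basicCell_eq_zero (hη : IsSmoothChar η₁₂) (hη₂ : IsSmoothChar η₂)
    (hh : h ∈ flagSpace η₁₂ η₂ m) (he : IsFlagEigen h) {ϖ : intRing F} (hϖ : Irreducible ϖ)
    (hne : charConductor η₂ = 0 → (resCard F : C) - extZero η₂ (ϖ : F) ≠ 0)
    (hne' : charConductor η₁₂ = 0 → (resCard F : C) ^ 2 - extZero η₁₂ (ϖ : F) ≠ 0)
    (h0 : VanishesOnLevi h) {N : Matrix (Fin 3) (Fin 2) F} (hN : IsBasicCell N) : h N = 0 := by
  rcases hN with ⟨a, b, c, hb, hc, rfl⟩ | ⟨a, c, hc, rfl⟩ | ⟨a, rfl⟩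
  · have := col_cell_one hη hh he a hb hc
    change col h 1 a b 0 1 c = 0
    simpa only [h0 _ _ _ _, mul_zero, integralO_const] using this
  · have := col_cell_two hη hη₂ hh he hϖ hne a hc
    change col h 1 a c 0 0 1 = 0
    simpa only [h0 _ _ _ _, mul_zero, integralO_const, sub_zero, add_zero] using this
  · have h1 := col_cell_three hη hη₂ hh he hϖ hne hne' a
    have h2 := col_smul₂ hh (neg_ne_zero.2 (one_ne_zero (α := F))) 0 0 1 1 a 0
    have h3 : (onMaxIdeal fun s : intRing F => (0 : C)) = fun _ => 0 := by
      funext s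
      simp [onMaxIdeal]
    simp only [h0 _ _ _ _, mul_zero, integralO_const, sub_zero, add_zero, h3] at h1
    rw [mul_one, mul_zero, neg_one_mul, h1] at h2
    exact (mul_eq_zero.1 h2.symm).resolve_left
      (extZero_ne_zero _ (neg_ne_zero.2 one_ne_zero))

/-- The uniqueness statement behind both halves of the isomorphism: it gives injectivity of `θ`
directly, and surjectivity through finite dimension. -/
theorem eq_zero_of_vanishesOnLevi (hη : IsSmoothChar η₁₂) (hη₂ : IsSmoothChar η₂)
    (hh : h ∈ flagSpace η₁₂ η₂ m) (he : IsFlagEigen h) {ϖ : intRing F} (hϖ : Irreducible ϖ)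
    (hne : charConductor η₂ = 0 → (resCard F : C) - extZero η₂ (ϖ : F) ≠ 0)
    (hne' : charConductor η₁₂ = 0 → (resCard F : C) ^ 2 - extZero η₁₂ (ϖ : F) ≠ 0)
    (h0 : VanishesOnLevi h) : h = 0 := by
  refine eq_zero_of_basicCell hh
    (fun N hN => apply_basicCell_eq_zero hη hη₂ hh he hϖ hne hne' h0 hN)
    (fun N hN => apply_basicCell_eq_zero hη hη₂ (swapRow_mem hh) (swapRow_eigen hh he) hϖ hne hne'
      (fun x₁ x₂ y₁ y₂ => ?_) hN)
  rw [col_swapRow]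
  exact h0 _ _ _ _

end

/-- Values at finitely many representatives. -/
def cellValues (m : ℕ) : (Matrix (Fin 3) (Fin 2) F → C) →ₗ[C]
    (Fin 3 → intRing F ⧸ maxIdeal F ^ m) → Fin 3 → C where
  toFun h p := ![
    h !![1, 0; ((p 0).out : intRing F), 1; ((p 1).out : intRing F), ((p 2).out : intRing F)],
    h !![1, 0; ((p 0).out : intRing F), 0; ((p 1).out : intRing F), 1],
    h !![0, 1; 0, ((p 0).out : intRing F); 1, 0]]
  map_add' h h' := by
    funext p i
    fin_cases i <;> rfl
  map_smul' c h := by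
    funext p i
    fin_cases i <;> rfl

theorem sub_out_mem (I : Ideal (intRing F)) (x : intRing F) :
    (Ideal.Quotient.mk I x).out - x ∈ I :=
  (Ideal.Quotient.mk_eq_mk_iff_sub_mem _ _).1 (Quotient.out_eq _)

theorem apply_basicCell_eq_zero_of_cellValues (hh : h ∈ flagSpace η₁₂ η₂ m)
    (h0 : cellValues m h = 0) {N : Matrix (Fin 3) (Fin 2) F} (hN : IsBasicCell N) : h N = 0 := by
  have hv := fun a b c : intRing F => congrFun h0 ![Ideal.Quotient.mk _ a, Ideal.Quotient.mk _ b,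
    Ideal.Quotient.mk _ c]
  rcases hN with ⟨a, b, c, -, -, rfl⟩ | ⟨a, c, -, rfl⟩ | ⟨a, rfl⟩
  · have h1 := congrFun (hv a b c) 0
    have hγ := sub_out_mem (maxIdeal F ^ m) c
    -- Adding `γ = c' - c` times the second row also adds `a γ` to the entry `b`, whence the
    -- correction `a γ` in the coefficient of the first row.
    have := col_lower hh (sub_out_mem (maxIdeal F ^ m) a)
      (sub_mem (sub_out_mem (maxIdeal F ^ m) b) (Ideal.mul_mem_left _ a hγ)) hγ 1 a b 0 1 c
    change col h 1 a b 0 1 c = 0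
    rw [← this]
    refine Eq.trans ?_ h1
    simp only [cellValues, LinearMap.coe_mk, AddHom.coe_mk, col, cons_val_zero, cons_val_one,
      cons_val]
    congr 1
    ext i j
    fin_cases i <;> fin_cases j <;> simp; ring
  · have h1 := congrFun (hv a c 0) 1
    have := col_lower hh (sub_out_mem (maxIdeal F ^ m) a)
      (sub_out_mem (maxIdeal F ^ m) c) (zero_mem _) 1 a c 0 0 1
    change col h 1 a c 0 0 1 = 0
    rw [← this]
    refine Eq.trans ?_ h1
    simp only [cellValues, LinearMap.coe_mk, AddHom.coe_mk, col, cons_val_zero, cons_val_one,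
      cons_val]
    congr 1
    ext i j
    fin_cases i <;> fin_cases j <;> simp
  · have h1 := congrFun (hv a 0 0) 2
    have := col_lower hh (sub_out_mem (maxIdeal F ^ m) a) (zero_mem _) (zero_mem _) 0 0 1 1 a 0
    change col h 0 0 1 1 a 0 = 0
    rw [← this]
    refine Eq.trans ?_ h1
    simp only [cellValues, LinearMap.coe_mk, AddHom.coe_mk, col, cons_val_zero, cons_val]
    congr 1
    ext i j
    fin_cases i <;> fin_cases j <;> simp

variable [Finite (IsLocalRing.ResidueField (intRing F))]

/-- The interchange of the first two rows as a linear map. -/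
def swapRowLinear : (Matrix (Fin 3) (Fin 2) F → C) →ₗ[C] (Matrix (Fin 3) (Fin 2) F → C) where
  toFun := swapRow
  map_add' _ _ := rfl
  map_smul' _ _ := rfl

/-- The parameters of the cell representatives matter only modulo `(ϖ ^ m)`, so finitely many values
determine a function of level `m`. -/
instance finite_flagSpace : Module.Finite C (flagSpace (C := C) η₁₂ η₂ m) := by
  let E := ((cellValues (F := F) (C := C) m).prod
    ((cellValues (F := F) (C := C) m).comp swapRowLinear)).comp
      (flagSpace (C := C) η₁₂ η₂ m).subtype
  refine Module.Finite.of_injective E ?_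
  rw [← LinearMap.ker_eq_bot, LinearMap.ker_eq_bot']
  rintro ⟨h, hh⟩ hE
  have h1 : cellValues m h = 0 := congrArg Prod.fst hE
  have h2 : cellValues m (swapRow h) = 0 := congrArg Prod.snd hE
  exact Subtype.ext (eq_zero_of_basicCell hh
    (fun N hN => apply_basicCell_eq_zero_of_cellValues hh h1 hN)
    (fun N hN => apply_basicCell_eq_zero_of_cellValues (swapRow_mem hh) h2 hN))

/-- The reason why averaging preserves the level. Conjugation by `contr ϖ` divides the first two
entries of the last column by `ϖ`; these become divisible once `(v, w)` is translated by the last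
column of `k`, and the average does not see this translation. -/
theorem exists_parahoric_commute {ϖ : intRing F} (hϖ : Irreducible ϖ) (hm : 1 ≤ m)
    {k : Matrix (Fin 3) (Fin 3) (intRing F)} (hk : k ∈ parahoric F m) (v w : intRing F) :
    ∃ k' ∈ parahoric F m, contr (ϖ : F) * unipMat (-(v : F)) (-(w : F)) * k.map (intRing F).subtype =
      k'.map (intRing F).subtype * (contr (ϖ : F) *
        unipMat (-((v + -k 0 2 : intRing F) : F)) (-((w + -k 1 2 : intRing F) : F))) := by
  have h00 := hk 0 0 (by simp)
  have h01 := hk 0 1 (by simp)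
  have h10 := hk 1 0 (by simp)
  have h11 := hk 1 1 (by simp)
  have h20 := hk 2 0 (by simp)
  have h21 := hk 2 1 (by simp)
  have h22 := hk 2 2 (by simp)
  simp only [one_apply_eq, ne_eq, Fin.reduceEq, not_false_eq_true, one_apply_ne, sub_zero]
    at h00 h01 h10 h11 h20 h21 h22
  have hle : ∀ {x : intRing F}, x ∈ maxIdeal F ^ m → x ∈ maxIdeal F := fun hx => by
    have := Ideal.pow_le_pow_right hm hx
    rwa [pow_one] at this
  -- The numerators that have to be divided by `ϖ`. Modulo `(ϖ)` the matrix `k` is unipotent because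
  -- `1 ≤ m`, and they cancel.
  have b1 : k 0 2 - v * k 2 2 + (k 0 0 - v * k 2 0) * (v - k 0 2) +
      (k 0 1 - v * k 2 1) * (w - k 1 2) ∈ maxIdeal F := by
    have : (k 0 0 - 1) * (v - k 0 2) - v * (k 2 2 - 1) + k 2 0 * (-v * (v - k 0 2)) +
      (k 0 1 * (w - k 1 2) + k 2 1 * (-v * (w - k 1 2))) ∈ maxIdeal F :=
      add_mem (add_mem (sub_mem (Ideal.mul_mem_right _ _ (hle h00))
        (Ideal.mul_mem_left _ _ (hle h22))) (Ideal.mul_mem_right _ _ (hle h20)))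
        (add_mem (Ideal.mul_mem_right _ _ (hle h01)) (Ideal.mul_mem_right _ _ (hle h21)))
    convert this using 1
    ring
  have b2 : k 1 2 - w * k 2 2 + (k 1 0 - w * k 2 0) * (v - k 0 2) +
      (k 1 1 - w * k 2 1) * (w - k 1 2) ∈ maxIdeal F := by
    have : (k 1 1 - 1) * (w - k 1 2) - w * (k 2 2 - 1) + k 2 0 * (-w * (v - k 0 2)) +
      (k 1 0 * (v - k 0 2) + k 2 1 * (-w * (w - k 1 2))) ∈ maxIdeal F :=
      add_mem (add_mem (sub_mem (Ideal.mul_mem_right _ _ (hle h11))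
        (Ideal.mul_mem_left _ _ (hle h22))) (Ideal.mul_mem_right _ _ (hle h20)))
        (add_mem (Ideal.mul_mem_right _ _ (hle h10)) (Ideal.mul_mem_right _ _ (hle h21)))
    convert this using 1
    ring
  obtain ⟨z₁, hz₁⟩ := (mem_maxIdeal_iff_dvd hϖ).1 b1
  obtain ⟨z₂, hz₂⟩ := (mem_maxIdeal_iff_dvd hϖ).1 b2
  refine ⟨!![k 0 0 - v * k 2 0, k 0 1 - v * k 2 1, z₁; k 1 0 - w * k 2 0, k 1 1 - w * k 2 1, z₂;
    ϖ * k 2 0, ϖ * k 2 1, k 2 2 + k 2 0 * (v - k 0 2) + k 2 1 * (w - k 1 2)], ?_, ?_⟩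
  · have c00 : k 0 0 - v * k 2 0 - 1 ∈ maxIdeal F ^ m := by
      rw [sub_right_comm]; exact sub_mem h00 (Ideal.mul_mem_left _ _ h20)
    have c01 : k 0 1 - v * k 2 1 ∈ maxIdeal F ^ m := sub_mem h01 (Ideal.mul_mem_left _ _ h21)
    have c10 : k 1 0 - w * k 2 0 ∈ maxIdeal F ^ m := sub_mem h10 (Ideal.mul_mem_left _ _ h20)
    have c11 : k 1 1 - w * k 2 1 - 1 ∈ maxIdeal F ^ m := by
      rw [sub_right_comm]; exact sub_mem h11 (Ideal.mul_mem_left _ _ h21)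
    have c20 : ϖ * k 2 0 ∈ maxIdeal F ^ m := Ideal.mul_mem_left _ _ h20
    have c21 : ϖ * k 2 1 ∈ maxIdeal F ^ m := Ideal.mul_mem_left _ _ h21
    have c22 : k 2 2 + k 2 0 * (v - k 0 2) + k 2 1 * (w - k 1 2) - 1 ∈ maxIdeal F ^ m := by
      have := add_mem (add_mem h22 (Ideal.mul_mem_right (v - k 0 2) _ h20))
        (Ideal.mul_mem_right (w - k 1 2) _ h21)
      convert this using 1
      ring
    intro i j hij
    fin_cases i <;> fin_cases j <;> simp_all
  · have e1 := congrArg (Subtype.val) hz₁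
    have e2 := congrArg (Subtype.val) hz₂
    push_cast at e1 e2
    ext i j
    fin_cases i <;> fin_cases j <;>
      simp [contr, unipMat, Matrix.mul_apply, Fin.sum_univ_three] <;>
      first | ring1 | linear_combination e1 | linear_combination e2

variable [CharZero C]

theorem flagAvg_mem {ϖ : intRing F} (hϖ : Irreducible ϖ) (hm : 1 ≤ m)
    (hh : h ∈ flagSpace η₁₂ η₂ m) : flagAvg (ϖ : F) h ∈ flagSpace η₁₂ η₂ m := by
  have hl := fun M => (isUnipInv_of_mem hh).hasLevel₂ hϖ.ne_zero M
  refine ⟨fun M c hc hM => ?_, fun M a b d ha hd => ?_, fun k hk M => ?_, fun u M => ?_⟩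
  · have : ∀ v w : intRing F, h (contr (ϖ : F) * unipMat (-(v : F)) (-(w : F)) * M) = 0 :=
      fun v w => hh.1 _ c hc (by rw [← mulVec_mulVec, hM, mulVec_zero])
    simp only [flagAvg, this, integralO_const]
  · simp only [flagAvg]
    rw [← integralO_const_mul _ (hl M).integral]
    congr 1
    funext v
    rw [← integralO_const_mul _ ((hl M).left v)]
    congr 1
    funext w
    rw [← Matrix.mul_assoc, hh.2.1 _ _ _ _ ha hd]
  · simp only [flagAvg]
    rw [← integralO_translate₂ (hl M) (-k 0 2) (-k 1 2)]
    refine congrArg _ (funext fun v => congrArg _ (funext fun w => ?_))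
    obtain ⟨k', hk', e⟩ := exists_parahoric_commute hϖ hm hk v w
    rw [← Matrix.mul_assoc, e, Matrix.mul_assoc, hh.2.2.1 k' hk']
  · simp only [flagAvg]
    rw [← integralO_unit_mul (hl M).integral u]
    refine congrArg _ (funext fun v => ?_)
    rw [← integralO_unit_mul ((hl M).left _) u]
    refine congrArg _ (funext fun w => ?_)
    rw [← Matrix.mul_assoc, Matrix.mul_assoc (contr _), unipMat_mul_contr, ← Matrix.mul_assoc,
      contr_mul, mul_comm (ϖ : F), ← contr_mul, Matrix.mul_assoc (contr _) (contr _),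
      Matrix.mul_assoc (contr _), hh.2.2.2 u]
    push_cast
    rw [mul_neg, mul_neg]

theorem flagAvg_add {h h' : Matrix (Fin 3) (Fin 2) F → C} (hh : IsUnipInv h) (hh' : IsUnipInv h')
    {x : intRing F} (hx : x ≠ 0) :
    flagAvg (x : F) (h + h') = flagAvg (x : F) h + flagAvg (x : F) h' := by
  funext M
  have hl := hh.hasLevel₂ hx M
  have hl' := hh'.hasLevel₂ hx M
  simp only [flagAvg, Pi.add_apply]
  rw [← integralO_add hl.integral hl'.integral]
  exact congrArg _ (funext fun v => integralO_add (hl.left v) (hl'.left v))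

theorem flagAvg_smul (c : C) {h : Matrix (Fin 3) (Fin 2) F → C} (hh : IsUnipInv h)
    {x : intRing F} (hx : x ≠ 0) : flagAvg (x : F) (c • h) = c • flagAvg (x : F) h := by
  funext M
  have hl := hh.hasLevel₂ hx M
  simp only [flagAvg, Pi.smul_apply, smul_eq_mul]
  rw [← integralO_const_mul _ hl.integral]
  exact congrArg _ (funext fun v => integralO_const_mul c (hl.left v))

/-- Neither `contr x` nor the unipotent matrices affect a matrix with zero last row. Hence `T h - h`
vanishes on `L` for every `h`. -/
theorem flagAvg_of_last_row_zero (x : F) (x₁ x₂ y₁ y₂ : F) :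
    col (flagAvg x h) x₁ x₂ 0 y₁ y₂ 0 = col h x₁ x₂ 0 y₁ y₂ 0 := by
  have : ∀ v w : intRing F, contr x * unipMat (-(v : F)) (-(w : F)) *
      !![x₁, y₁; x₂, y₂; 0, 0] = !![x₁, y₁; x₂, y₂; 0, 0] := by
    intro v w
    ext i j
    fin_cases i <;> fin_cases j <;>
      simp [contr, unipMat, Matrix.mul_apply, Fin.sum_univ_three]
  simp only [col, flagAvg, this, integralO_const]

/-- `T - 1` maps `V` into `K` and is injective on `K`, hence bijective on `K` by finite dimension.
Subtracting from `v₀` the element of `K` with the same image under `T - 1` gives a fixed vector. -/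
theorem exists_fixed_of_sub_mem {k V : Type*} [Field k] [AddCommGroup V] [Module k V]
    [Module.Finite k V] (T : V →ₗ[k] V) (K : Submodule k V) (hTK : ∀ v, T v - v ∈ K)
    (hT : ∀ v ∈ K, T v = v → v = 0) (v₀ : V) : ∃ v, T v = v ∧ v - v₀ ∈ K := by
  let S : K →ₗ[k] K := (T - 1).restrict fun v _ => hTK v
  have hS : Function.Injective S := by
    refine (injective_iff_map_eq_zero S).2 fun v hv => Subtype.ext (hT v.1 v.2 ?_)
    exact sub_eq_zero.1 (congrArg Subtype.val hv)
  obtain ⟨v, hv⟩ := LinearMap.injective_iff_surjective.1 hS ⟨_, hTK v₀⟩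
  have hv' : T v.1 - v.1 = T v₀ - v₀ := congrArg Subtype.val hv
  refine ⟨v₀ - v.1, ?_, ?_⟩
  · rw [map_sub, ← sub_eq_zero]
    rw [← sub_eq_zero] at hv'
    rw [← neg_eq_zero, ← hv']
    abel
  · rw [sub_sub_cancel_left]
    exact neg_mem v.2

/-- Every function of level `m` agrees with an eigenfunction on matrices with zero last row. -/
theorem exists_isFlagEigen (hη : IsSmoothChar η₁₂) (hη₂ : IsSmoothChar η₂)
    {ϖ : intRing F} (hϖ : Irreducible ϖ)
    (hne : charConductor η₂ = 0 → (resCard F : C) - extZero η₂ (ϖ : F) ≠ 0)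
    (hne' : charConductor η₁₂ = 0 → (resCard F : C) ^ 2 - extZero η₁₂ (ϖ : F) ≠ 0)
    (hm : 1 ≤ m) {h₀ : Matrix (Fin 3) (Fin 2) F → C} (hh₀ : h₀ ∈ flagSpace η₁₂ η₂ m) :
    ∃ h ∈ flagSpace η₁₂ η₂ m, IsFlagEigen h ∧
      ∀ x₁ x₂ y₁ y₂ : F, col h x₁ x₂ 0 y₁ y₂ 0 = col h₀ x₁ x₂ 0 y₁ y₂ 0 := by
  let V := flagSpace (C := C) η₁₂ η₂ m
  let T : V →ₗ[C] V :=
    { toFun := fun h => ⟨flagAvg (ϖ : F) h.1, flagAvg_mem hϖ hm h.2⟩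
      map_add' := fun h h' => Subtype.ext (flagAvg_add (isUnipInv_of_mem h.2)
        (isUnipInv_of_mem h'.2) hϖ.ne_zero)
      map_smul' := fun c h => Subtype.ext (flagAvg_smul c (isUnipInv_of_mem h.2) hϖ.ne_zero) }
  let K : Submodule C V :=
    { carrier := {h | VanishesOnLevi h.1}
      zero_mem' := fun _ _ _ _ => rfl
      add_mem' := fun {h h'} H H' x₁ x₂ y₁ y₂ => by
        have e1 := H x₁ x₂ y₁ y₂
        have e2 := H' x₁ x₂ y₁ y₂
        simp only [col] at e1 e2
        simp [col, e1, e2]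
      smul_mem' := fun c h H x₁ x₂ y₁ y₂ => by
        have e1 := H x₁ x₂ y₁ y₂
        simp only [col] at e1
        simp [col, e1] }
  have hTK : ∀ h : V, T h - h ∈ K := by
    intro h x₁ x₂ y₁ y₂
    have := flagAvg_of_last_row_zero (h := h.1) (ϖ : F) x₁ x₂ y₁ y₂
    rw [← sub_eq_zero] at this
    exact this
  obtain ⟨h, hT, hK⟩ := exists_fixed_of_sub_mem T K hTK (fun h hK hT =>
    Subtype.ext (eq_zero_of_vanishesOnLevi hη hη₂ h.2
      (isFlagEigen_of_uniformizer h.2 hϖ (congrArg Subtype.val hT)) hϖ hne hne' hK)) ⟨h₀, hh₀⟩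
  refine ⟨h.1, h.2, isFlagEigen_of_uniformizer h.2 hϖ (congrArg Subtype.val hT),
    fun x₁ x₂ y₁ y₂ => ?_⟩
  rw [← sub_eq_zero]
  exact hK x₁ x₂ y₁ y₂

end Existence

/-! ### Uniform local constancy -/

section Uniform

open Matrix Filter Topology

/-- Compactness makes the neighbourhood of `1` uniform in `s`. -/
theorem eventually_forall_apply_mul_eq {G X : Type*} [Group G] [TopologicalSpace G]
    [IsTopologicalGroup G] [CompactSpace G] {f : G → X} (hf : IsLocallyConstant f) :
    ∀ᶠ u in 𝓝 (1 : G), ∀ s, f (u * s) = f s := by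
  have := (isCompact_univ (X := G)).eventually_forall_of_forall_eventually
    (x₀ := (1 : G)) (P := fun u s => f (u * s) = f s) (fun s _ => by
      have h1 : ∀ᶠ z : G × G in 𝓝 (1, s), f (z.1 * z.2) = f s := by
        have hc : Tendsto (fun z : G × G => z.1 * z.2) (𝓝 (1, s)) (𝓝 s) := by
          have := (continuous_mul (M := G)).tendsto (1, s)
          rwa [one_mul] at this
        exact hc.eventually ((hf.isOpen_fiber (f s)).mem_nhds rfl)
      have h2 : ∀ᶠ z : G × G in 𝓝 (1, s), f z.2 = f s :=
        (continuous_snd.tendsto (1, s)).eventually ((hf.isOpen_fiber (f s)).mem_nhds rfl)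
      filter_upwards [h1, h2] with z hz1 hz2
      rw [hz1, hz2])
  simpa using this

variable {F : Type*} [NontriviallyNormedField F] [IsUltrametricDist F]
variable [IsDiscreteValuationRing (intRing F)]
variable {n : Type*} [Fintype n] [DecidableEq n]

/-- `A` is congruent to `1` modulo `(ϖ ^ m)`. -/
def CongrOne (m : ℕ) (A : Matrix n n (intRing F)) : Prop :=
  ∀ i j, A i j - (1 : Matrix n n (intRing F)) i j ∈ maxIdeal F ^ m

theorem congrOne_iff {m : ℕ} {A : Matrix n n (intRing F)} : CongrOne m A ↔
    (Ideal.Quotient.mk (maxIdeal F ^ m)).mapMatrix A = 1 := by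
  rw [← map_one (Ideal.Quotient.mk (maxIdeal F ^ m)).mapMatrix, ← Matrix.ext_iff]
  simp only [RingHom.mapMatrix_apply, map_apply, Ideal.Quotient.mk_eq_mk_iff_sub_mem]
  rfl

theorem CongrOne.inv {m : ℕ} {A : GL n (intRing F)} (h : CongrOne m A.1) :
    CongrOne m (A⁻¹).1 := by
  rw [congrOne_iff] at h ⊢
  have := congrArg (Ideal.Quotient.mk (maxIdeal F ^ m)).mapMatrix A.mul_inv
  rwa [map_mul, h, one_mul, map_one] at this

theorem CongrOne.isUnit_det {m : ℕ} (hm : 1 ≤ m) {A : Matrix n n (intRing F)}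
    (h : CongrOne m A) : IsUnit A.det := by
  refine isUnit_of_sub_one_mem ?_
  rw [congrOne_iff] at h
  have : A.det - 1 ∈ maxIdeal F ^ m := by
    rw [← Ideal.Quotient.mk_eq_mk_iff_sub_mem, RingHom.map_det, h, det_one, map_one]
  simpa using Ideal.pow_le_pow_right hm this

/-- The topology of `GL n` also involves the inverse matrices; these satisfy the same congruences by
`CongrOne.inv`. -/
theorem tendsto_one_of_congrOne {A : ℕ → GL n (intRing F)} (h : ∀ k, CongrOne k (A k).1) :
    Tendsto A atTop (𝓝 1) := by
  have key : ∀ B : ℕ → Matrix n n (intRing F), (∀ k, CongrOne k (B k)) →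
      Tendsto B atTop (𝓝 1) := by
    intro B hB
    refine tendsto_pi_nhds.2 fun i => tendsto_pi_nhds.2 fun j => ?_
    rw [Topology.IsEmbedding.subtypeVal.tendsto_nhds_iff]
    exact tendsto_one_of_sub_mem_pow (x := fun k => B k i j) fun k => ⟨_, hB k i j, by simp⟩
  rw [Units.isEmbedding_embedProduct.tendsto_nhds_iff]
  refine (key _ h).prodMk_nhds ?_
  refine (MulOpposite.continuous_op.tendsto _).comp ?_
  rw [inv_one]
  exact key _ fun k => (h k).inv

variable [CompactSpace (intRing F)]

theorem exists_level_of_isLocallyConstant {X : Type*} {f : GL n (intRing F) → X}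
    (hf : IsLocallyConstant f) : ∃ m, 1 ≤ m ∧
      ∀ k : GL n (intRing F), CongrOne m k.1 → ∀ s, f (k * s) = f s := by
  have : CompactSpace (Matrix n n (intRing F)) :=
    inferInstanceAs (CompactSpace (n → n → intRing F))
  by_contra! hcon
  -- The shift by one respects the requirement that the level be at least `1`.
  have h := fun m : ℕ => hcon (m + 1) (by omega)
  choose k hk hk' using h
  choose s hs using hk'
  have ht : Tendsto k atTop (𝓝 1) := tendsto_one_of_congrOne fun m i j =>
    Ideal.pow_le_pow_right (Nat.le_succ m) (hk m i j)
  obtain ⟨m, hm⟩ := (ht.eventually (eventually_forall_apply_mul_eq hf)).exists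
  exact hs m (hm _)

end Uniform

/-! ### The first two columns -/

section FirstCols

open Matrix

variable {F : Type*} [Field F]

/-- The first two columns of a matrix in `GL₃(F)`. -/
def firstCols (g : GL (Fin 3) F) : Matrix (Fin 3) (Fin 2) F :=
  !![g 0 0, g 0 1; g 1 0, g 1 1; g 2 0, g 2 1]

theorem firstCols_eq (g : GL (Fin 3) F) :
    firstCols g = g.1 * (!![1, 0; 0, 1; 0, 0] : Matrix (Fin 3) (Fin 2) F) := by
  ext i j
  fin_cases i <;> fin_cases j <;> simp [firstCols, Matrix.mul_apply, Fin.sum_univ_three]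

theorem firstCols_mul (g g' : GL (Fin 3) F) : firstCols (g * g') = g.1 * firstCols g' := by
  rw [firstCols_eq, firstCols_eq, Units.val_mul, Matrix.mul_assoc]

theorem firstCols_mul_borel (g : GL (Fin 3) F) {b : GL (Fin 3) F} (hb : b ∈ borelGL F) :
    firstCols (g * b) = firstCols g * !![b 0 0, b 0 1; 0, b 1 1] := by
  have h10 : b.1 1 0 = 0 := hb 1 0 (by decide)
  have h20 : b.1 2 0 = 0 := hb 2 0 (by decide)
  have h21 : b.1 2 1 = 0 := hb 2 1 (by decide)
  rw [firstCols_mul, firstCols_eq g, Matrix.mul_assoc]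
  congr 1
  ext i j
  fin_cases i <;> fin_cases j <;> simp [firstCols, h10, h20, h21]

theorem borel_diag_ne_zero {b : GL (Fin 3) F} (hb : b ∈ borelGL F) :
    b 0 0 ≠ 0 ∧ b 1 1 ≠ 0 ∧ b 2 2 ≠ 0 := by
  have hd := GeneralLinearGroup.det_ne_zero b
  rw [det_of_isUpperTriangular (M := b.1) (fun i j h => hb i j h), Fin.prod_univ_three] at hd
  simpa [and_assoc] using hd

theorem det_borel {b : GL (Fin 3) F} (hb : b ∈ borelGL F) :
    b.1.det = b 0 0 * b 1 1 * b 2 2 := by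
  rw [det_of_isUpperTriangular (M := b.1) (fun i j h => hb i j h), Fin.prod_univ_three]

theorem firstCols_mulVec_ne_zero (g : GL (Fin 3) F) {c : Fin 2 → F} (hc : c ≠ 0) :
    firstCols g *ᵥ c ≠ 0 := by
  intro h
  rw [firstCols_eq, ← mulVec_mulVec] at h
  have h1 := congrArg ((g⁻¹).1 *ᵥ ·) h
  simp only [mulVec_mulVec, mulVec_zero, ← Matrix.mul_assoc, Units.inv_mul, Matrix.one_mul] at h1
  refine hc (funext fun i => ?_)
  fin_cases i
  · simpa [Matrix.mulVec, dotProduct] using congrFun h1 0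
  · simpa [Matrix.mulVec, dotProduct] using congrFun h1 1

/-- Matrices with the same first two columns differ by an element of the Borel subgroup fixing
the first two basis vectors. -/
theorem inv_mul_of_firstCols_eq {g g' : GL (Fin 3) F} (h : firstCols g = firstCols g') :
    g⁻¹ * g' ∈ borelGL F ∧ (g⁻¹ * g') 0 0 = 1 ∧ (g⁻¹ * g') 1 1 = 1 := by
  have h1 : firstCols (g⁻¹ * g') = !![1, 0; 0, 1; 0, 0] := by
    rw [firstCols_mul, ← h, firstCols_eq, ← Matrix.mul_assoc, Units.inv_mul, Matrix.one_mul]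
  have e := fun i j => congrFun (congrFun h1 i) j
  refine ⟨fun i j hij => ?_, e 0 0, e 1 1⟩
  fin_cases i <;> fin_cases j <;> simp at hij
  · exact e 1 0
  · exact e 2 0
  · exact e 2 1

end FirstCols

/-! ### The Iwasawa decomposition -/

section Iwasawa

open Matrix

variable {F : Type*} [NontriviallyNormedField F] [IsUltrametricDist F]

/-- The map `GL(𝒪) → GL(F)`. -/
abbrev coeGL {n : Type*} [Fintype n] [DecidableEq n] : GL n (intRing F) →* GL n F :=
  GeneralLinearGroup.map (intRing F).subtype

theorem firstCols_coeGL (k : GL (Fin 3) (intRing F)) : firstCols (coeGL k) =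
    !![(k 0 0 : F), (k 0 1 : F); (k 1 0 : F), (k 1 1 : F); (k 2 0 : F), (k 2 1 : F)] := rfl

theorem exists_coeGL_of_basicCell {N : Matrix (Fin 3) (Fin 2) F} (hN : IsBasicCell N) :
    ∃ k : GL (Fin 3) (intRing F), firstCols (coeGL k) = N := by
  rcases hN with ⟨a, b, c, -, -, rfl⟩ | ⟨a, c, -, rfl⟩ | ⟨a, rfl⟩
  · refine ⟨GeneralLinearGroup.mk'' !![1, 0, 0; a, 1, 0; b, c, 1] (by simp [det_fin_three]), ?_⟩
    rw [firstCols_coeGL]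
    rfl
  · refine ⟨GeneralLinearGroup.mk'' !![1, 0, 0; a, 0, 1; c, 1, 0] (by simp [det_fin_three]), ?_⟩
    rw [firstCols_coeGL]
    rfl
  · refine ⟨GeneralLinearGroup.mk'' !![0, 1, 0; 0, a, 1; 1, 0, 0] (by simp [det_fin_three]), ?_⟩
    rw [firstCols_coeGL]
    rfl

theorem exists_coeGL_mul_of_basicCell {N : Matrix (Fin 3) (Fin 2) F}
    (hN : IsBasicCell N ∨ IsBasicCell (rowSwap F * N)) :
    ∃ k : GL (Fin 3) (intRing F), firstCols (coeGL k) = N := by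
  rcases hN with hN | hN
  · exact exists_coeGL_of_basicCell hN
  · obtain ⟨k, hk⟩ := exists_coeGL_of_basicCell hN
    refine ⟨GeneralLinearGroup.mk'' !![0, 1, 0; 1, 0, 0; 0, 0, 1] (by simp [det_fin_three]) * k, ?_⟩
    rw [map_mul, firstCols_mul, hk]
    have : (coeGL (GeneralLinearGroup.mk'' !![0, 1, 0; 1, 0, 0; 0, 0, 1]
        (by simp [det_fin_three]) : GL (Fin 3) (intRing F))).1 = rowSwap F := by
      ext i j
      fin_cases i <;> fin_cases j <;> rfl
    rw [this, ← Matrix.mul_assoc, rowSwap_mul_self, Matrix.one_mul]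

/-- The unipotent matrix with integral entries `v, w` in the last column. -/
def unipO (v w : intRing F) : GL (Fin 3) (intRing F) :=
  GeneralLinearGroup.mk'' !![1, 0, v; 0, 1, w; 0, 0, 1] (by simp [det_fin_three])

theorem coe_unipO (v w : intRing F) :
    (coeGL (unipO v w)).1 = unipMat (v : F) (w : F) := by
  ext i j
  fin_cases i <;> fin_cases j <;> rfl

/-- Each cell representative consists of the first two columns of a matrix in `GL₃(𝒪)`, so the cell
decomposition implies the Iwasawa decomposition. -/
theorem exists_eq_coeGL_mul_borel (g : GL (Fin 3) F) :
    ∃ (k : GL (Fin 3) (intRing F)), ∃ b ∈ borelGL F, g = coeGL k * b := by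
  obtain ⟨N, ⟨v, w, a, b, d, ha, hd, hN⟩, hN'⟩ := exists_basicCell (firstCols g) fun c hc => by
    by_contra h
    exact firstCols_mulVec_ne_zero g h hc
  obtain ⟨k, rfl⟩ := exists_coeGL_mul_of_basicCell hN'
  let β : GL (Fin 3) F := .mkOfDetNeZero !![a, b, 0; 0, d, 0; 0, 0, 1] (by
    simp [det_fin_three, ha, hd])
  have hβ : β ∈ borelGL F := fun i j hij => by
    fin_cases i <;> fin_cases j <;> first | rfl | simp at hij
  have h1 : firstCols (coeGL k) = firstCols (coeGL (unipO v w) * g * β) := by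
    rw [firstCols_mul_borel _ hβ, firstCols_mul, coe_unipO, ← hN]
    rfl
  have h2 := (inv_mul_of_firstCols_eq h1).1
  refine ⟨(unipO v w)⁻¹ * k, _, mul_mem h2 (inv_mem hβ), ?_⟩
  rw [map_mul, map_inv]
  group

end Iwasawa

/-! ### Functions on flags attached to functions on the group -/

section ToFlag

open Matrix

variable {F : Type*} [NontriviallyNormedField F] [IsUltrametricDist F] {C : Type*} [Field C]

variable [IsDiscreteValuationRing (intRing F)]

/-- The function on `3 × 2` matrices attached to an element of the induced representation. -/
def toFlag (χ₃ : Fˣ →* Cˣ) (f : GL (Fin 3) F → C) (M : Matrix (Fin 3) (Fin 2) F) : C :=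
  open Classical in
  if h : ∃ g, firstCols g = M then extZero χ₃ h.choose.1.det * f h.choose else 0

theorem torusChar_borel (χ : Fin 3 → Fˣ →* Cˣ) (b : GL (Fin 3) F) : torusChar χ b =
    extZero (χ 0) (b 0 0) * extZero (χ 1) (b 1 1) * extZero (χ 2) (b 2 2) := by
  rw [torusChar, Fin.prod_univ_three]

variable {χ : Fin 3 → Fˣ →* Cˣ} {f : GL (Fin 3) F → C}

/-- The twist by `χ₃(det)` cancels the dependence on the third diagonal entry of `b`, and turns
`χ₁⁻¹`, `χ₂⁻¹` into `η₁η₂`, `η₂`. -/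
theorem det_mul_apply_eq {f : GL (Fin 3) F → C}
    (hf : ∀ g, ∀ b ∈ borelGL F, f (g * b) = (torusChar χ b)⁻¹ * f g) (g : GL (Fin 3) F)
    {b : GL (Fin 3) F} (hb : b ∈ borelGL F) :
    extZero (χ 2) (g * b).1.det * f (g * b) =
      extZero ((χ 0)⁻¹ * χ 2) (b 0 0) * extZero ((χ 1)⁻¹ * χ 2) (b 1 1) *
        (extZero (χ 2) g.1.det * f g) := by
  obtain ⟨h0, h1, h2⟩ := borel_diag_ne_zero hb
  rw [hf g b hb, torusChar_borel, Units.val_mul, det_mul, det_borel hb]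
  rw [extZero_mul, extZero_mul, extZero_mul, extZero_mul_apply, extZero_mul_apply,
    extZero_inv_apply, extZero_inv_apply]
  have := extZero_ne_zero (χ 0) h0
  have := extZero_ne_zero (χ 1) h1
  have := extZero_ne_zero (χ 2) h2
  field_simp

/-- The matrix chosen in the definition differs from `g` by an element of `B` with diagonal `(1, 1,
*)`, under which the twisted function is invariant. -/
theorem toFlag_firstCols (hf : ∀ g, ∀ b ∈ borelGL F, f (g * b) = (torusChar χ b)⁻¹ * f g)
    (g : GL (Fin 3) F) : toFlag (χ 2) f (firstCols g) = extZero (χ 2) g.1.det * f g := by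
  have h : ∃ g', firstCols g' = firstCols g := ⟨g, rfl⟩
  rw [toFlag, dif_pos h]
  obtain ⟨hb, h0, h1⟩ := inv_mul_of_firstCols_eq h.choose_spec.symm
  have := det_mul_apply_eq hf g hb
  rw [h0, h1, extZero_one, extZero_one, one_mul, one_mul] at this
  rwa [mul_inv_cancel_left] at this

theorem toFlag_of_not {χ₃ : Fˣ →* Cˣ} {M : Matrix (Fin 3) (Fin 2) F}
    (h : ¬ ∃ g, firstCols g = M) : toFlag χ₃ f M = 0 := dif_neg h

theorem not_exists_firstCols_mul {M : Matrix (Fin 3) (Fin 2) F} (h : ¬ ∃ g, firstCols g = M)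
    (γ : GL (Fin 3) F) : ¬ ∃ g, firstCols g = γ.1 * M := by
  rintro ⟨g, hg⟩
  refine h ⟨γ⁻¹ * g, ?_⟩
  rw [firstCols_mul, hg, ← Matrix.mul_assoc, Units.inv_mul, Matrix.one_mul]

theorem toFlag_mul_left (hf : ∀ g, ∀ b ∈ borelGL F, f (g * b) = (torusChar χ b)⁻¹ * f g)
    {γ : GL (Fin 3) F} {c : C} (hγ : ∀ g, extZero (χ 2) γ.1.det * f (γ * g) = c * f g)
    (M : Matrix (Fin 3) (Fin 2) F) :
    toFlag (χ 2) f (γ.1 * M) = c * toFlag (χ 2) f M := by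
  by_cases h : ∃ g, firstCols g = M
  · obtain ⟨g, rfl⟩ := h
    rw [← firstCols_mul, toFlag_firstCols hf, toFlag_firstCols hf, Units.val_mul, det_mul,
      extZero_mul, mul_assoc, mul_left_comm, hγ]
    ring
  · rw [toFlag_of_not h, toFlag_of_not (not_exists_firstCols_mul h γ), mul_zero]

theorem toFlag_mul_right (hf : ∀ g, ∀ b ∈ borelGL F, f (g * b) = (torusChar χ b)⁻¹ * f g)
    (M : Matrix (Fin 3) (Fin 2) F) {a b d : F} (ha : a ≠ 0) (hd : d ≠ 0) :
    toFlag (χ 2) f (M * !![a, b; 0, d]) =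
      extZero ((χ 0)⁻¹ * χ 2) a * extZero ((χ 1)⁻¹ * χ 2) d * toFlag (χ 2) f M := by
  let β : GL (Fin 3) F := .mkOfDetNeZero !![a, b, 0; 0, d, 0; 0, 0, 1] (by
    simp [det_fin_three, ha, hd])
  have hβ : β ∈ borelGL F := fun i j hij => by
    fin_cases i <;> fin_cases j <;> first | rfl | simp at hij
  have hβM : ∀ g, firstCols (g * β) = firstCols g * !![a, b; 0, d] := fun g =>
    firstCols_mul_borel g hβ
  by_cases h : ∃ g, firstCols g = M
  · obtain ⟨g, rfl⟩ := h
    rw [← hβM, toFlag_firstCols hf, toFlag_firstCols hf, det_mul_apply_eq hf g hβ]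
    rfl
  · rw [toFlag_of_not h, toFlag_of_not, mul_zero]
    rintro ⟨g, hg⟩
    refine h ⟨g * β⁻¹, ?_⟩
    have h1 : firstCols (g * β⁻¹) * !![a, b; 0, d] = M * !![a, b; 0, d] := by
      rw [← hβM, inv_mul_cancel_right, hg]
    have h2 : (!![a, b; 0, d] : Matrix (Fin 2) (Fin 2) F) * !![a⁻¹, -(b / (a * d)); 0, d⁻¹] = 1 := by
      ext i j
      fin_cases i <;> fin_cases j <;> simp [ha, hd]
      field_simp
      ring
    simpa only [Matrix.mul_assoc, h2, Matrix.mul_one] using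
      congrArg (· * !![a⁻¹, -(b / (a * d)); 0, d⁻¹]) h1

theorem toFlag_mulVec_eq_zero {χ₃ : Fˣ →* Cˣ} {M : Matrix (Fin 3) (Fin 2) F} {c : Fin 2 → F}
    (hc : c ≠ 0) (hM : M *ᵥ c = 0) : toFlag χ₃ f M = 0 :=
  toFlag_of_not fun ⟨_, hg⟩ => firstCols_mulVec_ne_zero _ hc (hg ▸ hM)

end ToFlag

/-! ### Hecke operators as averages -/

section HeckeAverage

open Matrix

variable {F : Type*} [NontriviallyNormedField F] [IsUltrametricDist F]

theorem val_unipO (v w : intRing F) : (unipO v w).1 = !![1, 0, v; 0, 1, w; 0, 0, 1] := rfl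

theorem unipO_mul (v w v' w' : intRing F) :
    unipO v w * unipO v' w' = unipO (v + v') (w + w') := by
  refine Units.ext ?_
  rw [Units.val_mul, val_unipO, val_unipO, val_unipO]
  refine Matrix.ext fun i j => ?_
  fin_cases i <;> fin_cases j <;> simp [Matrix.mul_apply, Fin.sum_univ_three, add_comm]

theorem unipO_zero : unipO (0 : intRing F) 0 = 1 := by
  ext i j
  fin_cases i <;> fin_cases j <;> rfl

theorem unipO_inv (v w : intRing F) : (unipO v w)⁻¹ = unipO (-v) (-w) := by
  rw [inv_eq_iff_mul_eq_one, unipO_mul, add_neg_cancel, add_neg_cancel, unipO_zero]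

theorem coeGL_unipO_injective {v w v' w' : intRing F}
    (h : coeGL (unipO v w) = coeGL (unipO v' w')) : v = v' ∧ w = w' := by
  have h' := congrArg (fun g : GL (Fin 3) F => g.1) h
  simp only [coe_unipO] at h'
  exact ⟨Subtype.ext (by simpa [unipMat] using congrFun (congrFun h' 0) 2),
    Subtype.ext (by simpa [unipMat] using congrFun (congrFun h' 1) 2)⟩

theorem mem_unip₀_iff {n : GL (Fin 3) F} : n ∈ unip₀ F ↔ ∃ v w, n = coeGL (unipO v w) := by
  constructor
  · rintro ⟨hn, k, rfl⟩
    refine ⟨k 0 2, k 1 2, Units.ext ?_⟩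
    rw [coe_unipO]
    have hn' : ∀ i j, j ≠ 2 ∨ i = 2 → (coeGL k).1 i j = (1 : Matrix (Fin 3) (Fin 3) F) i j := hn
    ext i j
    fin_cases i <;> fin_cases j <;> first | rfl | exact hn' _ _ (by decide)
  · rintro ⟨v, w, rfl⟩
    refine ⟨fun i j hij => ?_, _, rfl⟩
    rw [coe_unipO]
    fin_cases i <;> fin_cases j <;> simp_all [unipMat]

theorem coeGL_unipO_mem (v w : intRing F) : coeGL (unipO v w) ∈ unip₀ F :=
  mem_unip₀_iff.2 ⟨v, w, rfl⟩

variable {C : Type*} [Field C] [CharZero C]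
variable [IsDiscreteValuationRing (intRing F)]
variable [Finite (IsLocalRing.ResidueField (intRing F))]

theorem exists_span_eq_pow {x : intRing F} (hx : x ≠ 0) :
    ∃ n : ℕ, ∀ y, y ∈ maxIdeal F ^ n ↔ x ∣ y := by
  obtain ⟨ϖ, hϖ⟩ := IsDiscreteValuationRing.exists_irreducible (intRing F)
  obtain ⟨n, u, rfl⟩ := IsDiscreteValuationRing.eq_unit_mul_pow_irreducible hx hϖ
  refine ⟨n, fun y => ?_⟩
  rw [mem_pow_iff_dvd hϖ, u.isUnit.mul_left_dvd]

/-- The Hecke operator of an element acting on `N₀` through multiplication by `x`. -/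
theorem hecke_unip₀_apply {z : GL (Fin 3) F} {x : intRing F} (hx : x ≠ 0)
    (hz : ∀ v w, z * coeGL (unipO v w) * z⁻¹ = coeGL (unipO (x * v) (x * w)))
    {f : GL (Fin 3) F → C} (hf : ∀ v w g, f (coeGL (unipO v w) * g) = f g) (g : GL (Fin 3) F) :
    hecke C (unip₀ F) z f g = integralO fun v => integralO fun w =>
      f (z⁻¹ * (coeGL (unipO v w))⁻¹ * g) := by
  obtain ⟨n, hn⟩ := exists_span_eq_pow hx
  have hmem : ∀ v w, coeGL (unipO v w) ∈ conjSubgroup z (unip₀ F) ↔ x ∣ v ∧ x ∣ w := by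
    intro v w
    constructor
    · rintro ⟨n', hn', h⟩
      obtain ⟨v', w', rfl⟩ := mem_unip₀_iff.1 hn'
      have h' : coeGL (unipO (x * v') (x * w')) = coeGL (unipO v w) := (hz v' w').symm.trans h
      obtain ⟨h1, h2⟩ := coeGL_unipO_injective h'
      exact ⟨⟨v', h1.symm⟩, ⟨w', h2.symm⟩⟩
    · rintro ⟨⟨v', rfl⟩, ⟨w', rfl⟩⟩
      exact ⟨_, coeGL_unipO_mem v' w', hz v' w'⟩
  set H := (conjSubgroup z (unip₀ F)).subgroupOf (unip₀ F) with hH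
  let ι : intRing F → intRing F → unip₀ F := fun v w => ⟨_, coeGL_unipO_mem v w⟩
  -- The conjugate of `N₀` consists of the unipotent matrices with entries divisible by `x`, so its
  -- cosets are pairs of classes modulo `x`, that is, modulo `(ϖ ^ n)`.
  have hι : ∀ v w v' w', (QuotientGroup.mk (ι v w) : unip₀ F ⧸ H) = QuotientGroup.mk (ι v' w') ↔
      v' - v ∈ maxIdeal F ^ n ∧ w' - w ∈ maxIdeal F ^ n := by
    intro v w v' w'
    rw [QuotientGroup.eq, hH, Subgroup.mem_subgroupOf, hn, hn]
    change (coeGL (unipO v w))⁻¹ * coeGL (unipO v' w') ∈ _ ↔ _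
    rw [← map_inv, unipO_inv, ← map_mul, unipO_mul, hmem, neg_add_eq_sub, neg_add_eq_sub]
  let Q := intRing F ⧸ maxIdeal F ^ n
  let e : Q × Q → unip₀ F ⧸ H := fun p => QuotientGroup.mk (ι p.1.out p.2.out)
  have he : Function.Bijective e := by
    constructor
    · rintro ⟨p, q⟩ ⟨p', q'⟩ h
      obtain ⟨h1, h2⟩ := (hι _ _ _ _).1 h
      have k1 := (Ideal.Quotient.mk_eq_mk_iff_sub_mem _ _).2 h1
      have k2 := (Ideal.Quotient.mk_eq_mk_iff_sub_mem _ _).2 h2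
      rw [mk_out, mk_out] at k1 k2
      exact Prod.ext k1.symm k2.symm
    · intro y
      obtain ⟨⟨n', hn'⟩, rfl⟩ := QuotientGroup.mk_surjective y
      obtain ⟨v, w, rfl⟩ := mem_unip₀_iff.1 hn'
      refine ⟨(Ideal.Quotient.mk _ v, Ideal.Quotient.mk _ w), (hι _ _ v w).2 ⟨?_, ?_⟩⟩
      · rw [← neg_sub]
        exact neg_mem (sub_out_mem _ _)
      · rw [← neg_sub]
        exact neg_mem (sub_out_mem _ _)
  let φ : intRing F → intRing F → C := fun v w => f (z⁻¹ * (coeGL (unipO v w))⁻¹ * g)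
  have hφ : ∀ v w v' w', v' - v ∈ maxIdeal F ^ n → w' - w ∈ maxIdeal F ^ n →
      φ v' w' = φ v w := by
    intro v w v' w' hv hw
    obtain ⟨a, ha⟩ := (hn _).1 hv
    obtain ⟨b, hb⟩ := (hn _).1 hw
    have h1 : coeGL (unipO v' w') = coeGL (unipO v w) * (z * coeGL (unipO a b) * z⁻¹) := by
      rw [hz, ← map_mul, unipO_mul, ← ha, ← hb, add_sub_cancel, add_sub_cancel]
    simp only [φ]
    rw [h1, ← hf (-a) (-b) (z⁻¹ * (coeGL (unipO v w))⁻¹ * g), ← unipO_inv, map_inv]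
    congr 1
    group
  -- The two sides may choose different representatives of a coset; `hφ` shows that the summand does
  -- not depend on the choice.
  have hsum : (∑ᶠ y : unip₀ F ⧸ H, f (z⁻¹ * ((Quotient.out y : unip₀ F) : GL (Fin 3) F)⁻¹ * g)) =
      ∑ᶠ p : Q × Q, φ p.1.out p.2.out := by
    refine (finsum_eq_of_bijective e he fun p => ?_).symm
    obtain ⟨v, w, hvw⟩ := mem_unip₀_iff.1 (Quotient.out (e p) : unip₀ F).2
    have h1 : Quotient.out (e p) = ι v w := Subtype.ext hvw
    have h2 : (QuotientGroup.mk (ι p.1.out p.2.out) : unip₀ F ⧸ H) = QuotientGroup.mk (ι v w) := by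
      rw [← h1]
      exact (Quotient.out_eq _).symm
    rw [h1]
    obtain ⟨h3, h4⟩ := (hι _ _ _ _).1 h2
    exact (hφ _ _ _ _ h3 h4).symm
  have hcard : ((conjSubgroup z (unip₀ F)).relIndex (unip₀ F) : C) =
      (Nat.card Q : C) * Nat.card Q := by
    rw [← Nat.cast_mul, ← Nat.card_prod]
    exact congrArg _ (Nat.card_congr (Equiv.ofBijective e he)).symm
  let _ := Fintype.ofFinite Q
  have h1 : ∀ v, integralO (φ v) = (Nat.card Q : C)⁻¹ * ∑ q : Q, φ v q.out := fun v =>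
    integralO_eq_sum fun w w' h => (hφ v w' v w (by simp) h)
  have h2 : integralO (fun v => integralO (φ v)) =
      (Nat.card Q : C)⁻¹ * ∑ p : Q, integralO (φ p.out) :=
    integralO_eq_sum fun v v' h => congrArg integralO (funext fun w => hφ v' w v w h (by simp))
  change ((conjSubgroup z (unip₀ F)).relIndex (unip₀ F) : C)⁻¹ *
    (∑ᶠ y : unip₀ F ⧸ H, f (z⁻¹ * ((Quotient.out y : unip₀ F) : GL (Fin 3) F)⁻¹ * g)) =
    integralO (fun v => integralO (φ v))
  rw [hsum, hcard, h2, finsum_eq_sum_of_fintype, Fintype.sum_prod_type]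
  simp only [h1]
  rw [← Finset.mul_sum, mul_inv, mul_assoc]

end HeckeAverage

/-! ### The center of the Levi subgroup. -/

section Center

open Matrix

variable {F : Type*} [Field F]

/-- Commuting with one lower and one upper elementary unipotent matrix already forces the `2 × 2`
block to be scalar. -/
theorem apply_of_mem_leviCenter {z : GL (Fin 3) F} (hz : z ∈ leviCenter F) :
    z.1 = !![z 0 0, 0, 0; 0, z 0 0, 0; 0, 0, z 2 2] ∧ z 0 0 ≠ 0 ∧ z 2 2 ≠ 0 := by
  obtain ⟨⟨z, h02, h12, h20, h21⟩, hc, rfl⟩ := hz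
  have hl : lowMat (1 : F) 0 0 ∈ levi F := by
    refine ⟨?_, ?_, ?_, ?_⟩ <;> simp [lowMat, GeneralLinearGroup.mkOfDetNeZero]
  have hm : mixMat (1 : F) 0 0 ∈ levi F := by
    refine ⟨?_, ?_, ?_, ?_⟩ <;> simp [mixMat, GeneralLinearGroup.mkOfDetNeZero]
  have e1 := congrArg (fun g : levi F => g.1.1) (Subgroup.mem_center_iff.1 hc ⟨_, hl⟩)
  have e2 := congrArg (fun g : levi F => g.1.1) (Subgroup.mem_center_iff.1 hc ⟨_, hm⟩)
  change (lowMat (1 : F) 0 0).1 * z.1 = z.1 * (lowMat (1 : F) 0 0).1 at e1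
  change (mixMat (1 : F) 0 0).1 * z.1 = z.1 * (mixMat (1 : F) 0 0).1 at e2
  have a00 := congrFun (congrFun e1 0) 0
  have a10 := congrFun (congrFun e1 1) 0
  have b00 := congrFun (congrFun e2 0) 0
  simp [lowMat, mixMat, GeneralLinearGroup.mkOfDetNeZero, Matrix.mul_apply, Fin.sum_univ_three]
    at a00 a10 b00
  have h11 : z.1 1 1 = z.1 0 0 := by
    rw [b00] at a10
    simpa using a10.symm
  have hz : z.1 = !![z.1 0 0, 0, 0; 0, z.1 0 0, 0; 0, 0, z.1 2 2] := by
    ext i j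
    fin_cases i <;> fin_cases j <;> simp_all
  refine ⟨hz, ?_⟩
  have hd := GeneralLinearGroup.det_ne_zero z
  rw [hz] at hd
  simp only [det_fin_three] at hd
  simpa using hd

/-- The matrix `diag(x, x, 1)`. -/
def centralElt (x : Fˣ) : GL (Fin 3) F :=
  .mkOfDetNeZero !![(x : F), 0, 0; 0, x, 0; 0, 0, 1] (by simp [det_fin_three])

theorem centralElt_mem (x : Fˣ) : centralElt x ∈ leviCenter F := by
  have hl : centralElt x ∈ levi F := by
    refine ⟨?_, ?_, ?_, ?_⟩ <;> simp [centralElt, GeneralLinearGroup.mkOfDetNeZero]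
  refine ⟨⟨_, hl⟩, Subgroup.mem_center_iff.2 ?_, rfl⟩
  rintro ⟨g, h02, h12, h20, h21⟩
  refine Subtype.ext (Units.ext ?_)
  change g.1 * (centralElt x).1 = (centralElt x).1 * g.1
  ext i j
  fin_cases i <;> fin_cases j <;> simp [centralElt, GeneralLinearGroup.mkOfDetNeZero,
    Matrix.mul_apply, Fin.sum_univ_three, *, mul_comm]

end Center

/-! ### Eigenfunctions on the group and on flags -/

section Bridge

open Matrix Filter Topology

variable {F : Type*} [NontriviallyNormedField F] [IsUltrametricDist F] {C : Type*} [Field C]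
variable {χ : Fin 3 → Fˣ →* Cˣ} {f : GL (Fin 3) F → C} {h : Matrix (Fin 3) (Fin 2) F → C}

theorem integral_of_conj_le {z : GL (Fin 3) F} {a b : F} (hb : b ≠ 0)
    (hz : z.1 = !![a, 0, 0; 0, a, 0; 0, 0, b]) (hc : conjSubgroup z (unip₀ F) ≤ unip₀ F) :
    ∃ x : intRing F, (x : F) = a / b := by
  have h1 : z * coeGL (unipO 1 0) * z⁻¹ ∈ unip₀ F :=
    hc ⟨_, coeGL_unipO_mem 1 0, rfl⟩
  obtain ⟨v, w, h2⟩ := mem_unip₀_iff.1 h1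
  have h3 : z.1 * (coeGL (unipO 1 0)).1 = (coeGL (unipO v w)).1 * z.1 :=
    congrArg Units.val (mul_inv_eq_iff_eq_mul.1 h2)
  refine ⟨v, ?_⟩
  rw [coe_unipO, coe_unipO, hz] at h3
  have := congrFun (congrFun h3 0) 2
  simp [unipMat, Matrix.mul_apply, Fin.sum_univ_three] at this
  field_simp
  exact this.symm

theorem conj_unipO {z : GL (Fin 3) F} {a b : F} (hb : b ≠ 0)
    (hz : z.1 = !![a, 0, 0; 0, a, 0; 0, 0, b]) {x : intRing F} (hx : (x : F) = a / b)
    (v w : intRing F) : z * coeGL (unipO v w) * z⁻¹ = coeGL (unipO (x * v) (x * w)) := by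
  rw [mul_inv_eq_iff_eq_mul]
  refine Units.ext ?_
  rw [Units.val_mul, Units.val_mul, coe_unipO, coe_unipO, hz]
  push_cast
  rw [hx]
  ext i j
  fin_cases i <;> fin_cases j <;>
    simp [unipMat, Matrix.mul_apply, Fin.sum_univ_three] <;> field_simp

variable [IsDiscreteValuationRing (intRing F)]

theorem apply_unipO_mul (hrel : ∀ g, h (firstCols g) = extZero (χ 2) g.1.det * f g)
    (hu : IsUnipInv h) (v w : intRing F) (g : GL (Fin 3) F) :
    f (coeGL (unipO v w) * g) = f g := by
  have h1 := hrel (coeGL (unipO v w) * g)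
  rw [firstCols_mul, coe_unipO, hu, hrel, Units.val_mul, det_mul, coe_unipO] at h1
  have h2 : (unipMat (v : F) (w : F)).det = 1 := by simp [unipMat, det_fin_three]
  rw [h2, one_mul] at h1
  exact (mul_left_cancel₀ (extZero_ne_zero _ (GeneralLinearGroup.det_ne_zero g)) h1).symm

/-- On first columns, `z⁻¹` acts as `contr (a / b)` followed by the scalar `a⁻¹`. This scalar
contributes `η₁η₂(a)⁻¹ η₂(a)⁻¹`, which together with the twist by `χ₃(det z)` is exactly `χ(z)`. -/
theorem apply_inv_mul {z : GL (Fin 3) F} {a b : F} (ha : a ≠ 0) (hb : b ≠ 0)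
    (hz : z.1 = !![a, 0, 0; 0, a, 0; 0, 0, b])
    (hrel : ∀ g, h (firstCols g) = extZero (χ 2) g.1.det * f g)
    (he : ∀ M, ∀ a b d : F, a ≠ 0 → d ≠ 0 → h (M * !![a, b; 0, d]) =
      extZero ((χ 0)⁻¹ * χ 2) a * extZero ((χ 1)⁻¹ * χ 2) d * h M) (g : GL (Fin 3) F) :
    extZero (χ 2) g.1.det * f (z⁻¹ * g) =
      torusChar χ z * h (contr (a / b) * firstCols g) := by
  have hd : z.1.det = a * a * b := by rw [hz]; simp [det_fin_three]
  have h1 : (z⁻¹).1 = !![a⁻¹, 0, 0; 0, a⁻¹, 0; 0, 0, b⁻¹] := by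
    have : z.1 * !![a⁻¹, 0, 0; 0, a⁻¹, 0; 0, 0, b⁻¹] = 1 := by
      rw [hz]
      ext i j
      fin_cases i <;> fin_cases j <;> simp [ha, hb]
    calc (z⁻¹).1 = (z⁻¹).1 * (z.1 * !![a⁻¹, 0, 0; 0, a⁻¹, 0; 0, 0, b⁻¹]) := by
          rw [this, Matrix.mul_one]
      _ = _ := by rw [← Matrix.mul_assoc, Units.inv_mul, Matrix.one_mul]
  have h2 : firstCols (z⁻¹ * g) = contr (a / b) * firstCols g * !![a⁻¹, 0; 0, a⁻¹] := by
    rw [firstCols_mul, h1]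
    ext i j
    fin_cases i <;> fin_cases j <;>
      simp [contr, firstCols, Matrix.mul_apply, Fin.sum_univ_three] <;> field_simp
  have h3 := hrel (z⁻¹ * g)
  rw [h2, he _ _ _ _ (inv_ne_zero ha) (inv_ne_zero ha)] at h3
  have h4 : g.1.det = z.1.det * (z⁻¹ * g).1.det := by
    rw [← det_mul, ← Units.val_mul, mul_inv_cancel_left]
  rw [h4, extZero_mul, mul_assoc, ← h3, hd, torusChar_borel]
  have e0 : z 0 0 = a := by rw [hz]; rfl
  have e1 : z 1 1 = a := by rw [hz]; rfl
  have e2 : z 2 2 = b := by rw [hz]; rfl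
  rw [e0, e1, e2, extZero_mul, extZero_mul, extZero_mul_apply, extZero_mul_apply,
    extZero_inv_apply, extZero_inv_apply, extZero_inv, extZero_inv, extZero_inv]
  have := extZero_ne_zero (χ 0) ha
  have := extZero_ne_zero (χ 1) ha
  have := extZero_ne_zero (χ 2) ha
  field_simp

variable [Finite (IsLocalRing.ResidueField (intRing F))] [CharZero C]

/-- The prescribed eigenvalue `χ(z)` is split off here, so eigenfunctions on the group correspond to
functions fixed by the averaging operators. -/
theorem hecke_apply_eq_flagAvg {z : GL (Fin 3) F} {a b : F} (ha : a ≠ 0) (hb : b ≠ 0)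
    (hz : z.1 = !![a, 0, 0; 0, a, 0; 0, 0, b]) {x : intRing F} (hx : (x : F) = a / b)
    (hrel : ∀ g, h (firstCols g) = extZero (χ 2) g.1.det * f g)
    (he : ∀ M, ∀ a b d : F, a ≠ 0 → d ≠ 0 → h (M * !![a, b; 0, d]) =
      extZero ((χ 0)⁻¹ * χ 2) a * extZero ((χ 1)⁻¹ * χ 2) d * h M)
    (hu : IsUnipInv h) (g : GL (Fin 3) F) :
    extZero (χ 2) g.1.det * hecke C (unip₀ F) z f g =
      torusChar χ z * flagAvg (x : F) h (firstCols g) := by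
  have hx0 : x ≠ 0 := by
    rintro rfl
    exact div_ne_zero ha hb hx.symm
  have hl := hu.hasLevel₂ hx0 (firstCols g)
  rw [hecke_unip₀_apply hx0 (conj_unipO hb hz hx) (apply_unipO_mul hrel hu)]
  have hd := extZero_ne_zero (χ 2) (GeneralLinearGroup.det_ne_zero g)
  have h1 : ∀ v w : intRing F, f (z⁻¹ * (coeGL (unipO v w))⁻¹ * g) =
      (extZero (χ 2) g.1.det)⁻¹ * torusChar χ z *
        h (contr (x : F) * unipMat (-(v : F)) (-(w : F)) * firstCols g) := by
    intro v w
    have := apply_inv_mul ha hb hz hrel he (coeGL (unipO (-v) (-w)) * g)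
    have hd1 : (coeGL (unipO (-v) (-w)) * g).1.det = g.1.det := by
      rw [Units.val_mul, det_mul, coe_unipO]
      simp [unipMat, det_fin_three]
    rw [hd1, firstCols_mul, coe_unipO, ← hx, ← Matrix.mul_assoc] at this
    rw [← map_inv, unipO_inv, mul_assoc, mul_assoc, ← mul_right_inj' hd, this,
      mul_inv_cancel_left₀ hd]
    push_cast
    rfl
  simp only [h1]
  simp only [integralO_const_mul _ (hl.left _)]
  rw [integralO_const_mul _ hl.integral, flagAvg, mul_assoc, mul_inv_cancel_left₀ hd]

theorem isUnipInv_toFlag (hf : ∀ g, ∀ b ∈ borelGL F, f (g * b) = (torusChar χ b)⁻¹ * f g)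
    (hn : ∀ n ∈ unip₀ F, ∀ g, f (n⁻¹ * g) = f g) : IsUnipInv (toFlag (χ 2) f) := by
  intro v w M
  rw [← coe_unipO, toFlag_mul_left hf (c := 1), one_mul]
  intro g
  have h1 := hn _ (inv_mem (coeGL_unipO_mem v w)) g
  rw [inv_inv] at h1
  rw [h1, coe_unipO]
  simp [unipMat, det_fin_three]

theorem isFlagEigen_toFlag (hf : f ∈ eigenInd χ) : IsFlagEigen (toFlag (χ 2) f) := by
  have hb := hf.1.2
  have hu := isUnipInv_toFlag hb hf.2.1
  intro x hx M
  by_cases hM : ∃ g, firstCols g = M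
  · obtain ⟨g, rfl⟩ := hM
    have hx' : (x : F) ≠ 0 := fun h0 => hx (Subtype.ext h0)
    let z := centralElt (Units.mk0 (x : F) hx')
    have hz : z.1 = !![(x : F), 0, 0; 0, x, 0; 0, 0, 1] := rfl
    have hx1 : (x : F) = x / 1 := (div_one _).symm
    have hc : conjSubgroup z (unip₀ F) ≤ unip₀ F := by
      rintro _ ⟨n, hn, rfl⟩
      obtain ⟨v, w, rfl⟩ := mem_unip₀_iff.1 hn
      exact mem_unip₀_iff.2 ⟨_, _, conj_unipO one_ne_zero hz hx1 v w⟩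
    have h1 := hecke_apply_eq_flagAvg hx' one_ne_zero hz hx1 (toFlag_firstCols hb)
      (fun M a b d ha hd => toFlag_mul_right hb M ha hd) hu g
    rw [hf.2.2 z (centralElt_mem _) hc, Pi.smul_apply, smul_eq_mul, mul_left_comm,
      ← toFlag_firstCols hb] at h1
    have hz0 : torusChar χ z ≠ 0 := by
      rw [torusChar_borel]
      exact mul_ne_zero (mul_ne_zero (extZero_ne_zero _ hx') (extZero_ne_zero _ hx'))
        (extZero_ne_zero _ one_ne_zero)
    exact (mul_left_cancel₀ hz0 h1).symm
  -- If `M` does not come from the group, neither do its translates by invertible matrices, and both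
  -- sides are zero.
  · have h1 : ∀ v w : intRing F, toFlag (χ 2) f (contr (x : F) * unipMat (-(v : F)) (-(w : F)) * M)
        = 0 := by
      intro v w
      have hx' : (x : F) ≠ 0 := fun h0 => hx (Subtype.ext h0)
      have := not_exists_firstCols_mul hM (.mkOfDetNeZero
        (contr (x : F) * unipMat (-(v : F)) (-(w : F)))
        (by simpa [contr, unipMat, det_fin_three] using hx'))
      exact toFlag_of_not this
    simp only [flagAvg, h1, integralO_const, toFlag_of_not hM]

theorem mem_eigenInd_of_isFlagEigen (hs : f ∈ smoothInd χ)
    (hrel : ∀ g, h (firstCols g) = extZero (χ 2) g.1.det * f g)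
    (he : ∀ M, ∀ a b d : F, a ≠ 0 → d ≠ 0 → h (M * !![a, b; 0, d]) =
      extZero ((χ 0)⁻¹ * χ 2) a * extZero ((χ 1)⁻¹ * χ 2) d * h M)
    (hu : IsUnipInv h) (hE : IsFlagEigen h) : f ∈ eigenInd χ := by
  refine ⟨hs, fun n hn g => ?_, fun z hz hc => ?_⟩
  · obtain ⟨v, w, rfl⟩ := mem_unip₀_iff.1 hn
    rw [← map_inv, unipO_inv]
    exact apply_unipO_mul hrel hu _ _ g
  · obtain ⟨h1, ha, hb⟩ := apply_of_mem_leviCenter hz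
    obtain ⟨x, hx⟩ := integral_of_conj_le hb h1 hc
    have hx0 : x ≠ 0 := by
      rintro rfl
      exact div_ne_zero ha hb hx.symm
    funext g
    have h2 := hecke_apply_eq_flagAvg ha hb h1 hx hrel he hu g
    rw [hE x hx0, hrel, mul_left_comm] at h2
    exact mul_left_cancel₀ (extZero_ne_zero _ (GeneralLinearGroup.det_ne_zero g)) h2

end Bridge

/-! ### Smoothness -/

section Smooth

open Matrix Filter Topology

variable {F : Type*} [NontriviallyNormedField F] [IsUltrametricDist F] {C : Type*} [Field C]
variable {χ : Fin 3 → Fˣ →* Cˣ}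

variable [IsDiscreteValuationRing (intRing F)]

theorem isLocallyConstant_extZero_det {n : Type*} [Fintype n] [DecidableEq n] {η : Fˣ →* Cˣ}
    (hη : IsLocallyConstant η) :
    IsLocallyConstant fun g : GL n F => (extZero η g.1.det : C) := by
  have h1 : (fun g : GL n F => (extZero η g.1.det : C)) =
      (fun u : Cˣ => (u : C)) ∘ (η ∘ GeneralLinearGroup.det) := by
    funext g
    exact extZero_coe η (GeneralLinearGroup.det g)
  rw [h1]
  exact (hη.comp_continuous GeneralLinearGroup.continuous_det).comp _

theorem congrOne_mul_parahoric {m : ℕ} {k : Matrix (Fin 3) (Fin 3) (intRing F)}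
    (hk : k ∈ parahoric F m) : CongrOne m ((unipO (-k 0 2) (-k 1 2)).1 * k) := by
  have h00 := hk 0 0 (by simp)
  have h01 := hk 0 1 (by simp)
  have h10 := hk 1 0 (by simp)
  have h11 := hk 1 1 (by simp)
  have h20 := hk 2 0 (by simp)
  have h21 := hk 2 1 (by simp)
  have h22 := hk 2 2 (by simp)
  rw [val_unipO]
  intro i j
  fin_cases i <;> fin_cases j <;> simp [Matrix.mul_apply, Fin.sum_univ_three] at *
  · rw [← sub_eq_add_neg, sub_right_comm]
    exact sub_mem h00 (Ideal.mul_mem_left _ _ h20)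
  · exact add_mem h01 (neg_mem (Ideal.mul_mem_left _ _ h21))
  · have := neg_mem (Ideal.mul_mem_left _ (k 0 2) h22)
    convert this using 1
    ring
  · exact add_mem h10 (neg_mem (Ideal.mul_mem_left _ _ h20))
  · rw [← sub_eq_add_neg, sub_right_comm]
    exact sub_mem h11 (Ideal.mul_mem_left _ _ h21)
  · have := neg_mem (Ideal.mul_mem_left _ (k 1 2) h22)
    convert this using 1
    ring
  · exact h20
  · exact h21
  · exact h22

theorem continuous_coeGL {n : Type*} [Fintype n] [DecidableEq n] :
    Continuous (coeGL : GL n (intRing F) →* GL n F) :=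
  Continuous.generalLinearGroup_map (n := n) (f := (intRing F).subtype) continuous_subtype_val

/-- Local constancy gives a uniform level on the compact group `GL₃(𝒪)`, and the Iwasawa
decomposition carries it to all of `G`. Invariance under the units of `Z_L` is not assumed: it is
the eigenvector equation for a unit. -/
theorem toFlag_mem_flagSpace [CompactSpace (intRing F)] [Finite (IsLocalRing.ResidueField (intRing F))]
    [CharZero C] (hχ : ∀ i, IsLocallyConstant (χ i)) {f : GL (Fin 3) F → C} (hf : f ∈ eigenInd χ) :
    ∃ m, 1 ≤ m ∧ toFlag (χ 2) f ∈ flagSpace ((χ 0)⁻¹ * χ 2) ((χ 1)⁻¹ * χ 2) m := by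
  have hb := hf.1.2
  have hu := isUnipInv_toFlag hb hf.2.1
  have hE := isFlagEigen_toFlag hf
  have hloc : IsLocallyConstant fun k : GL (Fin 3) (intRing F) =>
      extZero (χ 2) (coeGL k).1.det * f (coeGL k) :=
    ((isLocallyConstant_extZero_det (hχ 2)).mul hf.1.1).comp_continuous continuous_coeGL
  obtain ⟨m, hm, hlev⟩ := exists_level_of_isLocallyConstant hloc
  refine ⟨m, hm, fun M c hc hM => toFlag_mulVec_eq_zero hc hM,
    fun M a b d ha hd => toFlag_mul_right hb M ha hd, fun k hk M => ?_, fun u M => ?_⟩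
  · have hk' := congrOne_mul_parahoric hk
    let κ : GL (Fin 3) (intRing F) := GeneralLinearGroup.mk'' _ (hk'.isUnit_det hm)
    -- Removing the last column by an element of `N₀` leaves a matrix congruent to `1` modulo `(ϖ ^
    -- m)`.
    have h1 : k.map (intRing F).subtype = unipMat (k 0 2 : F) (k 1 2 : F) * (coeGL κ).1 := by
      rw [← coe_unipO, ← Units.val_mul, ← map_mul]
      change _ = ((unipO (k 0 2) (k 1 2)).1 * ((unipO (-k 0 2) (-k 1 2)).1 * k)).map _
      rw [← Matrix.mul_assoc, ← Units.val_mul, unipO_mul, add_neg_cancel, add_neg_cancel,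
        unipO_zero, Units.val_one, Matrix.one_mul]
    rw [h1, Matrix.mul_assoc, hu, toFlag_mul_left hb (c := 1), one_mul]
    intro g
    obtain ⟨s, b, hbo, rfl⟩ := exists_eq_coeGL_mul_borel g
    rw [← mul_assoc, hb _ _ hbo, hb _ _ hbo, ← map_mul]
    have h2 := hlev κ hk' s
    simp only [map_mul, Units.val_mul, det_mul, extZero_mul] at h2
    rw [mul_assoc, mul_left_comm] at h2
    have h3 := mul_left_cancel₀ (extZero_ne_zero (χ 2) (GeneralLinearGroup.det_ne_zero (coeGL s))) h2
    rw [map_mul, one_mul, mul_left_comm, h3]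
  · have h1 := hE u u.ne_zero M
    -- For unit `x` the unipotent factor moves to the left with integral entries, so the integrand
    -- is constant.
    have h2 : ∀ v w : intRing F, toFlag (χ 2) f (contr ((u : intRing F) : F) *
        unipMat (-(v : F)) (-(w : F)) * M) = toFlag (χ 2) f (contr ((u : intRing F) : F) * M) := by
      intro v w
      have h3 := hu (((u⁻¹ : (intRing F)ˣ) : intRing F) * -v)
        (((u⁻¹ : (intRing F)ˣ) : intRing F) * -w) (contr ((u : intRing F) : F) * M)
      rw [← Matrix.mul_assoc, unipMat_mul_contr, ← Subring.coe_mul, ← Subring.coe_mul,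
        Units.mul_inv_cancel_left, Units.mul_inv_cancel_left] at h3
      exact h3
    simp only [flagAvg, h2, integralO_const] at h1
    exact h1

/-- For `y` close to `g`, the matrix `y g⁻¹` is integral and congruent to `1` modulo `(ϖ ^ m)`,
hence fixes `h`. -/
theorem isLocallyConstant_firstCols {η₁₂ η₂ : Fˣ →* Cˣ} {m : ℕ}
    {h : Matrix (Fin 3) (Fin 2) F → C} (hh : h ∈ flagSpace η₁₂ η₂ m) :
    IsLocallyConstant fun g : GL (Fin 3) F => h (firstCols g) := by
  obtain ⟨ϖ, hϖ⟩ := IsDiscreteValuationRing.exists_irreducible (intRing F)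
  rw [IsLocallyConstant.iff_eventually_eq]
  intro g
  have ht : Tendsto (fun y : GL (Fin 3) F => y * g⁻¹) (𝓝 g) (𝓝 1) := by
    have := (continuous_mul_const g⁻¹).tendsto g
    rwa [mul_inv_cancel] at this
  have hent : ∀ i j, ∀ᶠ y in 𝓝 g, ‖(y * g⁻¹).1 i j - (1 : Matrix (Fin 3) (Fin 3) F) i j‖ <
      ‖(ϖ : F)‖ ^ m := by
    intro i j
    have h1 : Tendsto (fun y : GL (Fin 3) F => (y * g⁻¹).1 i j) (𝓝 g)
        (𝓝 ((1 : Matrix (Fin 3) (Fin 3) F) i j)) :=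
      ((continuous_apply_apply i j).tendsto _).comp ((Units.continuous_val.tendsto _).comp ht)
    have h2 := (tendsto_iff_norm_sub_tendsto_zero.1 h1)
    exact h2.eventually_lt_const (pow_pos (norm_uniformizer_pos hϖ) m)
  have hall := eventually_all.2 fun i => eventually_all.2 (hent i)
  filter_upwards [hall] with y hy
  have hz : ∀ i j, ∃ z : intRing F, z ∈ maxIdeal F ^ m ∧
      (z : F) = (y * g⁻¹).1 i j - (1 : Matrix (Fin 3) (Fin 3) F) i j := by
    intro i j
    have h1 : ‖(y * g⁻¹).1 i j - (1 : Matrix (Fin 3) (Fin 3) F) i j‖ ≤ ‖((ϖ ^ m : intRing F) : F)‖ := by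
      rw [SubmonoidClass.coe_pow, norm_pow]
      exact (hy i j).le
    obtain ⟨t, ht⟩ := exists_coe_div h1
    refine ⟨ϖ ^ m * t, Ideal.mul_mem_right _ _ (Ideal.pow_mem_pow (uniformizer_mem hϖ) m), ?_⟩
    rw [Subring.coe_mul, ht, mul_div_cancel₀]
    push_cast
    exact pow_ne_zero _ (norm_pos_iff.1 (norm_uniformizer_pos hϖ))
  choose z hz hz' using hz
  let k : Matrix (Fin 3) (Fin 3) (intRing F) := 1 + Matrix.of z
  have hk : k ∈ parahoric F m := fun i j _ => by
    simpa [k] using hz i j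
  have hk' : k.map (intRing F).subtype = (y * g⁻¹).1 := by
    refine Matrix.ext fun i j => ?_
    have : k.map (intRing F).subtype i j = (1 : Matrix (Fin 3) (Fin 3) F) i j + z i j := by
      rw [map_apply]
      simp only [k, Matrix.add_apply, map_add, Matrix.of_apply]
      congr 1
      by_cases hij : i = j
      · subst hij; simp
      · simp [hij]
    rw [this, hz', add_sub_cancel]
  have h1 := hh.2.2.1 k hk (firstCols g)
  rwa [hk', ← firstCols_mul, inv_mul_cancel_right] at h1

/-- The function on the group attached to a function on flags. -/
def ofFlag (χ₃ : Fˣ →* Cˣ) (h : Matrix (Fin 3) (Fin 2) F → C) (g : GL (Fin 3) F) : C :=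
  (extZero χ₃ g.1.det)⁻¹ * h (firstCols g)

theorem firstCols_ofFlag {χ₃ : Fˣ →* Cˣ} (h : Matrix (Fin 3) (Fin 2) F → C) (g : GL (Fin 3) F) :
    h (firstCols g) = extZero χ₃ g.1.det * ofFlag χ₃ h g := by
  rw [ofFlag, mul_inv_cancel_left₀ (extZero_ne_zero _ (GeneralLinearGroup.det_ne_zero g))]

theorem ofFlag_mem_smoothInd (hχ : ∀ i, IsLocallyConstant (χ i)) {m : ℕ}
    {h : Matrix (Fin 3) (Fin 2) F → C}
    (hh : h ∈ flagSpace ((χ 0)⁻¹ * χ 2) ((χ 1)⁻¹ * χ 2) m) : ofFlag (χ 2) h ∈ smoothInd χ := by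
  refine ⟨(((isLocallyConstant_extZero_det (hχ 2)).comp (·⁻¹)).mul
    (isLocallyConstant_firstCols hh)), fun g b hb => ?_⟩
  obtain ⟨h0, h1, h2⟩ := borel_diag_ne_zero hb
  rw [ofFlag, ofFlag, firstCols_mul_borel g hb, hh.2.1 _ _ _ _ h0 h1, torusChar_borel,
    Units.val_mul, det_mul, det_borel hb, extZero_mul, extZero_mul, extZero_mul,
    extZero_mul_apply, extZero_mul_apply, extZero_inv_apply, extZero_inv_apply]
  have := extZero_ne_zero (χ 0) h0
  have := extZero_ne_zero (χ 1) h1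
  have := extZero_ne_zero (χ 2) h0
  have := extZero_ne_zero (χ 2) h1
  have := extZero_ne_zero (χ 2) h2
  have := extZero_ne_zero (χ 2) (GeneralLinearGroup.det_ne_zero g)
  field_simp

theorem ofFlag_mem_eigenInd [Finite (IsLocalRing.ResidueField (intRing F))] [CharZero C]
    (hχ : ∀ i, IsLocallyConstant (χ i)) {m : ℕ} {h : Matrix (Fin 3) (Fin 2) F → C}
    (hh : h ∈ flagSpace ((χ 0)⁻¹ * χ 2) ((χ 1)⁻¹ * χ 2) m) (hE : IsFlagEigen h) :
    ofFlag (χ 2) h ∈ eigenInd χ :=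
  mem_eigenInd_of_isFlagEigen (ofFlag_mem_smoothInd hχ hh) (firstCols_ofFlag h) hh.2.1
    (isUnipInv_of_mem hh) hE

end Smooth

/-! ### Extension from the Levi subgroup -/

section Block

open Matrix

variable {R : Type*} [CommRing R]

/-- The block matrix `diag(A, 1)`. -/
def blockMat : Matrix (Fin 2) (Fin 2) R →* Matrix (Fin 3) (Fin 3) R where
  toFun A := !![A 0 0, A 0 1, 0; A 1 0, A 1 1, 0; 0, 0, 1]
  map_one' := by
    ext i j
    fin_cases i <;> fin_cases j <;> simp
  map_mul' A B := by
    ext i j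
    fin_cases i <;> fin_cases j <;> simp [Matrix.mul_apply, Fin.sum_univ_three]

/-- The embedding of `GL₂` into the Levi subgroup. -/
def blockLevi {F : Type*} [Field F] : GL (Fin 2) F →* levi F :=
  (Units.map blockMat).codRestrict (levi F) fun _ => ⟨rfl, rfl, rfl, rfl⟩

theorem val_blockLevi {F : Type*} [Field F] (A : GL (Fin 2) F) :
    (blockLevi A).1.1 = !![A 0 0, A 0 1, 0; A 1 0, A 1 1, 0; 0, 0, 1] := rfl

theorem continuous_blockLevi {F : Type*} [Field F] [TopologicalSpace F] :
    Continuous (blockLevi : GL (Fin 2) F →* levi F) := by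
  refine Continuous.subtype_mk (Continuous.units_map (M := Matrix (Fin 2) (Fin 2) F)
    (N := Matrix (Fin 3) (Fin 3) F) blockMat ?_) _
  refine continuous_matrix fun i j => ?_
  fin_cases i <;> fin_cases j <;> simp [blockMat] <;>
    first | exact continuous_const | exact continuous_apply_apply _ _

end Block

/-! ### Functions on the Levi subgroup extended to a neighbourhood of `P`. -/

section LeviExtension

open Matrix

variable {F : Type*} [NontriviallyNormedField F] [IsUltrametricDist F] {C : Type*} [Field C]
variable [IsDiscreteValuationRing (intRing F)]
variable {χ : Fin 3 → Fˣ →* Cˣ}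

/-- Iwasawa decomposition for `GL₂`: the larger entry of the first column is the pivot, which makes
the multiplier `t` integral. -/
theorem exists_eq_coeGL_mul_upper (A : GL (Fin 2) F) :
    ∃ k : GL (Fin 2) (intRing F), ∃ b : GL (Fin 2) F, b 1 0 = 0 ∧ A = coeGL k * b := by
  have hd := GeneralLinearGroup.det_ne_zero A
  rw [det_fin_two] at hd
  rcases le_total ‖A.1 1 0‖ ‖A.1 0 0‖ with hle | hle
  · have h0 : A.1 0 0 ≠ 0 := by
      intro h0
      rw [h0, norm_zero] at hle
      rw [h0, norm_le_zero_iff.1 hle] at hd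
      simp at hd
    obtain ⟨t, ht⟩ := exists_coe_div hle
    refine ⟨GeneralLinearGroup.mk'' !![1, 0; t, 1] (by simp [det_fin_two]),
      .mkOfDetNeZero !![A.1 0 0, A.1 0 1; 0, A.1 1 1 - t * A.1 0 1] ?_, rfl, Units.ext ?_⟩
    · rw [det_fin_two_of, ht]
      convert hd using 1
      field_simp
      ring
    · change A.1 = !![1, 0; t, 1].map (intRing F).subtype *
        !![A.1 0 0, A.1 0 1; 0, A.1 1 1 - t * A.1 0 1]
      ext i j
      fin_cases i <;> fin_cases j <;> simp [Matrix.mul_apply, Fin.sum_univ_two, ht, h0]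
  · have h0 : A.1 1 0 ≠ 0 := by
      intro h0
      rw [h0, norm_zero] at hle
      rw [h0, norm_le_zero_iff.1 hle] at hd
      simp at hd
    obtain ⟨t, ht⟩ := exists_coe_div hle
    refine ⟨GeneralLinearGroup.mk'' !![t, 1; 1, 0] (by simp [det_fin_two]),
      .mkOfDetNeZero !![A.1 1 0, A.1 1 1; 0, A.1 0 1 - t * A.1 1 1] ?_, rfl, Units.ext ?_⟩
    · rw [det_fin_two_of, ht]
      convert neg_ne_zero.2 hd using 1
      field_simp
      ring
    · change A.1 = !![t, 1; 1, 0].map (intRing F).subtype *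
        !![A.1 1 0, A.1 1 1; 0, A.1 0 1 - t * A.1 1 1]
      ext i j
      fin_cases i <;> fin_cases j <;> simp [Matrix.mul_apply, Fin.sum_univ_two, ht, h0]

/-- A function on the Levi subgroup as a function on `2 × 2` matrices. -/
def leviFun (χ₃ : Fˣ →* Cˣ) (φ : levi F → C) (A : Matrix (Fin 2) (Fin 2) F) : C :=
  open Classical in
  if h : A.det ≠ 0 then extZero χ₃ A.det * φ (blockLevi (.mkOfDetNeZero A h)) else 0

theorem leviFun_coe (χ₃ : Fˣ →* Cˣ) (φ : levi F → C) (A : GL (Fin 2) F) :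
    leviFun χ₃ φ A.1 = extZero χ₃ A.1.det * φ (blockLevi A) := by
  rw [leviFun, dif_pos (GeneralLinearGroup.det_ne_zero A)]
  congr 3
  exact Units.ext rfl

theorem leviFun_of_det_eq_zero (χ₃ : Fˣ →* Cˣ) (φ : levi F → C) {A : Matrix (Fin 2) (Fin 2) F}
    (h : A.det = 0) : leviFun χ₃ φ A = 0 := dif_neg (not_not.2 h)

theorem leviFun_mul_upper {φ : levi F → C} (hφ : φ ∈ smoothIndLevi χ)
    (A : Matrix (Fin 2) (Fin 2) F) {a b d : F} (ha : a ≠ 0) (hd : d ≠ 0) :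
    leviFun (χ 2) φ (A * !![a, b; 0, d]) =
      extZero ((χ 0)⁻¹ * χ 2) a * extZero ((χ 1)⁻¹ * χ 2) d * leviFun (χ 2) φ A := by
  by_cases hA : A.det = 0
  · rw [leviFun_of_det_eq_zero _ _ hA, leviFun_of_det_eq_zero, mul_zero]
    rw [det_mul, hA, zero_mul]
  · let α : GL (Fin 2) F := .mkOfDetNeZero A hA
    let β : GL (Fin 2) F := .mkOfDetNeZero !![a, b; 0, d] (by simp [det_fin_two, ha, hd])
    have hβ : (blockLevi β).1 ∈ borelGL F := fun i j hij => by
      fin_cases i <;> fin_cases j <;> first | rfl | simp at hij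
    have hβt : torusChar χ (blockLevi β).1 = extZero (χ 0) a * extZero (χ 1) d := by
      rw [torusChar_borel]
      change extZero (χ 0) a * extZero (χ 1) d * extZero (χ 2) 1 = _
      rw [extZero_one, mul_one]
    have hβd : β.1.det = a * d := by
      change (!![a, b; 0, d] : Matrix (Fin 2) (Fin 2) F).det = _
      rw [det_fin_two_of, mul_zero, sub_zero]
    change leviFun (χ 2) φ (α * β).1 = _ * leviFun (χ 2) φ α.1
    rw [leviFun_coe, leviFun_coe, map_mul, hφ.2 _ _ hβ, Units.val_mul, det_mul, hβt, hβd,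
      extZero_mul, extZero_mul, extZero_mul_apply, extZero_mul_apply, extZero_inv_apply,
      extZero_inv_apply]
    have := extZero_ne_zero (χ 0) ha
    have := extZero_ne_zero (χ 1) hd
    field_simp

theorem exists_level_leviFun [CompactSpace (intRing F)] (hχ : ∀ i, IsLocallyConstant (χ i))
    {φ : levi F → C} (hφ : φ ∈ smoothIndLevi χ) : ∃ m, 1 ≤ m ∧
      ∀ k : Matrix (Fin 2) (Fin 2) (intRing F), CongrOne m k → ∀ A,
        leviFun (χ 2) φ (k.map (intRing F).subtype * A) = leviFun (χ 2) φ A := by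
  have hloc : IsLocallyConstant fun k : GL (Fin 2) (intRing F) =>
      leviFun (χ 2) φ (coeGL k).1 := by
    simp only [leviFun_coe]
    exact ((isLocallyConstant_extZero_det (hχ 2)).mul
      (hφ.1.comp_continuous continuous_blockLevi)).comp_continuous continuous_coeGL
  obtain ⟨m, hm, hlev⟩ := exists_level_of_isLocallyConstant hloc
  refine ⟨m, hm, fun k hk A => ?_⟩
  let κ : GL (Fin 2) (intRing F) := GeneralLinearGroup.mk'' k (hk.isUnit_det hm)
  change leviFun (χ 2) φ ((coeGL κ).1 * A) = _
  by_cases hA : A.det = 0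
  · rw [leviFun_of_det_eq_zero _ _ hA, leviFun_of_det_eq_zero]
    rw [det_mul, hA, mul_zero]
  · obtain ⟨s, b, hb, hsb⟩ := exists_eq_coeGL_mul_upper (.mkOfDetNeZero A hA)
    have hA' : A = (coeGL s).1 * b.1 := congrArg Units.val hsb
    have hbe : b.1 = !![b.1 0 0, b.1 0 1; 0, b.1 1 1] := by
      rw [← hb]
      exact Matrix.ext fun i j => by fin_cases i <;> fin_cases j <;> rfl
    have hbd := GeneralLinearGroup.det_ne_zero b
    rw [hbe, det_fin_two_of, mul_zero, sub_zero] at hbd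
    have h0 := left_ne_zero_of_mul hbd
    have h1 := right_ne_zero_of_mul hbd
    rw [hA', ← Matrix.mul_assoc, hbe, leviFun_mul_upper hφ _ h0 h1, leviFun_mul_upper hφ _ h0 h1,
      ← Units.val_mul, ← map_mul]
    exact congrArg _ (hlev κ hk s)

/-- The first two rows of a `3 × 2` matrix. -/
def topRows (M : Matrix (Fin 3) (Fin 2) F) : Matrix (Fin 2) (Fin 2) F :=
  !![M 0 0, M 0 1; M 1 0, M 1 1]

/-- The last row is a combination of the first two with coefficients in `(ϖ ^ m)`. -/
def LastRowSmall (m : ℕ) (M : Matrix (Fin 3) (Fin 2) F) : Prop :=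
  ∃ w : Fin 2 → intRing F, (∀ i, w i ∈ maxIdeal F ^ m) ∧
    M 2 = (fun i => (w i : F)) ᵥ* topRows M

/-- The extension of a function on the Levi subgroup to flags, supported near `P`. -/
def extendLevi (χ₃ : Fˣ →* Cˣ) (m : ℕ) (φ : levi F → C) (M : Matrix (Fin 3) (Fin 2) F) : C :=
  open Classical in if LastRowSmall m M then leviFun χ₃ φ (topRows M) else 0

/-- Up to a factor in `N₀`, `k` is congruent to `1`, and that congruence passes to inverses. -/
theorem exists_parahoric_inv {m : ℕ} (hm : 1 ≤ m) {k : Matrix (Fin 3) (Fin 3) (intRing F)}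
    (hk : k ∈ parahoric F m) : ∃ k' ∈ parahoric F m, k' * k = 1 := by
  have hκ := congrOne_mul_parahoric hk
  let κ : GL (Fin 3) (intRing F) := GeneralLinearGroup.mk'' _ (hκ.isUnit_det hm)
  have hκi : CongrOne m (κ⁻¹).1 := CongrOne.inv (A := κ) hκ
  refine ⟨(κ⁻¹).1 * (unipO (-k 0 2) (-k 1 2)).1, fun i j hij => ?_, ?_⟩
  · have hi := hκi i
    rw [val_unipO, Matrix.mul_apply, Fin.sum_univ_three]
    obtain rfl | rfl | rfl : j = 0 ∨ j = 1 ∨ j = 2 := by fin_cases j <;> simp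
    · simpa using hi 0
    · simpa using hi 1
    · obtain rfl : i = 2 := by simpa using hij
      have h0 : (κ⁻¹).1 2 0 ∈ maxIdeal F ^ m := by simpa using hi 0
      have h1 : (κ⁻¹).1 2 1 ∈ maxIdeal F ^ m := by simpa using hi 1
      have h2 : (κ⁻¹).1 2 2 - 1 ∈ maxIdeal F ^ m := by simpa using hi 2
      have := add_mem (add_mem (Ideal.mul_mem_right (-k 0 2) _ h0)
        (Ideal.mul_mem_right (-k 1 2) _ h1)) h2
      simpa [add_sub_assoc] using this
  · rw [Matrix.mul_assoc]
    exact κ.inv_mul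

/-- Substituting the last row `w · top` expresses the new top rows as `κ · top` with `κ` congruent
to `1`, and the new last row as `u · top` with small `u`. The new coefficients are then `u κ⁻¹`,
again small. -/
theorem LastRowSmall.parahoric_mul {m : ℕ} (hm : 1 ≤ m)
    {k : Matrix (Fin 3) (Fin 3) (intRing F)} (hk : k ∈ parahoric F m)
    {M : Matrix (Fin 3) (Fin 2) F} (hM : LastRowSmall m M) :
    LastRowSmall m (k.map (intRing F).subtype * M) ∧
      ∃ κ : Matrix (Fin 2) (Fin 2) (intRing F), CongrOne m κ ∧
        topRows (k.map (intRing F).subtype * M) = κ.map (intRing F).subtype * topRows M := by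
  obtain ⟨w, hw, hMw⟩ := hM
  have hr : ∀ j, M 2 j = w 0 * M 0 j + w 1 * M 1 j := by
    intro j
    rw [hMw]
    fin_cases j <;> simp [vecMul, dotProduct, topRows]
  have h00 := hk 0 0 (by simp)
  have h01 := hk 0 1 (by simp)
  have h10 := hk 1 0 (by simp)
  have h11 := hk 1 1 (by simp)
  have h20 := hk 2 0 (by simp)
  have h21 := hk 2 1 (by simp)
  simp only [one_apply_eq, ne_eq, Fin.reduceEq, not_false_eq_true, one_apply_ne, sub_zero]
    at h00 h01 h10 h11 h20 h21
  let κ : Matrix (Fin 2) (Fin 2) (intRing F) :=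
    !![k 0 0 + k 0 2 * w 0, k 0 1 + k 0 2 * w 1; k 1 0 + k 1 2 * w 0, k 1 1 + k 1 2 * w 1]
  have hκ : CongrOne m κ := by
    intro i j
    fin_cases i <;> fin_cases j <;> simp [κ]
    · rw [add_sub_right_comm]
      exact add_mem h00 (Ideal.mul_mem_left _ _ (hw 0))
    · exact add_mem h01 (Ideal.mul_mem_left _ _ (hw 1))
    · exact add_mem h10 (Ideal.mul_mem_left _ _ (hw 0))
    · rw [add_sub_right_comm]
      exact add_mem h11 (Ideal.mul_mem_left _ _ (hw 1))
  have htop : topRows (k.map (intRing F).subtype * M) =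
      κ.map (intRing F).subtype * topRows M := by
    ext i j
    fin_cases i <;> fin_cases j <;>
      simp [topRows, κ, Matrix.mul_apply, Fin.sum_univ_three, hr] <;> ring
  let κu : GL (Fin 2) (intRing F) := GeneralLinearGroup.mk'' κ (hκ.isUnit_det hm)
  let u : Fin 2 → intRing F := ![k 2 0 + k 2 2 * w 0, k 2 1 + k 2 2 * w 1]
  have hu : ∀ i, u i ∈ maxIdeal F ^ m := by
    intro i
    fin_cases i
    · exact add_mem h20 (Ideal.mul_mem_left _ _ (hw 0))
    · exact add_mem h21 (Ideal.mul_mem_left _ _ (hw 1))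
  refine ⟨⟨u ᵥ* (κu⁻¹).1, fun i => ?_, ?_⟩, κ, hκ, htop⟩
  · rw [vecMul, dotProduct]
    exact sum_mem fun l _ => Ideal.mul_mem_right _ _ (hu l)
  · have h1 : (fun i => ((u ᵥ* (κu⁻¹).1) i : F)) =
        (fun i => (u i : F)) ᵥ* (κu⁻¹).1.map (intRing F).subtype :=
      funext fun i => RingHom.map_vecMul (intRing F).subtype (κu⁻¹).1 u i
    have h2 : (κu⁻¹).1.map (intRing F).subtype * κ.map (intRing F).subtype = 1 := by
      change (κu⁻¹).1.map (intRing F).subtype * κu.1.map (intRing F).subtype = 1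
      rw [← Matrix.map_mul, Units.inv_mul]
      simp
    rw [htop, h1, vecMul_vecMul, ← Matrix.mul_assoc, h2, Matrix.one_mul]
    funext j
    fin_cases j <;>
      simp [topRows, u, vecMul, dotProduct, Matrix.mul_apply, Fin.sum_univ_three, hr] <;> ring

theorem topRows_mul (M : Matrix (Fin 3) (Fin 2) F) (β : Matrix (Fin 2) (Fin 2) F) :
    topRows (M * β) = topRows M * β := by
  ext i j
  fin_cases i <;> fin_cases j <;> simp [topRows, Matrix.mul_apply]

theorem LastRowSmall.mul_upper {m : ℕ} {M : Matrix (Fin 3) (Fin 2) F} (hM : LastRowSmall m M)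
    (β : Matrix (Fin 2) (Fin 2) F) : LastRowSmall m (M * β) := by
  obtain ⟨w, hw, hMw⟩ := hM
  refine ⟨w, hw, ?_⟩
  have h2 : (M * β) 2 = M 2 ᵥ* β := rfl
  rw [topRows_mul, h2, hMw, vecMul_vecMul]

theorem LastRowSmall.contr_mul {m : ℕ} {M : Matrix (Fin 3) (Fin 2) F} (hM : LastRowSmall m M)
    (x : intRing F) : LastRowSmall m (contr (x : F) * M) := by
  obtain ⟨w, hw, hMw⟩ := hM
  refine ⟨fun i => x * w i, fun i => Ideal.mul_mem_left _ _ (hw i), ?_⟩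
  funext j
  have := congrFun hMw j
  fin_cases j <;>
    simp [vecMul, dotProduct, topRows, contr, Matrix.mul_apply, Fin.sum_univ_three] at this ⊢ <;>
    rw [this] <;> ring

theorem topRows_contr_mul (x : F) (M : Matrix (Fin 3) (Fin 2) F) :
    topRows (contr x * M) = topRows M := by
  ext i j
  fin_cases i <;> fin_cases j <;>
    simp [topRows, contr, Matrix.mul_apply, Fin.sum_univ_three]

/-- The support is stable under all the operations in `flagSpace`; on it the parahoric set changes
the top rows only by matrices congruent to `1`, under which `leviFun` is invariant by `hlev`. -/
theorem extendLevi_mem {φ : levi F → C} (hφ : φ ∈ smoothIndLevi χ) {m : ℕ} (hm : 1 ≤ m)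
    (hlev : ∀ k : Matrix (Fin 2) (Fin 2) (intRing F), CongrOne m k → ∀ A,
      leviFun (χ 2) φ (k.map (intRing F).subtype * A) = leviFun (χ 2) φ A) :
    extendLevi (χ 2) m φ ∈ flagSpace ((χ 0)⁻¹ * χ 2) ((χ 1)⁻¹ * χ 2) m := by
  refine ⟨fun M c hc hM => ?_, fun M a b d ha hd => ?_, fun k hk M => ?_, fun u M => ?_⟩
  · rw [extendLevi, leviFun_of_det_eq_zero, ite_self]
    refine exists_mulVec_eq_zero_iff.1 ⟨c, hc, funext fun i => ?_⟩
    fin_cases i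
    · simpa [topRows, mulVec, dotProduct] using congrFun hM 0
    · simpa [topRows, mulVec, dotProduct] using congrFun hM 1
  · have hiff : LastRowSmall m (M * !![a, b; 0, d]) ↔ LastRowSmall m M := by
      refine ⟨fun H => ?_, fun H => H.mul_upper _⟩
      have h2 : (!![a, b; 0, d] : Matrix (Fin 2) (Fin 2) F) * !![a, b; 0, d]⁻¹ = 1 :=
        Matrix.mul_nonsing_inv _ (by simp [det_fin_two, ha, hd])
      have := H.mul_upper (!![a, b; 0, d]⁻¹)
      rwa [Matrix.mul_assoc, h2, Matrix.mul_one] at this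
    by_cases H : LastRowSmall m M
    · rw [extendLevi, extendLevi, if_pos (hiff.2 H), if_pos H, topRows_mul,
        leviFun_mul_upper hφ _ ha hd]
    · rw [extendLevi, extendLevi, if_neg (mt hiff.1 H), if_neg H, mul_zero]
  · by_cases H : LastRowSmall m M
    · obtain ⟨H', κ, hκ, htop⟩ := H.parahoric_mul hm hk
      rw [extendLevi, extendLevi, if_pos H', if_pos H, htop, hlev κ hκ]
    -- Outside the support, invariance needs the inverse of `k` in the parahoric set.
    · rw [extendLevi, extendLevi, if_neg H, if_neg]
      intro H'
      obtain ⟨k', hk', hkk⟩ := exists_parahoric_inv hm hk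
      have := (H'.parahoric_mul hm hk').1
      rw [← Matrix.mul_assoc, ← Matrix.map_mul, hkk] at this
      exact H (by simpa using this)
  · have hiff : LastRowSmall m (contr ((u : intRing F) : F) * M) ↔ LastRowSmall m M := by
      refine ⟨fun H => ?_, fun H => H.contr_mul _⟩
      have := H.contr_mul ((u⁻¹ : (intRing F)ˣ) : intRing F)
      rwa [← Matrix.mul_assoc, GL3Ind.contr_mul, ← Subring.coe_mul, Units.inv_mul, Subring.coe_one,
        contr_one, Matrix.one_mul] at this
    by_cases H : LastRowSmall m M
    · rw [extendLevi, extendLevi, if_pos (hiff.2 H), if_pos H, topRows_contr_mul]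
    · rw [extendLevi, extendLevi, if_neg (mt hiff.1 H), if_neg H]

theorem extendLevi_of_last_row_zero (χ₃ : Fˣ →* Cˣ) (m : ℕ) (φ : levi F → C) (x₁ x₂ y₁ y₂ : F) :
    col (extendLevi χ₃ m φ) x₁ x₂ 0 y₁ y₂ 0 = leviFun χ₃ φ !![x₁, y₁; x₂, y₂] := by
  rw [col, extendLevi, if_pos]
  · rfl
  · refine ⟨0, fun i => zero_mem _, ?_⟩
    funext j
    fin_cases j <;> simp [vecMul, dotProduct]

/-- Elements of the Levi subgroup are products of a block matrix and an element of `B`. -/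
theorem levi_eq_blockLevi_mul (ℓ : levi F) : ∃ (A : GL (Fin 2) F) (b : levi F),
    b.1 ∈ borelGL F ∧ ℓ = blockLevi A * b ∧ b.1 0 0 = 1 ∧ b.1 1 1 = 1 ∧
      A.1 = !![ℓ.1 0 0, ℓ.1 0 1; ℓ.1 1 0, ℓ.1 1 1] := by
  obtain ⟨g, h02, h12, h20, h21⟩ := ℓ
  have hd := GeneralLinearGroup.det_ne_zero g
  have hg : g.1 = !![g.1 0 0, g.1 0 1, 0; g.1 1 0, g.1 1 1, 0; 0, 0, g.1 2 2] := by
    refine Matrix.ext fun i j => ?_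
    fin_cases i <;> fin_cases j <;> first | rfl | assumption
  rw [hg, det_fin_three] at hd
  have hd' : (g.1 0 0 * g.1 1 1 - g.1 0 1 * g.1 1 0) * g.1 2 2 ≠ 0 := by
    simpa [sub_mul] using hd
  let A : GL (Fin 2) F := .mkOfDetNeZero !![g.1 0 0, g.1 0 1; g.1 1 0, g.1 1 1] (by
    rw [det_fin_two_of]
    exact left_ne_zero_of_mul hd')
  let b : GL (Fin 3) F := .mkOfDetNeZero !![1, 0, 0; 0, 1, 0; 0, 0, g.1 2 2] (by
    simpa [det_fin_three] using right_ne_zero_of_mul hd')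
  refine ⟨A, ⟨b, rfl, rfl, rfl, rfl⟩, fun i j hij => ?_, Subtype.ext (Units.ext ?_), rfl, rfl, rfl⟩
  · fin_cases i <;> fin_cases j <;> first | rfl | simp at hij
  · change g.1 = (blockLevi A).1.1 * b.1
    rw [hg, val_blockLevi]
    refine Matrix.ext fun i j => ?_
    fin_cases i <;> fin_cases j <;>
      simp [A, b, GeneralLinearGroup.mkOfDetNeZero, Matrix.mul_apply, Fin.sum_univ_three]

end LeviExtension

/-! ### Values of functions on the group at the cell representatives -/

section Values

open Matrix

variable {F : Type*} [NontriviallyNormedField F] [IsUltrametricDist F] {C : Type*} [Field C]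
variable [IsDiscreteValuationRing (intRing F)]

theorem HasLevel.isLocallyConstant {φ : intRing F → C} (h : HasLevel φ) :
    IsLocallyConstant φ := by
  obtain ⟨n, hn⟩ := h
  obtain ⟨ϖ, hϖ⟩ := IsDiscreteValuationRing.exists_irreducible (intRing F)
  rw [IsLocallyConstant.iff_eventually_eq]
  intro x
  filter_upwards [Metric.ball_mem_nhds x (pow_pos (norm_uniformizer_pos hϖ) n)] with y hy
  refine hn y x ((mem_pow_iff_norm hϖ).2 ?_)
  rw [mem_ball_iff_norm] at hy
  exact hy.le

variable {χ : Fin 3 → Fˣ →* Cˣ} {f : GL (Fin 3) F → C}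

/-- The representatives in the theorem have determinant `1`, so the twist by `χ₃(det)` is invisible.
-/
theorem apply_eq_col (hf : ∀ g, ∀ b ∈ borelGL F, f (g * b) = (torusChar χ b)⁻¹ * f g)
    {g : GL (Fin 3) F} {x₁ x₂ x₃ y₁ y₂ y₃ z₁ z₂ z₃ : F}
    (hg : g.1 = !![x₁, y₁, z₁; x₂, y₂, z₂; x₃, y₃, z₃])
    (hd : (!![x₁, y₁, z₁; x₂, y₂, z₂; x₃, y₃, z₃] : Matrix (Fin 3) (Fin 3) F).det = 1) :
    f g = col (toFlag (χ 2) f) x₁ x₂ x₃ y₁ y₂ y₃ := by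
  have h1 : firstCols g = !![x₁, y₁; x₂, y₂; x₃, y₃] := by
    rw [firstCols, hg]
    rfl
  rw [col, ← h1, toFlag_firstCols hf, hg, hd, extZero_one, one_mul]

theorem val_lowMat (a b c : F) : (lowMat a b c).1 = !![1, 0, 0; a, 1, 0; b, c, 1] := rfl

theorem val_mixMat (a b c : F) : (mixMat a b c).1 = !![1, a, 0; 0, 1, 0; c, b, 1] := rfl

theorem val_s₁ : (s₁ F).1 = !![0, -1, 0; 1, 0, 0; 0, 0, 1] := rfl

theorem val_s₂ : (s₂ F).1 = !![1, 0, 0; 0, 0, -1; 0, 1, 0] := rfl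

theorem apply_lowMat (hf : ∀ g, ∀ b ∈ borelGL F, f (g * b) = (torusChar χ b)⁻¹ * f g) (a b c : F) :
    f (lowMat a b c) = col (toFlag (χ 2) f) 1 a b 0 1 c :=
  apply_eq_col hf (val_lowMat a b c) (by simp [det_fin_three])

theorem apply_mixMat_s₁ (hf : ∀ g, ∀ b ∈ borelGL F, f (g * b) = (torusChar χ b)⁻¹ * f g)
    (a b c : F) : f (mixMat a b c * s₁ F) = col (toFlag (χ 2) f) a 1 b (-1) 0 (-c) := by
  refine apply_eq_col hf (z₁ := 0) (z₂ := 0) (z₃ := 1) ?_ (by simp [det_fin_three])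
  rw [Units.val_mul, val_mixMat, val_s₁]
  ext i j
  fin_cases i <;> fin_cases j <;> simp [Matrix.mul_apply, Fin.sum_univ_three]

theorem apply_lowMat_s₂ (hf : ∀ g, ∀ b ∈ borelGL F, f (g * b) = (torusChar χ b)⁻¹ * f g)
    (a c : F) : f (lowMat a c 0 * s₂ F) = col (toFlag (χ 2) f) 1 a c 0 0 1 := by
  refine apply_eq_col hf (z₁ := 0) (z₂ := -1) (z₃ := 0) ?_ (by simp [det_fin_three])
  rw [Units.val_mul, val_lowMat, val_s₂]
  ext i j
  fin_cases i <;> fin_cases j <;> simp [Matrix.mul_apply, Fin.sum_univ_three]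

theorem apply_mixMat_s₁s₂ (hf : ∀ g, ∀ b ∈ borelGL F, f (g * b) = (torusChar χ b)⁻¹ * f g)
    (a c : F) : f (mixMat a c 0 * (s₁ F * s₂ F)) = col (toFlag (χ 2) f) a 1 c 0 0 1 := by
  refine apply_eq_col hf (z₁ := 1) (z₂ := 0) (z₃ := 0) ?_ (by simp [det_fin_three])
  rw [Units.val_mul, Units.val_mul, val_mixMat, val_s₁, val_s₂]
  ext i j
  fin_cases i <;> fin_cases j <;> simp [Matrix.mul_apply, Fin.sum_univ_three]

theorem apply_lowMat_s₂s₁ (hf : ∀ g, ∀ b ∈ borelGL F, f (g * b) = (torusChar χ b)⁻¹ * f g)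
    (a : F) : f (lowMat a 0 0 * (s₂ F * s₁ F)) = col (toFlag (χ 2) f) 0 0 1 (-1) (-a) 0 := by
  refine apply_eq_col hf (z₁ := 0) (z₂ := -1) (z₃ := 0) ?_ (by simp [det_fin_three])
  rw [Units.val_mul, Units.val_mul, val_lowMat, val_s₁, val_s₂]
  ext i j
  fin_cases i <;> fin_cases j <;> simp [Matrix.mul_apply, Fin.sum_univ_three]

theorem apply_mixMat_w₀ (hf : ∀ g, ∀ b ∈ borelGL F, f (g * b) = (torusChar χ b)⁻¹ * f g)
    (a : F) : f (mixMat a 0 0 * w₀ F) = col (toFlag (χ 2) f) 0 0 1 (-a) (-1) 0 := by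
  refine apply_eq_col hf (z₁ := 1) (z₂ := 0) (z₃ := 0) ?_ (by simp [det_fin_three])
  rw [w₀, Units.val_mul, Units.val_mul, Units.val_mul, val_mixMat, val_s₁, val_s₂]
  ext i j
  fin_cases i <;> fin_cases j <;> simp [Matrix.mul_apply, Fin.sum_univ_three]

end Values

/-! ### The second flag function -/

section Flip

open Matrix

variable {F : Type*} [NontriviallyNormedField F] [IsUltrametricDist F] {C : Type*} [Field C]
variable [IsDiscreteValuationRing (intRing F)]
variable {η₁₂ η₂ : Fˣ →* Cˣ} {m : ℕ} {h : Matrix (Fin 3) (Fin 2) F → C}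

/-- The translate of `h` by the representative of the first simple reflection. -/
def flipFlag (η₂ : Fˣ →* Cˣ) (h : Matrix (Fin 3) (Fin 2) F → C) : Matrix (Fin 3) (Fin 2) F → C :=
  extZero η₂ (-1 : F) • swapRow h

theorem extZero_neg_one_mul_self (η : Fˣ →* Cˣ) :
    (extZero η (-1 : F) : C) * extZero η (-1 : F) = 1 := by
  rw [← extZero_mul, neg_mul_neg, one_mul, extZero_one]

theorem extZero_neg (η : Fˣ →* Cˣ) (x : F) :
    (extZero η (-x) : C) = extZero η (-1 : F) * extZero η x := by
  rw [← extZero_mul, neg_one_mul]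

theorem col_flipFlag (x₁ x₂ x₃ y₁ y₂ y₃ : F) : col (flipFlag η₂ h) x₁ x₂ x₃ y₁ y₂ y₃ =
    extZero η₂ (-1 : F) * col h x₂ x₁ x₃ y₂ y₁ y₃ := by
  rw [← col_swapRow (h := h)]
  rfl

theorem flipFlag_mem (hh : h ∈ flagSpace η₁₂ η₂ m) : flipFlag η₂ h ∈ flagSpace η₁₂ η₂ m :=
  Submodule.smul_mem _ _ (swapRow_mem hh)

/-- Explains the factor `η₂(-1)` in `flipFlag`: it accounts for the sign in the second column of
`ṡ₁`. -/
theorem col_flipFlag_neg (hh : h ∈ flagSpace η₁₂ η₂ m) (x₁ x₂ x₃ y₁ y₂ y₃ : F) :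
    col (flipFlag η₂ h) x₁ x₂ x₃ y₁ y₂ y₃ = col h x₂ x₁ x₃ (-y₂) (-y₁) (-y₃) := by
  have := col_smul₂ hh (neg_ne_zero.2 (one_ne_zero (α := F))) x₂ x₁ x₃ y₂ y₁ y₃
  rw [neg_one_mul, neg_one_mul, neg_one_mul] at this
  rw [this, col_flipFlag]

variable [Finite (IsLocalRing.ResidueField (intRing F))] [CharZero C]

theorem flipFlag_eigen (hh : h ∈ flagSpace η₁₂ η₂ m) (he : IsFlagEigen h) :
    IsFlagEigen (flipFlag η₂ h) := by
  intro x hx M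
  rw [flipFlag, flagAvg_smul _ (isUnipInv_of_mem (swapRow_mem hh)) hx, Pi.smul_apply, Pi.smul_apply,
    swapRow_eigen hh he x hx]

end Flip

/-! ### Bijectivity of the restriction to the Levi subgroup. -/

section Final

open Matrix

variable {F : Type*} [NontriviallyNormedField F] [IsUltrametricDist F] {C : Type*} [Field C]
variable [IsDiscreteValuationRing (intRing F)] [Finite (IsLocalRing.ResidueField (intRing F))]
variable [CharZero C]
variable {χ : Fin 3 → Fˣ →* Cˣ}

theorem hasLevel_extZero_mul_col {η₁₂ η₂ : Fˣ →* Cˣ} (hη₂ : IsSmoothChar η₂) {m : ℕ}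
    {h : Matrix (Fin 3) (Fin 2) F → C} (hh : h ∈ flagSpace η₁₂ η₂ m) (a b : intRing F)
    {c : intRing F} (hc : c ∈ maxIdeal F) :
    HasLevel fun t : intRing F => extZero η₂ (1 + c * t : F) * col h 1 (a + b * t) 0 0 1 0 := by
  have h1 := hasLevel_extZero_one_add hη₂ 1 fun t => isUnit_one_add (Ideal.mul_mem_right t _ hc)
  rw [Subring.coe_one] at h1
  exact h1.mul ⟨m, isLevel_col_one hh a b⟩

theorem theta_injective (hη : IsSmoothChar ((χ 0)⁻¹ * χ 2)) (hη₂ : IsSmoothChar ((χ 1)⁻¹ * χ 2))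
    (hχ : ∀ i, IsLocallyConstant (χ i)) [CompactSpace (intRing F)]
    {ϖ : intRing F} (hϖ : Irreducible ϖ)
    (hne : charConductor ((χ 1)⁻¹ * χ 2) = 0 →
      (resCard F : C) - extZero ((χ 1)⁻¹ * χ 2) (ϖ : F) ≠ 0)
    (hne' : charConductor ((χ 0)⁻¹ * χ 2) = 0 →
      (resCard F : C) ^ 2 - extZero ((χ 0)⁻¹ * χ 2) (ϖ : F) ≠ 0) :
    Function.Injective (theta χ) := by
  rw [← LinearMap.ker_eq_bot, LinearMap.ker_eq_bot']
  rintro ⟨f, hf⟩ hθ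
  have hb := hf.1.2
  have h0 : ∀ ℓ : levi F, f ℓ = 0 := fun ℓ => congrFun (congrArg Subtype.val hθ) ℓ
  obtain ⟨m, -, hm⟩ := toFlag_mem_flagSpace hχ hf
  have hv : VanishesOnLevi (toFlag (χ 2) f) := by
    intro x₁ x₂ y₁ y₂
    -- A singular top block means rank less than two, where the flag function is zero; otherwise the
    -- matrix comes from `L`.
    by_cases hd : (!![x₁, y₁; x₂, y₂] : Matrix (Fin 2) (Fin 2) F).det = 0
    · obtain ⟨c, hc, hc'⟩ := exists_mulVec_eq_zero_iff.2 hd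
      refine hm.1 _ c hc (funext fun i => ?_)
      fin_cases i
      · simpa [mulVec, dotProduct] using congrFun hc' 0
      · simpa [mulVec, dotProduct] using congrFun hc' 1
      · simp [mulVec, dotProduct]
    · have h1 := toFlag_firstCols hb (blockLevi (.mkOfDetNeZero _ hd)).1
      rw [h0, mul_zero] at h1
      exact h1
  have h1 := eq_zero_of_vanishesOnLevi hη hη₂ hm (isFlagEigen_toFlag hf) hϖ hne hne' hv
  refine Subtype.ext (funext fun g => ?_)
  have h2 := toFlag_firstCols hb g
  rw [h1] at h2
  exact (mul_eq_zero.1 h2.symm).resolve_left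
    (extZero_ne_zero _ (GeneralLinearGroup.det_ne_zero g))

theorem theta_surjective (hη : IsSmoothChar ((χ 0)⁻¹ * χ 2)) (hη₂ : IsSmoothChar ((χ 1)⁻¹ * χ 2))
    (hχ : ∀ i, IsLocallyConstant (χ i)) [CompactSpace (intRing F)]
    {ϖ : intRing F} (hϖ : Irreducible ϖ)
    (hne : charConductor ((χ 1)⁻¹ * χ 2) = 0 →
      (resCard F : C) - extZero ((χ 1)⁻¹ * χ 2) (ϖ : F) ≠ 0)
    (hne' : charConductor ((χ 0)⁻¹ * χ 2) = 0 →
      (resCard F : C) ^ 2 - extZero ((χ 0)⁻¹ * χ 2) (ϖ : F) ≠ 0) :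
    Function.Surjective (theta χ) := by
  rintro ⟨φ, hφ⟩
  obtain ⟨m, hm, hlev⟩ := exists_level_leviFun hχ hφ
  obtain ⟨h, hh, hE, hh₀⟩ := exists_isFlagEigen hη hη₂ hϖ hne hne' hm (extendLevi_mem hφ hm hlev)
  have hf := ofFlag_mem_eigenInd hχ hh hE
  refine ⟨⟨_, hf⟩, Subtype.ext (funext fun ℓ => ?_)⟩
  change ofFlag (χ 2) h ℓ.1 = φ ℓ
  obtain ⟨A, b, hb, rfl, -⟩ := levi_eq_blockLevi_mul ℓ
  rw [hφ.2 _ _ hb, Subgroup.coe_mul, hf.1.2 _ _ hb]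
  congr 1
  have h1 : col h (A 0 0) (A 1 0) 0 (A 0 1) (A 1 1) 0 = leviFun (χ 2) φ A.1 := by
    rw [hh₀, extendLevi_of_last_row_zero]
    congr 1
    exact Matrix.ext fun i j => by fin_cases i <;> fin_cases j <;> rfl
  have h2 : h (firstCols (blockLevi A).1) = leviFun (χ 2) φ A.1 := h1
  have h3 : (blockLevi A).1.1.det = A.1.det := by
    rw [val_blockLevi, det_fin_three, det_fin_two]
    simp
  rw [ofFlag, h2, leviFun_coe, h3,
    inv_mul_cancel_left₀ (extZero_ne_zero _ (GeneralLinearGroup.det_ne_zero A))]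

end Final

end

end GL3Ind

/-! ### The isomorphism and the values on the six cells. -/

theorem mainTheorem5 {p : ℕ} [Fact p.Prime]
    {F : Type*} [NontriviallyNormedField F] [IsUltrametricDist F]
    [NormedAlgebra ℚ_[p] F] [FiniteDimensional ℚ_[p] F]
    {C : Type*} [Field C] [Algebra ℚ_[p] C] [FiniteDimensional ℚ_[p] C]
    (χ : Fin 3 → Fˣ →* Cˣ) (hχ : ∀ i, IsLocallyConstant (χ i))
    (η₁ η₂ : Fˣ →* Cˣ) (hη₁ : η₁ = (χ 0)⁻¹ * χ 1) (hη₂ : η₂ = (χ 1)⁻¹ * χ 2)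
    (h₂ : (fun x : Fˣ => (η₂ x : C)) ≠ fun x => (absF C x)⁻¹)
    (h₁₂ : (fun x : Fˣ => ((η₁ * η₂) x : C)) ≠ fun x => (absF C x ^ 2)⁻¹)
    (ϖ : intRing F) (hϖ : Irreducible ϖ) (q : C) (hq : q = (resCard F : C)) :
    -- restriction to `L` is an isomorphism
    Function.Bijective (theta χ) ∧
    ∀ f ∈ eigenInd χ,
      -- all the integrands below are locally constant
      ((∀ a b c : intRing F, b ∈ maxIdeal F → c ∈ maxIdeal F →
          IsLocallyConstant fun t : intRing F =>
            extZero η₂ (1 + c * t) * f (lowMat (a + b * t : F) 0 0)) ∧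
        (∀ a b c : intRing F, b ∈ maxIdeal F → c ∈ maxIdeal F →
          IsLocallyConstant fun t : intRing F =>
            extZero η₂ (1 + c * t) * f (mixMat (a + b * t : F) 0 0 * s₁ F)) ∧
        (∀ a c : intRing F, IsLocallyConstant fun t : intRing F =>
            extZero η₂ t * (f (lowMat (a + c * t : F) 0 0) - f (lowMat (a : F) 0 0))) ∧
        (∀ a c : intRing F, IsLocallyConstant fun t : intRing F =>
            extZero η₂ t *
              (f (mixMat (a - c * t : F) 0 0 * s₁ F) - f (mixMat (a : F) 0 0 * s₁ F))) ∧
        (∀ a : intRing F, IsLocallyConstant <| onMaxIdeal fun t : intRing F =>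
            extZero η₂ (1 - a * t) * f (mixMat (t : F) 0 0 * s₁ F)) ∧
        (∀ a : intRing F, IsLocallyConstant <| onMaxIdeal fun t : intRing F =>
            extZero η₂ (-1 + a * t) * f (lowMat (t : F) 0 0))) ∧
      -- the cell of `1`
      (∀ a b c : intRing F, b ∈ maxIdeal F → c ∈ maxIdeal F →
        f (lowMat (a : F) b c) =
          delta (b ∈ maxIdeal F ^ charConductor (η₁ * η₂)) *
            integralO fun t : intRing F =>
              extZero η₂ (1 + c * t) * f (lowMat (a + b * t : F) 0 0)) ∧
      -- the cell of `s₁`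
      (∀ a b c : intRing F, b ∈ maxIdeal F → c ∈ maxIdeal F →
        f (mixMat (a : F) b c * s₁ F) =
          delta (b ∈ maxIdeal F ^ charConductor (η₁ * η₂)) *
            integralO fun t : intRing F =>
              extZero η₂ (1 + c * t) * f (mixMat (a + b * t : F) 0 0 * s₁ F)) ∧
      -- the cell of `s₂`
      (∀ a c : intRing F, c ∈ maxIdeal F →
        f (lowMat (a : F) c 0 * s₂ F) =
          delta (c ∈ maxIdeal F ^ charConductor (η₁ * η₂)) *
            ((integralO fun t : intRing F => extZero η₂ t *
                (f (lowMat (a + c * t : F) 0 0) - f (lowMat (a : F) 0 0))) +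
              delta (charConductor η₂ = 0) * ((q - 1) / (q - extZero η₂ ϖ)) *
                f (lowMat (a : F) 0 0))) ∧
      -- the cell of `s₁ s₂`
      (∀ a c : intRing F, c ∈ maxIdeal F →
        f (mixMat (a : F) c 0 * (s₁ F * s₂ F)) =
          delta (c ∈ maxIdeal F ^ charConductor (η₁ * η₂)) *
            ((integralO fun t : intRing F => extZero η₂ t *
                (f (mixMat (a - c * t : F) 0 0 * s₁ F) - f (mixMat (a : F) 0 0 * s₁ F))) +
              delta (charConductor η₂ = 0) * ((q - 1) / (q - extZero η₂ ϖ)) *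
                f (mixMat (a : F) 0 0 * s₁ F))) ∧
      -- the cell of `s₂ s₁`
      (∀ a : intRing F,
        f (lowMat (a : F) 0 0 * (s₂ F * s₁ F)) =
          delta (charConductor (η₁ * η₂) = 0) *
            (q * (q - 1) / (q ^ 2 - extZero (η₁ * η₂) ϖ)) *
            ((integralO fun t : intRing F => extZero η₂ t *
                (f (lowMat (a + t : F) 0 0) - f (lowMat (a : F) 0 0))) +
              delta (charConductor η₂ = 0) * ((q - 1) / (q - extZero η₂ ϖ)) *
                f (lowMat (a : F) 0 0) +
              integralO (onMaxIdeal fun t : intRing F =>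
                extZero η₂ (1 - a * t) * f (mixMat (t : F) 0 0 * s₁ F)))) ∧
      -- the cell of `w₀`
      (∀ a : intRing F,
        f (mixMat (a : F) 0 0 * w₀ F) =
          delta (charConductor (η₁ * η₂) = 0) *
            (q * (q - 1) / (q ^ 2 - extZero (η₁ * η₂) ϖ)) *
            ((integralO fun t : intRing F => extZero η₂ t *
                (f (mixMat (a - t : F) 0 0 * s₁ F) - f (mixMat (a : F) 0 0 * s₁ F))) +
              delta (charConductor η₂ = 0) * ((q - 1) / (q - extZero η₂ ϖ)) *
                f (mixMat (a : F) 0 0 * s₁ F) +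
              integralO (onMaxIdeal fun t : intRing F =>
                extZero η₂ (-1 + a * t) * f (lowMat (t : F) 0 0)))) := by
  obtain ⟨_, _, _⟩ := discreteValuationRing_and_finite_of_finiteDimensional (p := p) F
  have : CharZero C := charZero_of_injective_algebraMap (algebraMap ℚ_[p] C).injective
  have hη₁₂ : η₁ * η₂ = (χ 0)⁻¹ * χ 2 := by
    rw [hη₁, hη₂]
    ext x
    simp
  have hs₂ : IsSmoothChar η₂ := by
    rw [hη₂]
    exact (isSmoothChar_of_isLocallyConstant (hχ 1)).inv.mul
      (isSmoothChar_of_isLocallyConstant (hχ 2))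
  have hs₁₂ : IsSmoothChar (η₁ * η₂) := by
    rw [hη₁₂]
    exact (isSmoothChar_of_isLocallyConstant (hχ 0)).inv.mul
      (isSmoothChar_of_isLocallyConstant (hχ 2))
  -- An unramified character is determined by its value at `ϖ`, so a vanishing denominator would
  -- make `η₂` equal to `|·|⁻¹`, and likewise `η₁η₂` equal to `|·|⁻²`.
  have hne : charConductor η₂ = 0 → (resCard F : C) - extZero η₂ (ϖ : F) ≠ 0 := by
    intro h0 h1
    refine h₂ ((coe_char_eq_absF hϖ hs₂ h0 (k := 1) ?_).trans ?_)
    · rw [pow_one, sub_eq_zero.1 h1]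
    · simp only [pow_one]
  have hne' : charConductor (η₁ * η₂) = 0 →
      (resCard F : C) ^ 2 - extZero (η₁ * η₂) (ϖ : F) ≠ 0 := fun h0 h1 =>
    h₁₂ (coe_char_eq_absF hϖ hs₁₂ h0 (k := 2) (sub_eq_zero.1 h1).symm)
  refine ⟨⟨?_, ?_⟩, fun f hf => ?_⟩
  · rw [hη₁₂] at hs₁₂ hne'
    rw [hη₂] at hs₂ hne
    exact theta_injective hs₁₂ hs₂ hχ hϖ hne hne'
  · rw [hη₁₂] at hs₁₂ hne'
    rw [hη₂] at hs₂ hne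
    exact theta_surjective hs₁₂ hs₂ hχ hϖ hne hne'
  have hb := hf.1.2
  obtain ⟨m, -, hh⟩ := toFlag_mem_flagSpace hχ hf
  have he := isFlagEigen_toFlag hf
  rw [← hη₁₂, ← hη₂] at hh
  have hh' := flipFlag_mem hh
  have he' := flipFlag_eigen hh he
  have hε := extZero_neg_one_mul_self (C := C) η₂
  set h := toFlag (χ 2) f with hdef
  have hlow : ∀ a b c : F, f (lowMat a b c) = col h 1 a b 0 1 c := apply_lowMat hb
  have hmix : ∀ a b c : F, f (mixMat a b c * s₁ F) = col (flipFlag η₂ h) 1 a b 0 1 c := by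
    intro a b c
    rw [col_flipFlag_neg hh, neg_zero]
    exact apply_mixMat_s₁ hb a b c
  have hmix' : ∀ t : F, f (mixMat t 0 0 * s₁ F) = col h t 1 0 (-1) 0 0 := by
    intro t
    rw [apply_mixMat_s₁ hb, neg_zero]
  have hlow' : ∀ t : F, col (flipFlag η₂ h) t 1 0 (-1) 0 0 = f (lowMat t 0 0) := by
    intro t
    rw [col_flipFlag_neg hh, hlow, neg_zero, neg_neg]
  have hneg : ∀ a t : F, extZero η₂ (-1 + a * t) =
      (extZero η₂ (-1 : F) : C) * extZero η₂ (1 - a * t) := by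
    intro a t
    rw [← extZero_neg, neg_sub, sub_eq_neg_add]
  have hlast : ∀ a : intRing F, (onMaxIdeal fun t : intRing F =>
      extZero η₂ (-1 + a * t : F) * f (lowMat (t : F) 0 0)) = fun t => extZero η₂ (-1 : F) *
        onMaxIdeal (fun t : intRing F => extZero η₂ (1 - a * t : F) *
          col (flipFlag η₂ h) t 1 0 (-1) 0 0) t := by
    intro a
    funext t
    by_cases ht : t ∈ maxIdeal F
    · rw [onMaxIdeal_of_mem ht, onMaxIdeal_of_mem ht, hneg, hlow', mul_assoc]
    · rw [onMaxIdeal_of_notMem ht, onMaxIdeal_of_notMem ht, mul_zero]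
  have hsub : ∀ a c : intRing F, (fun t : intRing F => extZero η₂ (t : F) *
      (f (mixMat (a - c * t : F) 0 0 * s₁ F) - f (mixMat (a : F) 0 0 * s₁ F))) =
      fun t : intRing F => extZero η₂ (t : F) * (col (flipFlag η₂ h) 1 (a + (-c : intRing F) * t)
        0 0 1 0 - col (flipFlag η₂ h) 1 a 0 0 1 0) := by
    intro a c
    funext t
    rw [hmix, hmix, Subring.coe_neg, neg_mul, ← sub_eq_add_neg]
  subst hq
  refine ⟨⟨?_, ?_, ?_, ?_, ?_, ?_⟩, ?_, ?_, ?_, ?_, ?_, ?_⟩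
  · intro a b c _ hc
    simp only [hlow]
    exact (hasLevel_extZero_mul_col hs₂ hh a b hc).isLocallyConstant
  · intro a b c _ hc
    simp only [hmix]
    exact (hasLevel_extZero_mul_col hs₂ hh' a b hc).isLocallyConstant
  · intro a c
    simp only [hlow]
    exact (hasLevel_extZero_mul_sub hh a c).isLocallyConstant
  · intro a c
    rw [hsub]
    exact (hasLevel_extZero_mul_sub hh' a (-c)).isLocallyConstant
  · intro a
    simp only [hmix']
    exact (hasLevel_onMaxIdeal_col hs₂ hh a).isLocallyConstant
  · intro a
    rw [hlast]
    exact (hasLevel_onMaxIdeal_col hs₂ hh' a).isLocallyConstant.comp _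
  · intro a b c hb hc
    simp only [hlow]
    exact col_cell_one hs₁₂ hh he a hb hc
  · intro a b c hb hc
    simp only [hmix]
    exact col_cell_one hs₁₂ hh' he' a hb hc
  · intro a c hc
    rw [apply_lowMat_s₂ hb]
    simp only [hlow]
    exact col_cell_two hs₁₂ hs₂ hh he hϖ hne a hc
  · intro a c hc
    -- The formula is applied with `-c`: the sign from `ṡ₁` in the second column is compensated by
    -- the unit `-1` in the last row, which turns `c` into `-c`.
    have h1 := col_cell_two hs₁₂ hs₂ hh' he' hϖ hne a (neg_mem hc)
    have h2 := col_unit hh' (-1) 1 a c 0 0 (-1)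
    have h3 : col (flipFlag η₂ h) 1 a ((-c : intRing F) : F) 0 0 1 =
        f (mixMat (a : F) c 0 * (s₁ F * s₂ F)) := by
      rw [apply_mixMat_s₁s₂ hb, ← hdef]
      simp only [Units.val_neg, Units.val_one, Subring.coe_neg, Subring.coe_one, neg_one_mul,
        neg_neg] at h2
      rw [Subring.coe_neg, h2, col_flipFlag_neg hh, neg_zero, neg_neg]
    rw [← h3, h1, hsub, hmix, neg_mem_iff]
  · intro a
    rw [apply_lowMat_s₂s₁ hb]
    simp only [hlow, hmix']
    exact col_cell_three hs₁₂ hs₂ hh he hϖ hne hne' a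
  · intro a
    have h1 := col_cell_three hs₁₂ hs₂ hh' he' hϖ hne hne' a
    have hl := hasLevel_extZero_mul_sub hh' a 1
    have hl' : HasLevel fun t : intRing F => extZero η₂ (t : F) *
        (f (mixMat (a - t : F) 0 0 * s₁ F) - f (mixMat (a : F) 0 0 * s₁ F)) := by
      have := hasLevel_extZero_mul_sub hh' a (-1)
      rw [← hsub] at this
      simpa only [Subring.coe_one, one_mul] using this
    -- Replacing `t` by `-t` turns `a - t` into `a + t` and produces `η₂(-1)`. The other two terms
    -- acquire the same factor, which cancels because its square is `1`.
    have h2 : (integralO fun t : intRing F => extZero η₂ (t : F) *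
        (f (mixMat (a - t : F) 0 0 * s₁ F) - f (mixMat (a : F) 0 0 * s₁ F))) =
        extZero η₂ (-1 : F) * integralO fun t : intRing F => extZero η₂ (t : F) *
          (col (flipFlag η₂ h) 1 (a + t) 0 0 1 0 - col (flipFlag η₂ h) 1 a 0 0 1 0) := by
      simp only [Subring.coe_one, one_mul] at hl
      rw [← integralO_unit_mul hl' (-1), ← integralO_const_mul _ hl]
      congr 1
      funext t
      rw [hmix, hmix, ← mul_assoc, ← extZero_neg]
      simp only [Units.val_neg, Units.val_one, neg_one_mul, Subring.coe_neg, sub_neg_eq_add]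
    -- If `η₂` is unramified, then `η₂(-1) = 1`; otherwise both sides vanish.
    have h3 : delta (charConductor η₂ = 0) = extZero η₂ (-1 : F) * (delta (charConductor η₂ = 0) : C) := by
      by_cases h0 : charConductor η₂ = 0
      · have := extZero_unit_eq_one hs₂ h0 (isUnit_one.neg)
        rw [Subring.coe_neg, Subring.coe_one] at this
        rw [this, one_mul]
      · rw [delta, if_neg h0, mul_zero]
    have h4 : col (flipFlag η₂ h) 0 0 1 (-1) (-a) 0 =
        extZero η₂ (-1 : F) * f (mixMat (a : F) 0 0 * w₀ F) := by
      rw [col_flipFlag, apply_mixMat_w₀ hb]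
    rw [h4] at h1
    rw [hlast, integralO_const_mul _ (hasLevel_onMaxIdeal_col hs₂ hh' a), h2, h3, hmix]
    generalize integralO (F := F) (C := C) _ = I at h1 ⊢
    generalize integralO (F := F) (C := C) _ = J at h1 ⊢
    linear_combination extZero η₂ (-1 : F) * h1 - f (mixMat (a : F) 0 0 * w₀ F) * hε
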